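/- Consider two classes $1,2$. For a finite family of (base, NN) label pairs ("NN" = nearest neighbor) let $N_{ij}$ be the number of pairs with base label $i$ and NN label $j$ (the entries of the nearest neighbor contingency table, NNCT), $N_i=\sum_j N_{ij}$, $C_j=\sum_i N_{ij}$, $n=\sum_{i,j}N_{ij}$, and $$\mathcal X_P^2=\sum_{i=1}^2\sum_{j=1}^2\frac{(N_{ij}-N_iC_j/n)^2}{N_iC_j/n}$$ (with $\mathcal X_P^2=0$ if a row or column of the table is empty). Let $0<\alpha<1$ and let Pielou's two-sided test reject when $\mathcal X_P^2>\chi^2_1(1-\alpha)$, the $(1-\alpha)$-quantile of the $\chi^2$ law with one degree of freedom. (I) Suppose the NNCT is based on a random sample of (base, NN) pairs, and let $\widetilde\pi_{ij}$ be the probability that the NN label is $j$ when the base label is $i$. This is meant in either of two frameworks: (row-wise binomial) the class sizes $n_1,n_2$ are given, the NN labels are independent with the row probabilities $\widetilde\pi_{ij}$, and $n_1,n_2\to\infty$; or (overall multinomial) the $n$ label pairs are i.i.d., both base classes have positive probability, $\widetilde\pi_{ij}$ is the conditional probability, and $n\to\infty$. In both frameworks: under $H_o:\widetilde\pi_{11}=\widetilde\pi_{21}\in(0,1)$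 the rejection probability tends to $\alpha$; under $H_a:\widetilde\pi_{11}\neq\widetilde\pi_{21}$ it tends to $1$. (II) Now let the table be that of completely mapped data: $n=n_1+n_2$ labeled points in the plane, each point taken with its nearest neighbor among the other points. (a) (Random labeling, RL.) For each member of a sequence of data sets let $n$ distinct locations be fixed, each with one of its nearest neighbors (ties broken in any fixed way), and let the labels be uniformly distributed over all labelings with $n_1$ points of class 1 and $n_2$ of class 2. If $n\to\infty$ and, for some $c>0$, eventually $n_1\ge cn$, $n_2\ge cn$ and $R\ge cn$, where $R$ is the number of reflexive (base, NN) pairs (i.e. twice the number of unordered pairs of points that are nearest neighbors of each other), then the test is liberal: there is $\delta>0$ such that its rejection probability is eventually at least $\alpha+\delta$. (b) (CSR independence.) Let $D\subset\mathbb R^2$ be measurable with positive finite area, and let $n_1$ points of class 1 and $n_2$ points of class 2 be independent and uniformly distributed on $D$. If $n\to\infty$ and, for some $c>0$, eventually $n_1\ge cn$ and $n_2\ge cn$, then the test is liberal: there is $\delta>0$ such that its rejection probability is eventually at least $\alpha+\delta$. (c) (Consistency.) For each member of a sequence of data sets let the points, with their labels, be independent, each marked point (location, label) having an arbitrary law of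 its own (so fixed locations with independent random labels, and fixed labels with independent random locations, are included), with locations almost surely distinct; ties between nearest neighbors are broken by the order of the points. If the expected class sizes $\mathbf E[N_1],\mathbf E[N_2]$ tend to $\infty$ and the alternative $\left|\frac{\mathbf E[N_{11}]}{\mathbf E[N_1]}-\frac{\mathbf E[N_{21}]}{\mathbf E[N_2]}\right|\ge\varepsilon$ holds eventually for some $\varepsilon>0$, then the rejection probability tends to $1$. -/

import Mathlib

open MeasureTheory ProbabilityTheory Filter Topology

/-! ### 2 × 2 contingency tables

The two classes are the elements of `Fin 2`: `0` is class 1 and `1` is class 2.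
A data set is a finite family of (base, NN) pairs, given by the base labels `u` and the
nearest-neighbour labels `v`. -/

/-- The cell frequency `N_ij`. -/
def cellCount {ι : Type*} [Fintype ι] (u v : ι → Fin 2) (i j : Fin 2) : ℕ :=
  (Finset.univ.filter fun k => u k = i ∧ v k = j).card

/-- The row sum `N_i = N_i1 + N_i2`. -/
def rowSum {ι : Type*} [Fintype ι] (u v : ι → Fin 2) (i : Fin 2) : ℕ :=
  ∑ j, cellCount u v i j

/-- The column sum `C_j = N_1j + N_2j`. -/
def colSum {ι : Type*} [Fintype ι] (u v : ι → Fin 2) (j : Fin 2) : ℕ :=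
  ∑ i, cellCount u v i j

/-- The (estimated) expected cell frequency `N_i C_j / n`, with `n` the number of pairs. -/
noncomputable def expectedCount {ι : Type*} [Fintype ι] (u v : ι → Fin 2) (i j : Fin 2) : ℝ :=
  (rowSum u v i : ℝ) * (colSum u v j : ℝ) / (Fintype.card ι : ℝ)

/-- Pielou's (= Pearson's) statistic `∑_i ∑_j (N_ij - N_i C_j / n)² / (N_i C_j / n)`.
A table with an empty row or column (for which the quotients are `0 / 0` in that row or column,
read as `0`) has the value `0`. -/
noncomputable def pielouStat {ι : Type*} [Fintype ι] (u v : ι → Fin 2) : ℝ :=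
  ∑ i, ∑ j, ((cellCount u v i j : ℝ) - expectedCount u v i j) ^ 2 / expectedCount u v i j

/-- The chi-square law with one degree of freedom: the law of the square of a standard normal. -/
noncomputable def chiSqOne : Measure ℝ :=
  (gaussianReal 0 1).map fun z => z ^ 2

/-- The `p`-quantile of the chi-square law with one degree of freedom. -/
noncomputable def chiSqOneQuantile (p : ℝ) : ℝ :=
  sInf {c : ℝ | p ≤ cdf chiSqOne c}

/-- Pielou's two-sided test at nominal level `α` rejects. -/
def PielouRejects {ι : Type*} [Fintype ι] (α : ℝ) (u v : ι → Fin 2) : Prop :=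
  chiSqOneQuantile (1 - α) < pielouStat u v

/-- The labelling of `m₁ + m₂` objects in which the first `m₁` have class 1, the others class 2. -/
def blockLabels (m₁ m₂ : ℕ) (k : Fin (m₁ + m₂)) : Fin 2 :=
  if (k : ℕ) < m₁ then 0 else 1

/-! ### Random samples of (base, NN) pairs -/

/-- Rejection probability in the row-wise binomial framework: there are `m₁` base points of
class 1 and `m₂` of class 2, the NN labels are independent, and the NN label of a base point of
class `i` has law `P i`. -/
noncomputable def rowwisePower (α : ℝ) (P : Fin 2 → Measure (Fin 2)) (m₁ m₂ : ℕ) : ℝ :=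
  (Measure.pi fun k => P (blockLabels m₁ m₂ k)).real
    {v : Fin (m₁ + m₂) → Fin 2 | PielouRejects α (blockLabels m₁ m₂) v}

/-- Rejection probability in the overall multinomial framework: `n` independent
(base label, NN label) pairs with common law `P`. -/
noncomputable def samplePower (α : ℝ) (P : Measure (Fin 2 × Fin 2)) (n : ℕ) : ℝ :=
  (Measure.pi fun _ : Fin n => P).real
    {w : Fin n → Fin 2 × Fin 2 | PielouRejects α (fun k => (w k).1) (fun k => (w k).2)}

/-- For a law `P` of a (base label, NN label) pair, the conditional probability
`P (NN label = j | base label = i)`. -/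
noncomputable def rowProb (P : Measure (Fin 2 × Fin 2)) (i j : Fin 2) : ℝ :=
  P.real {(i, j)} / P.real {p | p.1 = i}

/-! ### Completely mapped data -/

/-- The plane with its Euclidean distance. -/
abbrev Plane : Type := EuclideanSpace ℝ (Fin 2)

/-- `x j` is a nearest neighbour of `x i` among the other points of `x`. -/
def IsNN {n : ℕ} (x : Fin n → Plane) (i j : Fin n) : Prop :=
  j ≠ i ∧ ∀ k, k ≠ i → dist (x i) (x j) ≤ dist (x i) (x k)

open Classical in
/-- The nearest neighbour of `x i`; among several, the one with the least index.
(A single point, which has no nearest neighbour, is sent to itself.) -/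
noncomputable def nearest {n : ℕ} (x : Fin n → Plane) (i : Fin n) : Fin n :=
  if h : (Finset.univ.filter fun j => IsNN x i j).Nonempty
  then (Finset.univ.filter fun j => IsNN x i j).min' h else i

/-- The number `R` of reflexive (base, NN) pairs (twice the number of unordered mutual pairs). -/
def reflexiveCount {n : ℕ} (nn : Fin n → Fin n) : ℕ :=
  (Finset.univ.filter fun i => nn (nn i) = i).card

/-- Rejection probability under random labelling: the NN assignment `nn` is fixed, and the labels
are uniformly distributed over all labellings with `m₁` points of class 1 and `m₂` of class 2. -/
noncomputable def rlLevel (α : ℝ) (m₁ m₂ : ℕ) (nn : Fin (m₁ + m₂) → Fin (m₁ + m₂)) : ℝ :=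
  (uniformOn {l : Fin (m₁ + m₂) → Fin 2 | (Finset.univ.filter fun k => l k = 0).card = m₁}).real
    {l | PielouRejects α l (l ∘ nn)}

/-- Rejection probability under CSR independence on the region `D`: `m₁` points of class 1 and
`m₂` points of class 2, all independent and uniformly distributed on `D`. -/
noncomputable def csrLevel (α : ℝ) (D : Set Plane) (m₁ m₂ : ℕ) : ℝ :=
  (Measure.pi fun _ : Fin (m₁ + m₂) => (volume : Measure Plane)[|D]).real
    {x | PielouRejects α (blockLabels m₁ m₂) (blockLabels m₁ m₂ ∘ nearest x)}

/-- The base labels of a family of marked points (location, class). -/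
def labels {n : ℕ} (ω : Fin n → Plane × Fin 2) (k : Fin n) : Fin 2 := (ω k).2

/-- The NN labels of a family of marked points. -/
noncomputable def nnLabels {n : ℕ} (ω : Fin n → Plane × Fin 2) (k : Fin n) : Fin 2 :=
  (ω (nearest (fun m => (ω m).1) k)).2

/-- Expected cell frequency `E[N_ij]` of the NNCT of `n` independent marked points, the `k`-th one
with law `μ k`. -/
noncomputable def meanCell {n : ℕ} (μ : Fin n → Measure (Plane × Fin 2)) (i j : Fin 2) : ℝ :=
  ∫ ω, (cellCount (labels ω) (nnLabels ω) i j : ℝ) ∂(Measure.pi μ)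

/-- Expected number `E[N_i]` of points of class `i`. -/
noncomputable def meanRow {n : ℕ} (μ : Fin n → Measure (Plane × Fin 2)) (i : Fin 2) : ℝ :=
  ∑ j, meanCell μ i j

/-- The probability `E[N_ij] / E[N_i]` of NN class `j` for a base point of class `i`. -/
noncomputable def mappedRowProb {n : ℕ} (μ : Fin n → Measure (Plane × Fin 2)) (i j : Fin 2) : ℝ :=
  meanCell μ i j / meanRow μ i

/-- Rejection probability for `n` independent marked points, the `k`-th one with law `μ k`. -/
noncomputable def mappedPower (α : ℝ) {n : ℕ} (μ : Fin n → Measure (Plane × Fin 2)) : ℝ :=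
  (Measure.pi μ).real {ω | PielouRejects α (labels ω) (nnLabels ω)}

/-! When no row or column is empty, the statistic equals `n (N₁₁ n - N₁ C₁)² / (N₁ N₂ C₁ C₂)`
(`pielouStat_eq`). Moreover `N₁₁ - N₁ C₁ / n` is the linear form `∑ a_k (v_k - q)` in the NN
indicators `v_k`, where `a_k` are the base indicators minus their mean. The constant `q` is
arbitrary because `∑ a_k = 0` (`cellCount_sub_expected_eq_sum`). Size statements are therefore
central limit theorems for this form. Consistency statements are concentration of the two row
proportions, since the statistic is at least a constant times the smaller row sum times the squared
difference of these proportions (`le_pielouStat`).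

Random samples. Given the base labels, the form under the null hypothesis is a weighted sum of
independent centred Bernoulli variables. The Lyapunov argument applies, because the weights are at
most 1 and `∑ a_k² = N₁ N₂ / n` tends to infinity. The column sums concentrate, so the estimated
variance may be replaced by the true one (`pielouStat_sandwich`, `tendsto_tail_of_sandwich`). The
multinomial framework is a mixture over the base labels, and both class counts tend to infinity in
probability (`samplePower_eq_integral`, `tendsto_integral_iid_labels`).

Random labelling. Now `v_k` is the base label of the neighbour `η k`, and with `q` the class
proportion the form becomes `T = ∑ a_i a_{η i}`. Its variance is asymptotically `p² (1 - p)² (n +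
R)`, whereas Pielou's normalisation corresponds to `p² (1 - p)² n`: a reflexive pair contributes the
same product twice. The statistic thus behaves like `(1 + R / n) Z²`, and it exceeds the chi-square
quantile with probability strictly above `α` when `R / n` stays away from zero. Normality of `T` is
obtained by an exchangeable-pair argument in the manner of Stein. Transposing the labels at `η i`
and `k` gives an exact identity (`IsSwapInvariant.integral_nnForm_mul`). Its first-order expansion
shows that the characteristic function `ψ` of `T / s` nearly solves `ψ' = -t ψ`
(`IsSwapInvariant.norm_charFun_nnForm_sub_le`). Geometry enters only through the bounded in-degree
of nearest-neighbour maps in the plane (`card_isNN_le`).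

CSR independence. By exchangeability the level is the mean over the locations of the random
labelling level (`pi_rejects_eq_integral_rlLevel`). The random labelling bounds are uniform over NN
maps (`exists_forall_chiTail_le_rlLevel`): for small `R` hardly anything below `α` is lost, for `R`
proportional to `n` there is a fixed gain. The mean of `R` is at least `n / 32`, by counting pairs
of close points isolated from the rest (`eventually_integral_reflexiveCount_ge`).

Consistency for mapped data. Altering one marked point changes only the pairs in which it takes
part. With bounded in-degrees, the Efron–Stein inequality gives `Var N_ij ≤ 104 E[N_i]`
(`integral_sq_cellCount_sub_le`). Hence every cell divided by `E[N_i]` concentrates around its mean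
as soon as `E[N_i]` tends to infinity. -/

/-! ### The chi-square tail -/

/-- The upper tail `P(Z² > y)` of the chi-square law with one degree of freedom. -/
noncomputable def chiTail (y : ℝ) : ℝ := (gaussianReal 0 1).real {z | y < z ^ 2}

instance isProbabilityMeasure_chiSqOne : IsProbabilityMeasure chiSqOne :=
  Measure.isProbabilityMeasure_map (by fun_prop)

lemma chiTail_eq_one_sub_cdf (y : ℝ) : chiTail y = 1 - cdf chiSqOne y := by
  have h : cdf chiSqOne y = (gaussianReal 0 1).real {z | y < z ^ 2}ᶜ := by
    rw [cdf_eq_real, chiSqOne, map_measureReal_apply (by fun_prop) measurableSet_Iic]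
    congr 1
    ext z
    simp
  rw [h, chiTail, probReal_compl_eq_one_sub (measurableSet_lt (by fun_prop) (by fun_prop))]
  ring

lemma gaussian_sq_eq_null (y : ℝ) : gaussianReal 0 1 {z | z ^ 2 = y} = 0 := by
  have := nullSingletonClass_gaussianReal (μ := 0) (v := 1) one_ne_zero
  have hsub : {z : ℝ | z ^ 2 = y} ⊆ {√y, -√y} := by
    intro z hz
    simp only [Set.mem_ofPred_eq] at hz
    have hy : 0 ≤ y := hz ▸ sq_nonneg z
    have : z ^ 2 = (√y) ^ 2 := by rw [Real.sq_sqrt hy, hz]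
    simpa using sq_eq_sq_iff_eq_or_eq_neg.1 this
  exact measure_mono_null hsub ((Set.toFinite _).measure_zero _)

/-- A distribution function is right-continuous by construction, and its left jump at `y` is the
mass of `{y}`, which vanishes because the Gaussian law has no atoms. -/
lemma continuous_cdf_chiSqOne : Continuous (cdf chiSqOne) := by
  rw [continuous_iff_continuousAt]
  intro y
  have hnull : chiSqOne {y} = 0 := by
    rw [chiSqOne, Measure.map_apply (by fun_prop) (measurableSet_singleton y)]
    exact gaussian_sq_eq_null y
  have h1 : Function.leftLim (cdf chiSqOne) y = cdf chiSqOne y := by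
    have h2 := (cdf chiSqOne).measure_singleton y
    rw [measure_cdf, hnull] at h2
    have h3 := ENNReal.ofReal_eq_zero.1 h2.symm
    have h4 := (cdf chiSqOne).mono.leftLim_le (le_refl y)
    linarith
  rw [(cdf chiSqOne).mono.continuousAt_iff_leftLim_eq_rightLim, h1, StieltjesFunction.rightLim_eq]

lemma continuous_chiTail : Continuous chiTail := by
  have : chiTail = fun y => 1 - cdf chiSqOne y := funext chiTail_eq_one_sub_cdf
  rw [this]
  exact continuous_const.sub continuous_cdf_chiSqOne

lemma chiTail_lt {y y' : ℝ} (h0 : 0 ≤ y) (h : y < y') : chiTail y' < chiTail y := by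
  have hopen : IsOpen {z : ℝ | y < z ^ 2 ∧ z ^ 2 < y'} :=
    (isOpen_lt continuous_const (continuous_pow 2)).and
      (isOpen_lt (continuous_pow 2) continuous_const)
  have hne : ({z : ℝ | y < z ^ 2 ∧ z ^ 2 < y'}).Nonempty :=
    ⟨√((y + y') / 2), by simp only [Set.mem_ofPred_eq]; rw [Real.sq_sqrt (by linarith)]; constructor <;> linarith⟩
  have hpos : 0 < (gaussianReal 0 1).real {z : ℝ | y < z ^ 2 ∧ z ^ 2 < y'} := by
    rw [measureReal_def]
    refine ENNReal.toReal_pos (fun hz => ?_) (measure_ne_top _ _)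
    -- Lebesgue measure is absolutely continuous with respect to the Gaussian law, so nonempty open
    -- sets have positive Gaussian mass.
    exact (hopen.measure_pos volume hne).ne'
      (gaussianReal_absolutelyContinuous' 0 one_ne_zero hz)
  have hdisj : Disjoint {z : ℝ | y < z ^ 2 ∧ z ^ 2 < y'} {z : ℝ | y' < z ^ 2} := by
    rw [Set.disjoint_left]
    rintro z ⟨-, h1⟩ h2
    exact lt_asymm h1 h2
  have hle : (gaussianReal 0 1).real ({z : ℝ | y < z ^ 2 ∧ z ^ 2 < y'} ∪ {z : ℝ | y' < z ^ 2})
      ≤ chiTail y := by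
    refine measureReal_mono ?_
    rintro z (⟨h1, -⟩ | h2)
    · exact h1
    · exact h.trans h2
  rw [measureReal_union hdisj (measurableSet_lt (by fun_prop) (by fun_prop))] at hle
  have : chiTail y' = (gaussianReal 0 1).real {z | y' < z ^ 2} := rfl
  linarith

lemma chiTail_zero : chiTail 0 = 1 := by
  have h : {z : ℝ | 0 < z ^ 2} = {z | z ^ 2 = 0}ᶜ := by
    ext z
    simp [pow_eq_zero_iff, sq_pos_iff]
  rw [chiTail, h, probReal_compl_eq_one_sub (measurableSet_eq_fun (by fun_prop) (by fun_prop)),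
    measureReal_def, gaussian_sq_eq_null]
  simp

/-- The infimum defining the quantile is attained because the set is closed, nonempty and bounded
below by 0. Continuity from the left then makes the distribution function equal to `1 - α` there,
and not just at least that. -/
lemma chiTail_quantile {α : ℝ} (h0 : 0 < α) (h1 : α < 1) :
    chiTail (chiSqOneQuantile (1 - α)) = α ∧ 0 < chiSqOneQuantile (1 - α) := by
  have hc0 : cdf chiSqOne 0 = 0 := by have := chiTail_eq_one_sub_cdf 0; rw [chiTail_zero] at this; linarith
  set S := {c : ℝ | 1 - α ≤ cdf chiSqOne c} with hS
  have hclosed : IsClosed S := isClosed_le continuous_const continuous_cdf_chiSqOne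
  have hbdd : ∀ c ∈ S, 0 ≤ c := by
    intro c hc
    by_contra hneg
    have := monotone_cdf chiSqOne (not_le.1 hneg).le
    have hc' : 1 - α ≤ cdf chiSqOne c := hc
    linarith
  have hne : S.Nonempty := by
    have := (tendsto_cdf_atTop chiSqOne).eventually (eventually_ge_nhds (show 1 - α < 1 by linarith))
    exact this.exists
  have hbb : BddBelow S := ⟨0, hbdd⟩
  have hmem : sInf S ∈ S := hclosed.csInf_mem hne hbb
  have hge : 1 - α ≤ cdf chiSqOne (sInf S) := hmem
  have hle : cdf chiSqOne (sInf S) ≤ 1 - α := by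
    have ht : Tendsto (cdf chiSqOne) (𝓝[<] (sInf S)) (𝓝 (cdf chiSqOne (sInf S))) :=
      (continuous_cdf_chiSqOne.tendsto _).mono_left nhdsWithin_le_nhds
    refine le_of_tendsto ht ?_
    filter_upwards [self_mem_nhdsWithin] with c hc
    by_contra hcon
    exact (not_le.2 hc) (csInf_le hbb (not_le.1 hcon).le)
  have hq : chiSqOneQuantile (1 - α) = sInf S := rfl
  refine ⟨by rw [hq, chiTail_eq_one_sub_cdf]; linarith, ?_⟩
  rw [hq]
  rcases (hbdd _ hmem).eq_or_lt with h | h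
  · rw [← h, hc0] at hge
    linarith
  · exact h

/-- If the characteristic functions converge to that of the standard normal law, the tails of the
squares converge to the chi-square tail. -/
lemma tendsto_sq_tail_of_charFun (μ : ℕ → Measure ℝ) [∀ k, IsProbabilityMeasure (μ k)]
    (h : ∀ t : ℝ, Tendsto (fun k => charFun (μ k) t) atTop (𝓝 (Complex.exp (-t ^ 2 / 2)))) (y : ℝ) :
    Tendsto (fun k => (μ k).real {z | y < z ^ 2}) atTop (𝓝 (chiTail y)) := by
  have hconv : Tendsto (β := ProbabilityMeasure ℝ) (fun k => ⟨μ k, inferInstance⟩) atTop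
      (𝓝 ⟨gaussianReal 0 1, inferInstance⟩) := by
    refine ProbabilityMeasure.tendsto_of_tendsto_charFun fun t => ?_
    have h2 : charFun (gaussianReal 0 1) t = Complex.exp (-t ^ 2 / 2) := by
      rw [charFun_gaussianReal]
      congr 1
      push_cast
      ring
    simpa [h2] using h t
  -- The boundary is a Gaussian null set, so Lévy's continuity theorem and the portmanteau theorem
  -- give convergence for this event.
  have hfr : frontier {z : ℝ | y < z ^ 2} ⊆ {z | z ^ 2 = y} := by
    refine (frontier_lt_subset_eq continuous_const (continuous_pow 2)).trans ?_
    intro z hz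
    exact (show y = z ^ 2 from hz).symm
  have := ProbabilityMeasure.tendsto_measure_of_null_frontier_of_tendsto' hconv
    (E := {z : ℝ | y < z ^ 2}) (measure_mono_null hfr (gaussian_sq_eq_null y))
  simp only [ProbabilityMeasure.coe_mk] at this
  exact (ENNReal.tendsto_toReal (measure_ne_top _ _)).comp this

/-! ### Algebra of the table -/

section Table
variable {ι : Type*} [Fintype ι] (u v : ι → Fin 2)

lemma card_eq_sum_cellCount : Fintype.card ι =
    cellCount u v 0 0 + cellCount u v 0 1 + cellCount u v 1 0 + cellCount u v 1 1 := by
  classical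
  have h : Fintype.card ι = ∑ p : Fin 2 × Fin 2, (Finset.univ.filter fun k => (u k, v k) = p).card := by
    rw [← Finset.card_univ]
    exact Finset.card_eq_sum_card_fiberwise (fun _ _ => Finset.mem_coe.2 (Finset.mem_univ _))
  rw [h, Fintype.sum_prod_type]
  simp [cellCount, Fin.sum_univ_two, Prod.ext_iff]
  ring

lemma rowSum_eq (i : Fin 2) : rowSum u v i = cellCount u v i 0 + cellCount u v i 1 :=
  Fin.sum_univ_two _

lemma colSum_eq (j : Fin 2) : colSum u v j = cellCount u v 0 j + cellCount u v 1 j :=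
  Fin.sum_univ_two _

/-- With no empty row or column, Pielou's statistic is the squared normalised determinant. -/
lemma pielouStat_eq (h0 : 0 < rowSum u v 0) (h1 : 0 < rowSum u v 1) (h2 : 0 < colSum u v 0)
    (h3 : 0 < colSum u v 1) : pielouStat u v = (Fintype.card ι : ℝ) *
      ((cellCount u v 0 0 : ℝ) * Fintype.card ι - rowSum u v 0 * colSum u v 0) ^ 2 /
      (rowSum u v 0 * rowSum u v 1 * colSum u v 0 * colSum u v 1) := by
  have hn := card_eq_sum_cellCount u v
  rw [rowSum_eq] at h0 h1
  rw [colSum_eq] at h2 h3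
  have h0' : (0 : ℝ) < cellCount u v 0 0 + cellCount u v 0 1 := by exact_mod_cast h0
  have h1' : (0 : ℝ) < cellCount u v 1 0 + cellCount u v 1 1 := by exact_mod_cast h1
  have h2' : (0 : ℝ) < cellCount u v 0 0 + cellCount u v 1 0 := by exact_mod_cast h2
  have h3' : (0 : ℝ) < cellCount u v 0 1 + cellCount u v 1 1 := by exact_mod_cast h3
  simp only [pielouStat, expectedCount, Fin.sum_univ_two, rowSum_eq, colSum_eq, hn]
  push_cast
  generalize (cellCount u v 0 0 : ℝ) = a at *
  generalize (cellCount u v 0 1 : ℝ) = b at *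
  generalize (cellCount u v 1 0 : ℝ) = c at *
  generalize (cellCount u v 1 1 : ℝ) = d at *
  have hN : 0 < a + b + c + d := by linarith
  -- All four deviations from the expected counts are the same number `(ad - bc) / n` up to sign.
  have e1 : a - (a + b) * (a + c) / (a + b + c + d) = (a * d - b * c) / (a + b + c + d) := by
    field_simp; ring
  have e2 : b - (a + b) * (b + d) / (a + b + c + d) = -(a * d - b * c) / (a + b + c + d) := by
    field_simp; ring
  have e3 : c - (c + d) * (a + c) / (a + b + c + d) = -(a * d - b * c) / (a + b + c + d) := by
    field_simp; ring
  have e4 : d - (c + d) * (b + d) / (a + b + c + d) = (a * d - b * c) / (a + b + c + d) := by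
    field_simp; ring
  have e5 : a * (a + b + c + d) - (a + b) * (a + c) = a * d - b * c := by ring
  rw [e1, e2, e3, e4, e5]
  generalize a * d - b * c = t
  field_simp
  ring

lemma pielouStat_nonneg : 0 ≤ pielouStat u v := by
  refine Finset.sum_nonneg fun i _ => Finset.sum_nonneg fun j _ => ?_
  unfold expectedCount
  positivity

/-- Pielou's statistic is large when the two observed row proportions differ. -/
lemma le_pielouStat {M : ℝ} (hM : 0 < M) (h0 : M ≤ rowSum u v 0) (h1 : M ≤ rowSum u v 1) :
    2 * M * ((cellCount u v 0 0 : ℝ) / rowSum u v 0 - (cellCount u v 1 0 : ℝ) / rowSum u v 1) ^ 2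
      ≤ pielouStat u v := by
  have r0 : 0 < rowSum u v 0 := by exact_mod_cast hM.trans_le h0
  have r1 : 0 < rowSum u v 1 := by exact_mod_cast hM.trans_le h1
  -- With an empty column both row proportions are 0, or both are 1, so the left side vanishes.
  by_cases c0 : colSum u v 0 = 0
  · rw [colSum_eq] at c0
    have h2 : cellCount u v 0 0 = 0 := by omega
    have h3 : cellCount u v 1 0 = 0 := by omega
    simpa [h2, h3] using pielouStat_nonneg u v
  by_cases c1 : colSum u v 1 = 0
  · rw [colSum_eq] at c1
    have h2 : rowSum u v 0 = cellCount u v 0 0 := by rw [rowSum_eq]; omega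
    have h3 : rowSum u v 1 = cellCount u v 1 0 := by rw [rowSum_eq]; omega
    rw [h2] at r0 ⊢
    rw [h3] at r1 ⊢
    rw [div_self (by exact_mod_cast r0.ne'), div_self (by exact_mod_cast r1.ne')]
    simpa using pielouStat_nonneg u v
  rw [pielouStat_eq u v r0 r1 (Nat.pos_of_ne_zero c0) (Nat.pos_of_ne_zero c1)]
  have hn := card_eq_sum_cellCount u v
  have c0' : (0 : ℝ) < colSum u v 0 := by exact_mod_cast Nat.pos_of_ne_zero c0
  have c1' : (0 : ℝ) < colSum u v 1 := by exact_mod_cast Nat.pos_of_ne_zero c1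
  have r0' : (0 : ℝ) < rowSum u v 0 := by exact_mod_cast r0
  have r1' : (0 : ℝ) < rowSum u v 1 := by exact_mod_cast r1
  rw [hn]
  simp only [rowSum_eq, colSum_eq] at *
  push_cast at *
  generalize (cellCount u v 0 0 : ℝ) = a at *
  generalize (cellCount u v 0 1 : ℝ) = b at *
  generalize (cellCount u v 1 0 : ℝ) = c at *
  generalize (cellCount u v 1 1 : ℝ) = d at *
  have e1 : a / (a + b) - c / (c + d) = (a * d - b * c) / ((a + b) * (c + d)) := by
    field_simp; ring
  rw [e1, show a * (a + b + c + d) - (a + b) * (a + c) = a * d - b * c by ring, div_pow,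
    ← mul_div_assoc, div_le_div_iff₀ (by positivity) (by positivity)]
  -- After cancelling `(ad - bc)²` the claim is `2 M C₁ C₂ ≤ n N₁ N₂`. It follows from `4 C₁ C₂ ≤
  -- n²` and `M n ≤ 2 N₁ N₂`.
  have key : 2 * M * ((a + c) * (b + d)) ≤ (a + b + c + d) * ((a + b) * (c + d)) := by
    have k1 : 4 * ((a + c) * (b + d)) ≤ (a + b + c + d) ^ 2 := by nlinarith [sq_nonneg (a + c - b - d)]
    have k2 : M * (a + b + c + d) ≤ 2 * ((a + b) * (c + d)) := by
      nlinarith [mul_le_mul_of_nonneg_right h0 r1'.le, mul_le_mul_of_nonneg_right h1 r0'.le]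
    have k3 : 0 < a + b + c + d := by linarith
    nlinarith [mul_le_mul_of_nonneg_right k2 k3.le]
  have := mul_le_mul_of_nonneg_right key
    (show 0 ≤ (a * d - b * c) ^ 2 * ((a + b) * (c + d)) by positivity)
  nlinarith [this]

end Table


/-! ### Cell counts as sums of indicators, and the statistic normalised by a known variance -/

/-- The indicator of class 1. -/
noncomputable def classInd (j : Fin 2) : ℝ := if j = 0 then 1 else 0

@[simp] lemma classInd_zero : classInd 0 = 1 := by simp [classInd]
@[simp] lemma classInd_one : classInd 1 = 0 := by simp [classInd]

lemma classInd_nonneg (j : Fin 2) : 0 ≤ classInd j := by fin_cases j <;> simp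
lemma classInd_le_one (j : Fin 2) : classInd j ≤ 1 := by fin_cases j <;> simp
lemma classInd_sq (j : Fin 2) : classInd j ^ 2 = classInd j := by fin_cases j <;> simp

section Table
variable {ι : Type*} [Fintype ι] (u v : ι → Fin 2)

lemma cellCount_cast (i j : Fin 2) :
    (cellCount u v i j : ℝ) = ∑ k, (if u k = i ∧ v k = j then (1 : ℝ) else 0) := by
  simp [cellCount]

lemma cellCount_zero_zero : (cellCount u v 0 0 : ℝ) = ∑ k, classInd (u k) * classInd (v k) := by
  rw [cellCount_cast]
  refine Finset.sum_congr rfl fun k _ => ?_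
  generalize u k = a
  generalize v k = b
  fin_cases a <;> fin_cases b <;> simp

lemma cellCount_one_zero :
    (cellCount u v 1 0 : ℝ) = ∑ k, (1 - classInd (u k)) * classInd (v k) := by
  rw [cellCount_cast]
  refine Finset.sum_congr rfl fun k _ => ?_
  generalize u k = a
  generalize v k = b
  fin_cases a <;> fin_cases b <;> simp

lemma rowSum_eq_card (i : Fin 2) : rowSum u v i = (Finset.univ.filter fun k => u k = i).card := by
  classical
  have h : (Finset.univ.filter fun k => u k = i).card
      = ∑ j : Fin 2, ((Finset.univ.filter fun k => u k = i).filter fun k => v k = j).card :=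
    Finset.card_eq_sum_card_fiberwise (fun _ _ => Finset.mem_coe.2 (Finset.mem_univ _))
  rw [h, rowSum]
  simp [cellCount, Finset.filter_filter]

lemma rowSum_zero_cast : (rowSum u v 0 : ℝ) = ∑ k, classInd (u k) := by
  rw [rowSum_eq_card]
  simp [classInd]

lemma rowSum_one_cast : (rowSum u v 1 : ℝ) = ∑ k, (1 - classInd (u k)) := by
  rw [rowSum_eq_card]
  rw [Finset.card_filter]
  push_cast
  refine Finset.sum_congr rfl fun k _ => ?_
  generalize u k = a
  fin_cases a <;> simp

lemma colSum_zero_cast : (colSum u v 0 : ℝ) = ∑ k, classInd (v k) := by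
  rw [colSum_eq]
  push_cast
  rw [cellCount_zero_zero, cellCount_one_zero, ← Finset.sum_add_distrib]
  exact Finset.sum_congr rfl fun k _ => by ring

lemma rowSum_add : rowSum u v 0 + rowSum u v 1 = Fintype.card ι := by
  rw [card_eq_sum_cellCount u v, rowSum_eq, rowSum_eq]; ring

lemma colSum_add : colSum u v 0 + colSum u v 1 = Fintype.card ι := by
  rw [card_eq_sum_cellCount u v, colSum_eq, colSum_eq]; ring

/-- If the column proportion is close to `q`, Pielou's statistic is close to its version with
the variance `q * (1 - q)` in place of the estimated one. -/
lemma pielouStat_sandwich {q κ : ℝ} (hq0 : 0 < q) (hq1 : q < 1) (hκ : κ ≤ 1 / 2)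
    (h0 : 0 < rowSum u v 0) (h1 : 0 < rowSum u v 1)
    (hC : |(colSum u v 0 : ℝ) - Fintype.card ι * q| ≤ κ * (Fintype.card ι * (q * (1 - q)))) :
    ((cellCount u v 0 0 : ℝ) - rowSum u v 0 * colSum u v 0 / Fintype.card ι) ^ 2 * Fintype.card ι /
        (rowSum u v 0 * rowSum u v 1 * (q * (1 - q))) ≤ (1 + κ) * pielouStat u v ∧
    (1 - κ) * pielouStat u v ≤
      ((cellCount u v 0 0 : ℝ) - rowSum u v 0 * colSum u v 0 / Fintype.card ι) ^ 2 *
        Fintype.card ι / (rowSum u v 0 * rowSum u v 1 * (q * (1 - q))) := by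
  have hr := rowSum_add u v
  have hc := colSum_add u v
  have hn : 0 < Fintype.card ι := by omega
  have hn' : (0 : ℝ) < Fintype.card ι := by exact_mod_cast hn
  have hc' : (colSum u v 1 : ℝ) = Fintype.card ι - colSum u v 0 := by
    rw [← hc]; push_cast; ring
  have hv : 0 < q * (1 - q) := mul_pos hq0 (by linarith)
  rw [abs_le] at hC
  -- Since `κ ≤ 1 / 2`, the deviation is too small to empty a column, so the closed formula for the
  -- statistic is available.
  have hb1 : κ * (Fintype.card ι * (q * (1 - q))) ≤ 1 / 2 * (Fintype.card ι * (q * (1 - q))) :=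
    mul_le_mul_of_nonneg_right hκ (by positivity)
  have hb2 : (Fintype.card ι : ℝ) * (q * (1 - q)) ≤ Fintype.card ι * q :=
    mul_le_mul_of_nonneg_left (by nlinarith) hn'.le
  have hb3 : (Fintype.card ι : ℝ) * (q * (1 - q)) ≤ Fintype.card ι * (1 - q) :=
    mul_le_mul_of_nonneg_left (by nlinarith) hn'.le
  have c0 : (0 : ℝ) < colSum u v 0 := by
    have : 0 < (Fintype.card ι : ℝ) * q := by positivity
    linarith [hC.1]
  have c1 : (0 : ℝ) < colSum u v 1 := by
    rw [hc']
    have : 0 < (Fintype.card ι : ℝ) * (1 - q) := mul_pos hn' (by linarith)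
    linarith [hC.2]
  rw [pielouStat_eq u v h0 h1 (by exact_mod_cast c0) (by exact_mod_cast c1)]
  have r0 : (0 : ℝ) < rowSum u v 0 := by exact_mod_cast h0
  have r1 : (0 : ℝ) < rowSum u v 1 := by exact_mod_cast h1
  have hcprod : |(colSum u v 0 : ℝ) * colSum u v 1 - (Fintype.card ι) ^ 2 * (q * (1 - q))| ≤
      κ * ((Fintype.card ι) ^ 2 * (q * (1 - q))) := by
    -- The second factor has absolute value at most `n`, so the relative error of `C₁ C₂` is again
    -- at most `κ`.
    have e : (colSum u v 0 : ℝ) * colSum u v 1 - (Fintype.card ι) ^ 2 * (q * (1 - q)) =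
      ((colSum u v 0 : ℝ) - Fintype.card ι * q) * ((colSum u v 1 : ℝ) - Fintype.card ι * q) := by
      rw [hc']; ring
    rw [e, abs_mul]
    have b1 : |(colSum u v 1 : ℝ) - Fintype.card ι * q| ≤ Fintype.card ι := by
      rw [abs_le]
      constructor <;> nlinarith
    calc _ ≤ (κ * (Fintype.card ι * (q * (1 - q)))) * Fintype.card ι :=
          mul_le_mul (abs_le.2 hC) b1 (abs_nonneg _) (by linarith [abs_nonneg ((colSum u v 0 : ℝ) - Fintype.card ι * q), abs_le.2 hC])
      _ = _ := by ring
  rw [abs_le] at hcprod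
  generalize (colSum u v 0 : ℝ) = C0 at *
  generalize (colSum u v 1 : ℝ) = C1 at *
  generalize (rowSum u v 0 : ℝ) = R0 at *
  generalize (rowSum u v 1 : ℝ) = R1 at *
  generalize (Fintype.card ι : ℝ) = n at *
  generalize (cellCount u v 0 0 : ℝ) = a at *
  have e1 : (a - R0 * C0 / n) ^ 2 * n / (R0 * R1 * (q * (1 - q))) =
      (a * n - R0 * C0) ^ 2 / (n * R0 * R1 * (q * (1 - q))) := by
    field_simp
  rw [e1]
  have ht : 0 ≤ (a * n - R0 * C0) ^ 2 / (R0 * R1 * n) := by positivity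
  have e2 : (a * n - R0 * C0) ^ 2 / (n * R0 * R1 * (q * (1 - q))) =
      (a * n - R0 * C0) ^ 2 / (R0 * R1 * n) * (1 / (q * (1 - q))) := by
    rw [div_mul_div_comm, mul_one]; congr 1; ring
  have e3 : n * (a * n - R0 * C0) ^ 2 / (R0 * R1 * C0 * C1) =
      (a * n - R0 * C0) ^ 2 / (R0 * R1 * n) * (n ^ 2 / (C0 * C1)) := by
    field_simp
  -- Both quantities share a nonnegative factor. What remains is to compare `1 / (q (1 - q))` with
  -- `n² / (C₁ C₂)`.
  rw [e2, e3, mul_left_comm, mul_left_comm (1 - κ)]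
  refine ⟨mul_le_mul_of_nonneg_left ?_ ht, mul_le_mul_of_nonneg_left ?_ ht⟩
  · rw [← mul_div_assoc, div_le_div_iff₀ hv (by positivity)]
    nlinarith [hcprod.2]
  · rw [← mul_div_assoc, div_le_div_iff₀ (by positivity) hv]
    nlinarith [hcprod.1]

end Table

/-! ### Characteristic functions and Chebyshev bounds for independent labels -/

lemma norm_prod_sub_prod_le {ι : Type*} (s : Finset ι) (f g : ι → ℂ) (hf : ∀ i ∈ s, ‖f i‖ ≤ 1)
    (hg : ∀ i ∈ s, ‖g i‖ ≤ 1) : ‖∏ i ∈ s, f i - ∏ i ∈ s, g i‖ ≤ ∑ i ∈ s, ‖f i - g i‖ := by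
  classical
  induction s using Finset.induction_on with
  | empty => simp
  | insert a s ha ih =>
    rw [Finset.prod_insert ha, Finset.prod_insert ha, Finset.sum_insert ha]
    -- Factors are exchanged one at a time; all the others have norm at most 1.
    have e : f a * ∏ i ∈ s, f i - g a * ∏ i ∈ s, g i =
      (f a - g a) * ∏ i ∈ s, f i + g a * (∏ i ∈ s, f i - ∏ i ∈ s, g i) := by ring
    rw [e]
    refine (norm_add_le _ _).trans (add_le_add ?_ ?_)
    · rw [norm_mul, norm_prod]
      exact mul_le_of_le_one_right (norm_nonneg _) (Finset.prod_le_one (fun _ _ => norm_nonneg _)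
        fun i hi => hf i (Finset.mem_insert_of_mem hi))
    · rw [norm_mul]
      refine (mul_le_of_le_one_left (norm_nonneg _) (hg a (Finset.mem_insert_self _ _))).trans ?_
      exact ih (fun i hi => hf i (Finset.mem_insert_of_mem hi))
        fun i hi => hg i (Finset.mem_insert_of_mem hi)

lemma norm_exp_I_sub_taylor_two_le {x : ℝ} (hx : |x| ≤ 1) :
    ‖Complex.exp (x * Complex.I) - (1 + x * Complex.I - x ^ 2 / 2)‖ ≤ 3 * |x| ^ 3 := by
  have h := Complex.norm_exp_sub_sum_le_norm_mul_exp (x * Complex.I) 3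
  have e : ∑ m ∈ Finset.range 3, ((x : ℂ) * Complex.I) ^ m / (m.factorial : ℂ) =
      1 + x * Complex.I - x ^ 2 / 2 := by
    simp [Finset.sum_range_succ, mul_pow]
    ring
  rw [e] at h
  refine h.trans ?_
  have hn : ‖(x : ℂ) * Complex.I‖ = |x| := by simp
  rw [hn, mul_comm]
  refine mul_le_mul_of_nonneg_right ?_ (by positivity)
  exact (Real.exp_le_exp.2 hx).trans (by linarith [Real.exp_one_lt_d9])

lemma abs_exp_neg_sub_one_add_le {y : ℝ} (h0 : 0 ≤ y) (h1 : y ≤ 1) :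
    |Real.exp (-y) - (1 - y)| ≤ y ^ 2 := by
  have := Real.norm_exp_sub_one_sub_id_le (x := -y) (by rw [Real.norm_eq_abs, abs_neg, abs_of_nonneg h0]; exact h1)
  rw [Real.norm_eq_abs, Real.norm_eq_abs, abs_neg, abs_of_nonneg h0] at this
  convert this using 2
  ring

/-- The characteristic function of a centred Bernoulli variable with success probability `q`. -/
lemma norm_bernoulli_charFun_sub_le {q b : ℝ} (hq0 : 0 ≤ q) (hq1 : q ≤ 1) (hb : |b| ≤ 1) :
    ‖(q * Complex.exp ((b * (1 - q) : ℝ) * Complex.I) +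
      (1 - q) * Complex.exp ((b * (0 - q) : ℝ) * Complex.I)) -
      Complex.exp ((-(b ^ 2 * (q * (1 - q)) / 2) : ℝ))‖ ≤ 4 * |b| ^ 3 := by
  have hx1 : |b * (1 - q)| ≤ |b| := by
    rw [abs_mul]
    exact mul_le_of_le_one_right (abs_nonneg _) (by rw [abs_of_nonneg] <;> linarith)
  have hx2 : |b * (0 - q)| ≤ |b| := by
    rw [abs_mul]
    exact mul_le_of_le_one_right (abs_nonneg _) (by rw [zero_sub, abs_neg, abs_of_nonneg] <;> linarith)
  have h1 := norm_exp_I_sub_taylor_two_le (hx1.trans hb)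
  have h2 := norm_exp_I_sub_taylor_two_le (hx2.trans hb)
  have hb2 : b ^ 2 ≤ |b| := by rw [← sq_abs]; nlinarith [abs_nonneg b]
  have hv : q * (1 - q) ≤ 1 := by nlinarith
  have hv0 : 0 ≤ q * (1 - q) := mul_nonneg hq0 (by linarith)
  have hy0 : 0 ≤ b ^ 2 * (q * (1 - q)) / 2 := by positivity
  have hy : b ^ 2 * (q * (1 - q)) / 2 ≤ b ^ 2 := by nlinarith [sq_nonneg b]
  have h3 := abs_exp_neg_sub_one_add_le hy0 (hy.trans (hb2.trans hb))
  have h3' : ‖Complex.exp ((-(b ^ 2 * (q * (1 - q)) / 2) : ℝ)) -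
      ((1 - b ^ 2 * (q * (1 - q)) / 2 : ℝ) : ℂ)‖ ≤ |b| ^ 3 := by
    rw [← Complex.ofReal_exp, ← Complex.ofReal_sub, Complex.norm_real, Real.norm_eq_abs]
    refine h3.trans ?_
    calc (b ^ 2 * (q * (1 - q)) / 2) ^ 2 ≤ (b ^ 2) ^ 2 := pow_le_pow_left₀ hy0 hy 2
      _ = |b| ^ 3 * |b| := by rw [← sq_abs b]; ring
      _ ≤ |b| ^ 3 := mul_le_of_le_one_right (by positivity) hb
  set E1 := Complex.exp ((b * (1 - q) : ℝ) * Complex.I) with hE1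
  set E2 := Complex.exp ((b * (0 - q) : ℝ) * Complex.I) with hE2
  set E3 := Complex.exp ((-(b ^ 2 * (q * (1 - q)) / 2) : ℝ)) with hE3
  -- The first-order Taylor terms cancel by centring, and the second-order ones add up to `-b² q (1
  -- - q) / 2`. The three remainders carry the constants `3 q`, `3 (1 - q)` and 1, whence 4.
  have e : q * E1 + (1 - q) * E2 - E3 =
      (q : ℂ) * (E1 - (1 + (b * (1 - q) : ℝ) * Complex.I - (b * (1 - q) : ℝ) ^ 2 / 2)) +
      ((1 - q : ℝ) : ℂ) * (E2 - (1 + (b * (0 - q) : ℝ) * Complex.I - (b * (0 - q) : ℝ) ^ 2 / 2)) -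
      (E3 - ((1 - b ^ 2 * (q * (1 - q)) / 2 : ℝ) : ℂ)) := by
    push_cast
    ring
  rw [e]
  refine (norm_sub_le _ _).trans ?_
  refine (add_le_add (norm_add_le _ _) h3').trans ?_
  rw [norm_mul, norm_mul, Complex.norm_real, Complex.norm_real, Real.norm_eq_abs, Real.norm_eq_abs,
    abs_of_nonneg hq0, abs_of_nonneg (show 0 ≤ 1 - q by linarith)]
  have p1 : |b * (1 - q)| ^ 3 ≤ |b| ^ 3 := pow_le_pow_left₀ (abs_nonneg _) hx1 3
  have p2 : |b * (0 - q)| ^ 3 ≤ |b| ^ 3 := pow_le_pow_left₀ (abs_nonneg _) hx2 3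
  have k1 := mul_le_mul_of_nonneg_left (h1.trans (mul_le_mul_of_nonneg_left p1 (by norm_num))) hq0
  have k2 := mul_le_mul_of_nonneg_left (h2.trans (mul_le_mul_of_nonneg_left p2 (by norm_num)))
    (show 0 ≤ 1 - q by linarith)
  linarith

lemma integral_fin_two {Q : Measure (Fin 2)} [IsProbabilityMeasure Q] {E : Type*}
    [NormedAddCommGroup E] [NormedSpace ℝ E] [CompleteSpace E] (f : Fin 2 → E) :
    ∫ j, f j ∂Q = Q.real {0} • f 0 + (1 - Q.real {0}) • f 1 := by
  rw [integral_fintype .of_finite, Fin.sum_univ_two]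
  congr 2
  rw [← probReal_compl_eq_one_sub (measurableSet_singleton 0)]
  congr 1
  ext j
  fin_cases j <;> simp

/-- Normal approximation for the characteristic function of a weighted sum of i.i.d. centred
Bernoulli variables. -/
lemma norm_charFun_weighted_sum_sub_le {ι : Type*} [Fintype ι] (Q : Measure (Fin 2))
    [IsProbabilityMeasure Q] (b : ι → ℝ) (t : ℝ) (hb : ∀ k, |t * b k| ≤ 1) :
    ‖charFun ((Measure.pi fun _ : ι => Q).map
        fun v => ∑ k, b k * (classInd (v k) - Q.real {0})) t -
      Complex.exp ((-(t ^ 2 * ((∑ k, b k ^ 2) * (Q.real {0} * (1 - Q.real {0}))) / 2) : ℝ))‖ ≤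
    ∑ k, 4 * |t * b k| ^ 3 := by
  set q := Q.real {0} with hq
  have hq0 : 0 ≤ q := measureReal_nonneg
  have hq1 : q ≤ 1 := measureReal_le_one
  have hind : iIndepFun (fun k (v : ι → Fin 2) => b k * (classInd (v k) - q))
      (Measure.pi fun _ : ι => Q) :=
    iIndepFun_pi (X := fun k (j : Fin 2) => b k * (classInd j - q))
      fun k => (measurable_of_finite _).aemeasurable
  rw [hind.charFun_map_fun_sum_eq_prod (fun k => (measurable_of_finite _).aemeasurable),
    Finset.prod_apply]
  have hfac : ∀ k, charFun ((Measure.pi fun _ : ι => Q).map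
      fun v => b k * (classInd (v k) - q)) t =
      q * Complex.exp ((t * b k * (1 - q) : ℝ) * Complex.I) +
      (1 - q) * Complex.exp ((t * b k * (0 - q) : ℝ) * Complex.I) := by
    intro k
    rw [charFun_apply_real, integral_map (measurable_of_finite _).aemeasurable
      (by fun_prop)]
    rw [integral_comp_eval (μ := fun _ : ι => Q) (i := k)
      (f := fun j : Fin 2 => Complex.exp (t * ((b k * (classInd j - q) : ℝ) : ℂ) * Complex.I))
      (by fun_prop), integral_fin_two]
    simp only [classInd_zero, classInd_one, Complex.real_smul, ← hq]
    push_cast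
    ring_nf
  have hgauss : Complex.exp ((-(t ^ 2 * ((∑ k, b k ^ 2) * (q * (1 - q))) / 2) : ℝ)) =
      ∏ k, Complex.exp ((-((t * b k) ^ 2 * (q * (1 - q)) / 2) : ℝ)) := by
    rw [← Complex.exp_sum]
    congr 1
    rw [← Complex.ofReal_sum]
    congr 1
    rw [Finset.sum_neg_distrib, ← Finset.sum_div, ← Finset.sum_mul]
    simp_rw [mul_pow]
    rw [← Finset.mul_sum]
    ring
  rw [hgauss]
  refine (norm_prod_sub_prod_le _ _ _ (fun k _ => ?_) (fun k _ => ?_)).trans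
    (Finset.sum_le_sum fun k _ => ?_)
  · have := Measure.isProbabilityMeasure_map (μ := Measure.pi fun _ : ι => Q)
      (f := fun v => b k * (classInd (v k) - q)) (measurable_of_finite _).aemeasurable
    exact norm_charFun_le_one t
  · rw [← Complex.ofReal_exp, Complex.norm_real, Real.norm_eq_abs, abs_of_pos (Real.exp_pos _),
      Real.exp_le_one_iff, neg_nonpos]
    have : 0 ≤ q * (1 - q) := mul_nonneg hq0 (by linarith)
    positivity
  · rw [hfac]
    exact norm_bernoulli_charFun_sub_le hq0 hq1 (hb k)

/-- Chebyshev's inequality for weighted sums of independent labels. -/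
lemma labels_weighted_sum_chebyshev {ι : Type*} [Fintype ι] (Q : ι → Measure (Fin 2))
    [∀ k, IsProbabilityMeasure (Q k)] (b : ι → ℝ) {r : ℝ} (hr : 0 < r) :
    (Measure.pi Q).real {v | r ≤ |∑ k, b k * (classInd (v k) - (Q k).real {0})|} ≤
      (∑ k, b k ^ 2) / r ^ 2 := by
  have hmem : ∀ k, MemLp (fun j : Fin 2 => b k * (classInd j - (Q k).real {0})) 2 (Q k) :=
    fun k => .of_discrete
  have hvar := variance_sum_pi hmem
  have hmean : ∀ k, ∫ j, b k * (classInd j - (Q k).real {0}) ∂(Q k) = 0 := by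
    intro k
    rw [integral_fin_two]
    simp
    ring
  have hvark : ∀ k, Var[fun j : Fin 2 => b k * (classInd j - (Q k).real {0}); Q k] ≤ b k ^ 2 := by
    intro k
    refine (variance_le_expectation_sq (measurable_of_finite _).aestronglyMeasurable).trans ?_
    have h0 : 0 ≤ (Q k).real {0} := measureReal_nonneg
    have h1 : (Q k).real {0} ≤ 1 := measureReal_le_one
    simp only [Pi.pow_apply]
    rw [integral_fin_two]
    simp only [smul_eq_mul, classInd_zero, classInd_one]
    have hb := sq_nonneg (b k)
    have : (Q k).real {0} * (1 - (Q k).real {0}) ≤ 1 := by nlinarith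
    nlinarith [mul_le_mul_of_nonneg_left this hb]
  have hint : ∀ k, ∫ v, b k * (classInd (v k) - (Q k).real {0}) ∂(Measure.pi Q) = 0 := by
    intro k
    rw [integral_comp_eval (μ := Q) (i := k)
      (f := fun j : Fin 2 => b k * (classInd j - (Q k).real {0}))
      (measurable_of_finite _).aestronglyMeasurable, hmean]
  have hE : ∫ v, (∑ k, fun v : ι → Fin 2 => b k * (classInd (v k) - (Q k).real {0})) v
      ∂(Measure.pi Q) = 0 := by
    simp only [Finset.sum_apply]
    rw [integral_finsetSum _ fun k _ => .of_finite]
    simp [hint]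
  have hch := meas_ge_le_variance_div_sq (μ := Measure.pi Q)
    (X := ∑ k, fun v : ι → Fin 2 => b k * (classInd (v k) - (Q k).real {0})) .of_discrete hr
  rw [hE, hvar] at hch
  simp only [Finset.sum_apply, sub_zero] at hch
  rw [measureReal_def]
  refine (ENNReal.toReal_mono ENNReal.ofReal_ne_top hch).trans ?_
  rw [ENNReal.toReal_ofReal (div_nonneg (Finset.sum_nonneg fun _ _ => variance_nonneg _ _)
    (sq_nonneg _))]
  exact div_le_div_of_nonneg_right (Finset.sum_le_sum fun k _ => hvark k) (sq_nonneg _)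


/-! ### Centred base labels -/

/-- The number of objects with label `i`. -/
def labelCount {ι : Type*} [Fintype ι] (u : ι → Fin 2) (i : Fin 2) : ℕ :=
  (Finset.univ.filter fun k => u k = i).card

section Table
variable {ι : Type*} [Fintype ι] (u v : ι → Fin 2)

lemma rowSum_eq_labelCount (i : Fin 2) : rowSum u v i = labelCount u i := rowSum_eq_card u v i

lemma labelCount_add : labelCount u 0 + labelCount u 1 = Fintype.card ι := by
  rw [← rowSum_eq_labelCount u u, ← rowSum_eq_labelCount u u, rowSum_add]

lemma labelCount_zero_cast : (labelCount u 0 : ℝ) = ∑ k, classInd (u k) := by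
  rw [← rowSum_eq_labelCount u u, rowSum_zero_cast]

lemma labelCount_one_cast : (labelCount u 1 : ℝ) = ∑ k, (1 - classInd (u k)) := by
  rw [← rowSum_eq_labelCount u u, rowSum_one_cast]

/-- The base labels, centred at the proportion of class 1. -/
noncomputable def centredLabel (k : ι) : ℝ := classInd (u k) - labelCount u 0 / Fintype.card ι

lemma sum_centredLabel : ∑ k, centredLabel u k = 0 := by
  rcases isEmpty_or_nonempty ι with h | h
  · simp
  have hn : (Fintype.card ι : ℝ) ≠ 0 := by exact_mod_cast Fintype.card_ne_zero
  simp only [centredLabel]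
  rw [Finset.sum_sub_distrib, ← labelCount_zero_cast]
  simp
  field_simp
  ring

lemma sum_centredLabel_sq :
    ∑ k, centredLabel u k ^ 2 = labelCount u 0 * labelCount u 1 / Fintype.card ι := by
  rcases isEmpty_or_nonempty ι with h | h
  · simp
  have hn : (Fintype.card ι : ℝ) ≠ 0 := by exact_mod_cast Fintype.card_ne_zero
  have h1 : (labelCount u 1 : ℝ) = Fintype.card ι - labelCount u 0 := by
    rw [← labelCount_add u]; push_cast; ring
  have : ∀ k, centredLabel u k ^ 2 = classInd (u k) * (1 - 2 * (labelCount u 0 / Fintype.card ι)) +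
      (labelCount u 0 / Fintype.card ι : ℝ) ^ 2 := by
    intro k
    rw [centredLabel, sub_sq, classInd_sq]
    ring
  simp_rw [this]
  rw [Finset.sum_add_distrib, ← Finset.sum_mul, ← labelCount_zero_cast, h1]
  simp
  field_simp
  ring

lemma abs_centredLabel_le (k : ι) : |centredLabel u k| ≤ 1 := by
  have hle : (labelCount u 0 : ℝ) ≤ Fintype.card ι := by
    rw [← labelCount_add u]; push_cast; linarith [(Nat.cast_nonneg (labelCount u 1) : (0 : ℝ) ≤ _)]
  have h1 : (labelCount u 0 : ℝ) / Fintype.card ι ≤ 1 := div_le_one_of_le₀ hle (by positivity)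
  have h0 : 0 ≤ (labelCount u 0 : ℝ) / Fintype.card ι := by positivity
  rw [centredLabel, abs_le]
  constructor <;> linarith [classInd_nonneg (u k), classInd_le_one (u k)]

/-- The deviation of `N₁₁` from its expectation as a linear form in the NN labels. -/
lemma cellCount_sub_expected_eq_sum (q : ℝ) :
    (cellCount u v 0 0 : ℝ) - labelCount u 0 * colSum u v 0 / Fintype.card ι =
      ∑ k, centredLabel u k * (classInd (v k) - q) := by
  -- The term with `q` drops out because the centred labels sum to zero. For independent NN labels
  -- `q` will be their success probability; under random labelling it will be the proportion of
  -- class 1.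
  have h : ∑ k, centredLabel u k * (classInd (v k) - q) =
      ∑ k, (classInd (u k) * classInd (v k)) -
        (labelCount u 0 / Fintype.card ι) * ∑ k, classInd (v k) - (∑ k, centredLabel u k) * q := by
    rw [Finset.mul_sum, Finset.sum_mul, ← Finset.sum_sub_distrib, ← Finset.sum_sub_distrib]
    exact Finset.sum_congr rfl fun k _ => by rw [centredLabel]; ring
  rw [h, sum_centredLabel, cellCount_zero_zero, colSum_zero_cast]
  ring

end Table

/-- Two-sided comparison of the tails of two statistics that agree up to small relative errors
outside an event of small probability. -/
lemma tendsto_tail_of_sandwich {Ω : ℕ → Type*} [∀ k, MeasurableSpace (Ω k)]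
    (P : ∀ k, Measure (Ω k)) [∀ k, IsProbabilityMeasure (P k)] (W X : ∀ k, Ω k → ℝ) {x : ℝ}
    (hW : ∀ y, Tendsto (fun k => (P k).real {ω | y < W k ω}) atTop (𝓝 (chiTail y)))
    (hbad : ∀ κ : ℝ, 0 < κ → κ ≤ 1 / 2 → Tendsto (fun k => (P k).real
      {ω | ¬ (W k ω ≤ (1 + κ) * X k ω ∧ (1 - κ) * X k ω ≤ W k ω)}) atTop (𝓝 0)) :
    Tendsto (fun k => (P k).real {ω | x < X k ω}) atTop (𝓝 (chiTail x)) := by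
  rw [Metric.tendsto_nhds]
  intro ε hε
  have hcont : Tendsto (fun κ : ℝ => chiTail ((1 + κ) * x)) (𝓝 0) (𝓝 (chiTail x)) := by
    have : Continuous fun κ : ℝ => chiTail ((1 + κ) * x) := continuous_chiTail.comp (by fun_prop)
    simpa using this.tendsto 0
  -- Continuity of the limiting tail absorbs the relative error: `κ` is taken so small that the
  -- tails at `(1 ± κ) x` lie within `ε / 3` of the tail at `x`.
  obtain ⟨d, hd, hdd⟩ := Metric.eventually_nhds_iff.1 (Metric.tendsto_nhds.1 hcont (ε / 3) (by linarith))
  set κ := min (d / 2) (1 / 2) with hκ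
  have hκ0 : 0 < κ := lt_min (by linarith) (by norm_num)
  have hκ1 : κ ≤ 1 / 2 := min_le_right _ _
  have hκd : κ < d := (min_le_left _ _).trans_lt (by linarith)
  have h1 := hdd (y := κ) (by rw [Real.dist_eq, sub_zero, abs_of_pos hκ0]; exact hκd)
  have h2 := hdd (y := -κ) (by rw [Real.dist_eq, sub_zero, abs_neg, abs_of_pos hκ0]; exact hκd)
  rw [Real.dist_eq, abs_lt] at h1 h2
  filter_upwards [Metric.tendsto_nhds.1 (hbad κ hκ0 hκ1) (ε / 3) (by linarith),
    Metric.tendsto_nhds.1 (hW ((1 + κ) * x)) (ε / 3) (by linarith),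
    Metric.tendsto_nhds.1 (hW ((1 + -κ) * x)) (ε / 3) (by linarith)] with k h3 h4 h5
  rw [Real.dist_eq, abs_lt] at h3 h4 h5 ⊢
  set B := {ω | ¬ (W k ω ≤ (1 + κ) * X k ω ∧ (1 - κ) * X k ω ≤ W k ω)} with hB
  have u1 : (P k).real {ω | x < X k ω} ≤ (P k).real {ω | (1 + -κ) * x < W k ω} + (P k).real B := by
    refine (measureReal_mono ?_).trans (measureReal_union_le _ _)
    intro ω hω
    by_cases hb : ω ∈ B
    · exact Or.inr hb
    · left
      have hb' : W k ω ≤ (1 + κ) * X k ω ∧ (1 - κ) * X k ω ≤ W k ω := not_not.1 hb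
      have hω' : x < X k ω := hω
      show (1 + -κ) * x < W k ω
      nlinarith [hb'.2]
  have u2 : (P k).real {ω | (1 + κ) * x < W k ω} ≤ (P k).real {ω | x < X k ω} + (P k).real B := by
    refine (measureReal_mono ?_).trans (measureReal_union_le _ _)
    intro ω hω
    by_cases hb : ω ∈ B
    · exact Or.inr hb
    · left
      have hb' : W k ω ≤ (1 + κ) * X k ω ∧ (1 - κ) * X k ω ≤ W k ω := not_not.1 hb
      have hω' : (1 + κ) * x < W k ω := hω
      show x < X k ω
      have : (1 + κ) * x < (1 + κ) * X k ω := hω'.trans_le hb'.1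
      exact lt_of_mul_lt_mul_left this (by linarith)
  constructor <;> linarith

/-! ### Pielou's test with given base labels and independent NN labels -/

section RowWise
variable {n : ℕ → ℕ} (u : ∀ k, Fin (n k) → Fin 2)

lemma half_min_le_mul_div_add {a b : ℝ} (ha : 0 < a) (hb : 0 < b) :
    min a b / 2 ≤ a * b / (a + b) := by
  rw [div_le_div_iff₀ (by norm_num) (by linarith)]
  rcases le_total a b with h | h
  · rw [min_eq_left h]; nlinarith
  · rw [min_eq_right h]; nlinarith

/-- The sum equals `n₁ n₂ / (n₁ + n₂)`, which is at least half the smaller class size. -/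
lemma tendsto_sum_centredLabel_sq (h0 : Tendsto (fun k => labelCount (u k) 0) atTop atTop)
    (h1 : Tendsto (fun k => labelCount (u k) 1) atTop atTop) :
    Tendsto (fun k => ∑ i, centredLabel (u k) i ^ 2) atTop atTop := by
  rw [tendsto_atTop]
  intro M
  filter_upwards [h0.eventually_ge_atTop (⌈2 * |M|⌉₊ + 1), h1.eventually_ge_atTop (⌈2 * |M|⌉₊ + 1)]
    with k h2 h3
  rw [sum_centredLabel_sq, ← labelCount_add (u k)]
  push_cast
  have h2' : ((⌈2 * |M|⌉₊ + 1 : ℕ) : ℝ) ≤ labelCount (u k) 0 := by exact_mod_cast h2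
  have h3' : ((⌈2 * |M|⌉₊ + 1 : ℕ) : ℝ) ≤ labelCount (u k) 1 := by exact_mod_cast h3
  push_cast at h2' h3'
  have hc := Nat.le_ceil (2 * |M|)
  have hM := le_abs_self M
  have ha := abs_nonneg M
  refine le_trans ?_ (half_min_le_mul_div_add (by linarith) (by linarith))
  have : 2 * |M| ≤ min (labelCount (u k) 0 : ℝ) (labelCount (u k) 1) :=
    le_min (by linarith) (by linarith)
  linarith

/-- Asymptotic size of Pielou's test when the base labels are given and the NN labels are i.i.d. -/
theorem tendsto_rejection_of_iid_nnLabels {α : ℝ} (hα : 0 < α) (hα' : α < 1) (Q : Measure (Fin 2))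
    [IsProbabilityMeasure Q] (hq0 : 0 < Q.real {0}) (hq1 : Q.real {0} < 1)
    (h0 : Tendsto (fun k => labelCount (u k) 0) atTop atTop)
    (h1 : Tendsto (fun k => labelCount (u k) 1) atTop atTop) :
    Tendsto (fun k => (Measure.pi fun _ : Fin (n k) => Q).real {v | PielouRejects α (u k) v})
      atTop (𝓝 α) := by
  set q := Q.real {0} with hq
  have hv : 0 < q * (1 - q) := mul_pos hq0 (by linarith)
  obtain ⟨hx, -⟩ := chiTail_quantile hα hα'
  -- This is the variance of `N₁₁ - N₁ C₁ / n` for the given base labels.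
  set A : ℕ → ℝ := fun k => (∑ i, centredLabel (u k) i ^ 2) * (q * (1 - q)) with hA
  have hAlim : Tendsto A atTop atTop := (tendsto_sum_centredLabel_sq u h0 h1).atTop_mul_const hv
  set b : ∀ k, Fin (n k) → ℝ := fun k i => centredLabel (u k) i / √(A k) with hb
  set S : ∀ k, (Fin (n k) → Fin 2) → ℝ :=
    fun k v => ∑ i, b k i * (classInd (v i) - q) with hS
  have hmap : ∀ k, IsProbabilityMeasure ((Measure.pi fun _ : Fin (n k) => Q).map (S k)) :=
    fun k => Measure.isProbabilityMeasure_map (measurable_of_finite _).aemeasurable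
  have hsqrt : Tendsto (fun k => √(A k)) atTop atTop := Real.tendsto_sqrt_atTop.comp hAlim
  have hcf : ∀ t : ℝ, Tendsto (fun k => charFun ((Measure.pi fun _ : Fin (n k) => Q).map (S k)) t)
      atTop (𝓝 (Complex.exp (-t ^ 2 / 2))) := by
    intro t
    rw [tendsto_iff_norm_sub_tendsto_zero]
    have hlim : Tendsto (fun k => 4 * |t| ^ 3 / (q * (1 - q)) * (√(A k))⁻¹) atTop (𝓝 0) := by
      simpa using (tendsto_inv_atTop_zero.comp hsqrt).const_mul (4 * |t| ^ 3 / (q * (1 - q)))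
    refine squeeze_zero' (Eventually.of_forall fun _ => norm_nonneg _) ?_ hlim
    filter_upwards [hsqrt.eventually_ge_atTop (|t| + 1), hAlim.eventually_gt_atTop 0] with k hk hk0
    have hs : 0 < √(A k) := Real.sqrt_pos.2 hk0
    have hbk : ∀ i, |t * b k i| ≤ |t| * (√(A k))⁻¹ := by
      intro i
      rw [abs_mul, hb, abs_div, abs_of_pos hs, div_eq_mul_inv]
      refine mul_le_mul_of_nonneg_left ?_ (abs_nonneg _)
      exact mul_le_of_le_one_left (by positivity) (abs_centredLabel_le _ _)
    have hb1 : ∀ i, |t * b k i| ≤ 1 := by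
      intro i
      refine (hbk i).trans ?_
      rw [← div_eq_mul_inv, div_le_one hs]
      linarith
    have hsum : ∑ i, b k i ^ 2 = 1 / (q * (1 - q)) := by
      simp_rw [hb, div_pow]
      rw [← Finset.sum_div, Real.sq_sqrt hk0.le, hA, div_eq_div_iff hk0.ne' hv.ne', one_mul]
    have hmain := norm_charFun_weighted_sum_sub_le Q (b k) t hb1
    rw [← hq, hsum] at hmain
    have e : (-(t ^ 2 * (1 / (q * (1 - q)) * (q * (1 - q))) / 2) : ℝ) = -t ^ 2 / 2 := by
      rw [one_div, inv_mul_cancel₀ hv.ne', mul_one, neg_div]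
    rw [e] at hmain
    push_cast at hmain
    refine hmain.trans ?_
    -- Lyapunov's condition: one factor of each cube is at most `|t| / √A`, while the squares of the
    -- weights have the fixed sum `1 / (q (1 - q))`.
    calc ∑ i, 4 * |t * b k i| ^ 3
        ≤ ∑ i, 4 * |t| ^ 3 * (√(A k))⁻¹ * b k i ^ 2 := by
          refine Finset.sum_le_sum fun i _ => ?_
          have : |t * b k i| ^ 3 = |t * b k i| * (t ^ 2 * b k i ^ 2) := by
            rw [← mul_pow, ← sq_abs (t * b k i)]; ring
          rw [this]
          have h3 : 0 ≤ t ^ 2 * b k i ^ 2 := by positivity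
          have := mul_le_mul_of_nonneg_right (hbk i) h3
          rw [← sq_abs t] at this ⊢
          linarith
      _ = _ := by rw [← Finset.mul_sum, hsum]; ring
  have htail := fun y => tendsto_sq_tail_of_charFun
    (fun k => (Measure.pi fun _ : Fin (n k) => Q).map (S k)) hcf y
  suffices h : Tendsto (fun k => (Measure.pi fun _ : Fin (n k) => Q).real
      {v | chiSqOneQuantile (1 - α) < pielouStat (u k) v}) atTop
      (𝓝 (chiTail (chiSqOneQuantile (1 - α)))) by
    rw [hx] at h
    exact h
  refine tendsto_tail_of_sandwich (fun k => Measure.pi fun _ : Fin (n k) => Q)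
    (fun k v => S k v ^ 2) (fun k v => pielouStat (u k) v) (fun y => ?_) (fun κ hκ0 hκ1 => ?_)
  · refine (htail y).congr fun k => ?_
    rw [map_measureReal_apply (measurable_of_finite _)
      (measurableSet_lt (by fun_prop) (by fun_prop))]
    rfl
  · have hn : Tendsto (fun k => (n k : ℝ)) atTop atTop := by
      refine tendsto_natCast_atTop_atTop.comp (tendsto_atTop_mono (fun k => ?_) h0)
      have := labelCount_add (u k)
      simp only [Fintype.card_fin] at this
      omega
    have hlim : Tendsto (fun k => 1 / (κ * (q * (1 - q))) ^ 2 * (n k : ℝ)⁻¹) atTop (𝓝 0) := by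
      have := (tendsto_inv_atTop_zero.comp hn).const_mul (1 / (κ * (q * (1 - q))) ^ 2)
      rw [mul_zero] at this
      exact this
    refine squeeze_zero' (Eventually.of_forall fun _ => measureReal_nonneg) ?_ hlim
    filter_upwards [h0.eventually_gt_atTop 0, h1.eventually_gt_atTop 0, hn.eventually_gt_atTop 0,
      hAlim.eventually_gt_atTop 0] with k hk0 hk1 hkn hAk
    -- Unit weights turn the weighted sum into the deviation of the column sum, and that is the only
    -- source of the exceptional event.
    have hch := labels_weighted_sum_chebyshev (fun _ : Fin (n k) => Q) (fun _ => 1)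
      (r := κ * (n k * (q * (1 - q)))) (by positivity)
    refine (measureReal_mono ?_).trans (hch.trans (le_of_eq ?_))
    · intro v hvb
      show κ * (n k * (q * (1 - q))) ≤ |∑ i, 1 * (classInd (v i) - Q.real {0})|
      by_contra hcon
      refine hvb ?_
      have hC : |(colSum (u k) v 0 : ℝ) - Fintype.card (Fin (n k)) * q| ≤
          κ * (Fintype.card (Fin (n k)) * (q * (1 - q))) := by
        rw [colSum_zero_cast, Fintype.card_fin]
        refine le_trans (le_of_eq ?_) (not_le.1 hcon).le
        congr 1
        simp [Finset.sum_sub_distrib, hq]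
      have hsand := pielouStat_sandwich (u k) v hq0 hq1 hκ1
        (by rw [rowSum_eq_labelCount]; exact hk0) (by rw [rowSum_eq_labelCount]; exact hk1) hC
      -- With the true variance `q (1 - q)` the statistic is exactly the square of the normalised
      -- linear form, because `∑ a_i² = N₁ N₂ / n`.
      have e : ((cellCount (u k) v 0 0 : ℝ) - rowSum (u k) v 0 * colSum (u k) v 0 /
          Fintype.card (Fin (n k))) ^ 2 * Fintype.card (Fin (n k)) /
          (rowSum (u k) v 0 * rowSum (u k) v 1 * (q * (1 - q))) = S k v ^ 2 := by
        rw [rowSum_eq_labelCount, rowSum_eq_labelCount, cellCount_sub_expected_eq_sum (u k) v q]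
        have e2 : S k v = (∑ i, centredLabel (u k) i * (classInd (v i) - q)) / √(A k) := by
          rw [Finset.sum_div]
          exact Finset.sum_congr rfl fun i _ => by simp only [hb]; ring
        have hcn : (0 : ℝ) < Fintype.card (Fin (n k)) := by rw [Fintype.card_fin]; exact hkn
        have hk0' : (0 : ℝ) < labelCount (u k) 0 := by exact_mod_cast hk0
        have hk1' : (0 : ℝ) < labelCount (u k) 1 := by exact_mod_cast hk1
        rw [e2, div_pow, Real.sq_sqrt hAk.le]
        simp only [hA]
        rw [sum_centredLabel_sq]
        field_simp
      rw [e] at hsand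
      exact hsand
    · simp
      field_simp

/-- Consistency of Pielou's test when the base labels are given and the NN labels are
independent with different row probabilities. -/
theorem tendsto_rejection_of_indep_nnLabels (α : ℝ) (P : Fin 2 → Measure (Fin 2))
    [∀ i, IsProbabilityMeasure (P i)] (hne : (P 0).real {0} ≠ (P 1).real {0})
    (h0 : Tendsto (fun k => labelCount (u k) 0) atTop atTop)
    (h1 : Tendsto (fun k => labelCount (u k) 1) atTop atTop) :
    Tendsto (fun k => (Measure.pi fun i : Fin (n k) => P (u k i)).real
      {v | PielouRejects α (u k) v}) atTop (𝓝 1) := by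
  set d := |(P 0).real {0} - (P 1).real {0}| with hd
  have hd0 : 0 < d := abs_pos.2 (sub_ne_zero.2 hne)
  set x := chiSqOneQuantile (1 - α) with hx
  have hr0 : Tendsto (fun k => (labelCount (u k) 0 : ℝ)) atTop atTop :=
    tendsto_natCast_atTop_atTop.comp h0
  have hr1 : Tendsto (fun k => (labelCount (u k) 1 : ℝ)) atTop atTop :=
    tendsto_natCast_atTop_atTop.comp h1
  -- Once both rows have at least `M` entries and the observed proportions differ by more than `d /
  -- 2`, the lower bound `2 M (d / 2)²` exceeds `x`. The maximum with 1 keeps `M` positive.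
  set M := max 1 (4 * x / d ^ 2) with hM
  have hM0 : 0 < M := lt_of_lt_of_le one_pos (le_max_left _ _)
  have hlim : Tendsto (fun k => 1 - (16 / d ^ 2 * (labelCount (u k) 0 : ℝ)⁻¹ +
      16 / d ^ 2 * (labelCount (u k) 1 : ℝ)⁻¹)) atTop (𝓝 1) := by
    simpa using (((tendsto_inv_atTop_zero.comp hr0).const_mul (16 / d ^ 2)).add
      ((tendsto_inv_atTop_zero.comp hr1).const_mul (16 / d ^ 2))).const_sub 1
  refine tendsto_of_tendsto_of_tendsto_of_le_of_le' hlim tendsto_const_nhds ?_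
    (Eventually.of_forall fun k => measureReal_le_one)
  filter_upwards [hr0.eventually_gt_atTop M, hr1.eventually_gt_atTop M] with k hk0 hk1
  set μ := Measure.pi fun i : Fin (n k) => P (u k i) with hμ
  have p0 := hM0.trans hk0
  have p1 := hM0.trans hk1
  -- On these events an observed row proportion is off by at least `d / 4`; outside both, the
  -- observed difference still exceeds `d / 2`.
  set B0 := {v : Fin (n k) → Fin 2 | d / 4 * labelCount (u k) 0 ≤
    |∑ i, classInd (u k i) * (classInd (v i) - (P (u k i)).real {0})|} with hB0
  set B1 := {v : Fin (n k) → Fin 2 | d / 4 * labelCount (u k) 1 ≤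
    |∑ i, (1 - classInd (u k i)) * (classInd (v i) - (P (u k i)).real {0})|} with hB1
  have hc0 : μ.real B0 ≤ 16 / d ^ 2 * (labelCount (u k) 0 : ℝ)⁻¹ := by
    refine (labels_weighted_sum_chebyshev (fun i => P (u k i)) (fun i => classInd (u k i))
      (by positivity)).trans (le_of_eq ?_)
    simp_rw [classInd_sq]
    rw [← labelCount_zero_cast]
    field_simp
    norm_num
  have hc1 : μ.real B1 ≤ 16 / d ^ 2 * (labelCount (u k) 1 : ℝ)⁻¹ := by
    refine (labels_weighted_sum_chebyshev (fun i => P (u k i)) (fun i => 1 - classInd (u k i))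
      (by positivity)).trans (le_of_eq ?_)
    have : ∀ i, (1 - classInd (u k i)) ^ 2 = 1 - classInd (u k i) := by
      intro i
      rw [sub_sq, classInd_sq]
      ring
    simp_rw [this]
    rw [← labelCount_one_cast]
    field_simp
    norm_num
  have hsub : (B0 ∪ B1)ᶜ ⊆ {v | PielouRejects α (u k) v} := by
    intro v hv
    rw [Set.compl_union] at hv
    have hv0 : |∑ i, classInd (u k i) * (classInd (v i) - (P (u k i)).real {0})| <
      d / 4 * labelCount (u k) 0 := not_le.1 hv.1
    have hv1 : |∑ i, (1 - classInd (u k i)) * (classInd (v i) - (P (u k i)).real {0})| <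
      d / 4 * labelCount (u k) 1 := not_le.1 hv.2
    have s0 : ∑ i, classInd (u k i) * (classInd (v i) - (P (u k i)).real {0}) =
        cellCount (u k) v 0 0 - labelCount (u k) 0 * (P 0).real {0} := by
      rw [cellCount_zero_zero, labelCount_zero_cast, Finset.sum_mul, ← Finset.sum_sub_distrib]
      refine Finset.sum_congr rfl fun i _ => ?_
      generalize u k i = a
      fin_cases a <;> simp
    have s1 : ∑ i, (1 - classInd (u k i)) * (classInd (v i) - (P (u k i)).real {0}) =
        cellCount (u k) v 1 0 - labelCount (u k) 1 * (P 1).real {0} := by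
      rw [cellCount_one_zero, labelCount_one_cast, Finset.sum_mul, ← Finset.sum_sub_distrib]
      refine Finset.sum_congr rfl fun i _ => ?_
      generalize u k i = a
      fin_cases a <;> simp
    rw [s0] at hv0
    rw [s1] at hv1
    have t0 : |(cellCount (u k) v 0 0 : ℝ) / labelCount (u k) 0 - (P 0).real {0}| < d / 4 := by
      rw [div_sub' p0.ne', abs_div, abs_of_pos p0, div_lt_iff₀ p0]
      exact hv0
    have t1 : |(cellCount (u k) v 1 0 : ℝ) / labelCount (u k) 1 - (P 1).real {0}| < d / 4 := by
      rw [div_sub' p1.ne', abs_div, abs_of_pos p1, div_lt_iff₀ p1]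
      exact hv1
    have hst := le_pielouStat (u k) v hM0 (by rw [rowSum_eq_labelCount]; exact hk0.le)
      (by rw [rowSum_eq_labelCount]; exact hk1.le)
    rw [rowSum_eq_labelCount, rowSum_eq_labelCount] at hst
    show x < pielouStat (u k) v
    set a := (cellCount (u k) v 0 0 : ℝ) / labelCount (u k) 0
    set b := (cellCount (u k) v 1 0 : ℝ) / labelCount (u k) 1
    have hab : d / 2 < |a - b| := by
      have := abs_sub_abs_le_abs_sub ((P 0).real {0} - (P 1).real {0}) (a - b)
      have h2 : |((P 0).real {0} - (P 1).real {0}) - (a - b)| ≤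
          |a - (P 0).real {0}| + |b - (P 1).real {0}| := by
        rw [show ((P 0).real {0} - (P 1).real {0}) - (a - b) =
          (b - (P 1).real {0}) - (a - (P 0).real {0}) by ring, add_comm]
        exact abs_sub _ _
      linarith
    have hab2 : (d / 2) ^ 2 < (a - b) ^ 2 := by
      rw [← sq_abs (a - b)]
      exact pow_lt_pow_left₀ hab (by positivity) two_ne_zero
    have hMx : 4 * x ≤ M * d ^ 2 := by
      rw [← div_le_iff₀ (by positivity)]
      exact le_max_right _ _
    nlinarith [mul_lt_mul_of_pos_left hab2 hM0]
  have hfin : 1 - (μ.real B0 + μ.real B1) ≤ μ.real {v | PielouRejects α (u k) v} := by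
    refine le_trans ?_ (measureReal_mono hsub)
    rw [probReal_compl_eq_one_sub (Set.toFinite _).measurableSet]
    linarith [measureReal_union_le (μ := μ) B0 B1]
  linarith

end RowWise


lemma labelCount_blockLabels_zero (m₁ m₂ : ℕ) : labelCount (blockLabels m₁ m₂) 0 = m₁ := by
  have h : (labelCount (blockLabels m₁ m₂) 0 : ℝ) = m₁ := by
    rw [labelCount_zero_cast, Fin.sum_univ_add]
    simp [blockLabels]
  exact_mod_cast h

lemma labelCount_blockLabels_one (m₁ m₂ : ℕ) : labelCount (blockLabels m₁ m₂) 1 = m₂ := by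
  have h := labelCount_add (blockLabels m₁ m₂)
  rw [labelCount_blockLabels_zero, Fintype.card_fin] at h
  omega

lemma measure_fin_two_ext {P Q : Measure (Fin 2)} [IsProbabilityMeasure P] [IsProbabilityMeasure Q]
    (h : P.real {0} = Q.real {0}) : P = Q := by
  have h1 : P.real {1} = Q.real {1} := by
    have e : ({1} : Set (Fin 2)) = {0}ᶜ := by
      ext j
      fin_cases j <;> simp
    rw [e, probReal_compl_eq_one_sub (measurableSet_singleton 0),
      probReal_compl_eq_one_sub (measurableSet_singleton 0), h]
  refine Measure.ext_of_singleton fun j => ?_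
  rw [← measureReal_eq_measureReal_iff]
  fin_cases j
  · exact h
  · exact h1

theorem rowwisePower_tendsto_size {α : ℝ} (hα : 0 < α) (hα' : α < 1) {m₁ m₂ : ℕ → ℕ}
    (h1 : Tendsto m₁ atTop atTop) (h2 : Tendsto m₂ atTop atTop) (P : Fin 2 → Measure (Fin 2))
    (hP : ∀ i, IsProbabilityMeasure (P i)) (heq : (P 0).real {0} = (P 1).real {0})
    (hp0 : 0 < (P 0).real {0}) (hp1 : (P 0).real {0} < 1) :
    Tendsto (fun k => rowwisePower α P (m₁ k) (m₂ k)) atTop (𝓝 α) := by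
  have hPP : ∀ i, P i = P 0 := by
    intro i
    fin_cases i
    · rfl
    · exact (measure_fin_two_ext heq).symm
  have := tendsto_rejection_of_iid_nnLabels (fun k => blockLabels (m₁ k) (m₂ k)) hα hα' (P 0)
    hp0 hp1 (by simpa only [labelCount_blockLabels_zero] using h1)
    (by simpa only [labelCount_blockLabels_one] using h2)
  refine this.congr fun k => ?_
  simp only [rowwisePower, hPP]

theorem rowwisePower_tendsto_one (α : ℝ) {m₁ m₂ : ℕ → ℕ}
    (h1 : Tendsto m₁ atTop atTop) (h2 : Tendsto m₂ atTop atTop) (P : Fin 2 → Measure (Fin 2))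
    (hP : ∀ i, IsProbabilityMeasure (P i)) (hne : (P 0).real {0} ≠ (P 1).real {0}) :
    Tendsto (fun k => rowwisePower α P (m₁ k) (m₂ k)) atTop (𝓝 1) :=
  tendsto_rejection_of_indep_nnLabels (fun k => blockLabels (m₁ k) (m₂ k)) α P hne
    (by simpa only [labelCount_blockLabels_zero] using h1)
    (by simpa only [labelCount_blockLabels_one] using h2)

/-! ### The overall multinomial framework, as a mixture over the base labels -/

/-- A limit along all sequences of labellings with growing classes is a limit in mean for
i.i.d. labels. -/
lemma tendsto_integral_iid_labels (Q : Measure (Fin 2)) [IsProbabilityMeasure Q]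
    (hq0 : 0 < Q.real {0}) (hq1 : Q.real {0} < 1) (g : ∀ n, (Fin n → Fin 2) → ℝ) {L : ℝ}
    (hg : ∀ n u, |g n u - L| ≤ 1)
    (h : ∀ (n : ℕ → ℕ) (u : ∀ k, Fin (n k) → Fin 2),
      Tendsto (fun k => labelCount (u k) 0) atTop atTop →
      Tendsto (fun k => labelCount (u k) 1) atTop atTop →
      Tendsto (fun k => g (n k) (u k)) atTop (𝓝 L)) :
    Tendsto (fun n => ∫ u, g n u ∂(Measure.pi fun _ : Fin n => Q)) atTop (𝓝 L) := by
  -- Convergence along every sequence is automatically uniform: if no `M` worked, one bad labelling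
  -- for each `M` would form a sequence contradicting the hypothesis.
  have hunif : ∀ ε > 0, ∃ M : ℕ, ∀ n (u : Fin n → Fin 2), M ≤ labelCount u 0 → M ≤ labelCount u 1 →
      |g n u - L| < ε := by
    intro ε hε
    by_contra hcon
    push Not at hcon
    choose n u h0 h1 hbad using hcon
    have hlim := h n u (tendsto_atTop_mono h0 tendsto_id) (tendsto_atTop_mono h1 tendsto_id)
    obtain ⟨k, hk⟩ := (Metric.tendsto_nhds.1 hlim ε hε).exists
    rw [Real.dist_eq] at hk
    exact absurd hk (not_lt.2 (hbad k))
  set q := Q.real {0} with hq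
  rw [Metric.tendsto_nhds]
  intro ε hε
  obtain ⟨M, hM⟩ := hunif (ε / 2) (by linarith)
  -- If the count of class 1 deviates from `n q` by less than `c n`, both classes still have at
  -- least `c n` members.
  set c := min q (1 - q) / 2 with hc
  have hc0 : 0 < c := half_pos (lt_min hq0 (by linarith))
  have hlim : Tendsto (fun n : ℕ => 1 / c ^ 2 * (n : ℝ)⁻¹) atTop (𝓝 0) := by
    have := (tendsto_inv_atTop_zero.comp (tendsto_natCast_atTop_atTop (R := ℝ))).const_mul (1 / c ^ 2)
    rw [mul_zero] at this
    exact this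
  have hbig : ∀ᶠ n : ℕ in atTop, (M : ℝ) ≤ c * n :=
    (tendsto_natCast_atTop_atTop.const_mul_atTop hc0).eventually_ge_atTop _
  filter_upwards [hlim.eventually (gt_mem_nhds (show (0 : ℝ) < ε / 2 by linarith)), hbig,
    eventually_gt_atTop 0] with n hn1 hn2 hn3
  have hn3' : (0 : ℝ) < n := by exact_mod_cast hn3
  set μ := Measure.pi fun _ : Fin n => Q with hμ
  set B := {u : Fin n → Fin 2 | c * n ≤ |∑ k, 1 * (classInd (u k) - Q.real {0})|} with hB
  have hBle : μ.real B ≤ 1 / c ^ 2 * (n : ℝ)⁻¹ := by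
    refine (labels_weighted_sum_chebyshev (fun _ : Fin n => Q) (fun _ => 1)
      (by positivity)).trans (le_of_eq ?_)
    simp
    field_simp
  have hpt : ∀ u, |g n u - L| ≤ ε / 2 + B.indicator (fun _ => (1 : ℝ)) u := by
    intro u
    by_cases hu : u ∈ B
    · rw [Set.indicator_of_mem hu]
      linarith [hg n u]
    · rw [Set.indicator_of_notMem hu, add_zero]
      have hu' : |∑ k, 1 * (classInd (u k) - Q.real {0})| < c * n := not_le.1 hu
      have e : ∑ k, 1 * (classInd (u k) - Q.real {0}) = labelCount u 0 - n * q := by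
        rw [labelCount_zero_cast]
        simp [Finset.sum_sub_distrib, hq]
      have hadd : (labelCount u 0 : ℝ) + labelCount u 1 = n := by
        have := labelCount_add u
        rw [Fintype.card_fin] at this
        exact_mod_cast this
      rw [e, abs_lt] at hu'
      have c1 : 2 * c * n ≤ q * n := mul_le_mul_of_nonneg_right
        (by rw [hc]; linarith [min_le_left q (1 - q)]) hn3'.le
      have c2 : 2 * c * n ≤ (1 - q) * n := mul_le_mul_of_nonneg_right
        (by rw [hc]; linarith [min_le_right q (1 - q)]) hn3'.le
      refine (hM n u ?_ ?_).le
      · have : (M : ℝ) ≤ labelCount u 0 := by linarith [hu'.1]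
        exact_mod_cast this
      · have : (M : ℝ) ≤ labelCount u 1 := by linarith [hu'.2]
        exact_mod_cast this
  rw [Real.dist_eq]
  have e1 : ∫ u, g n u ∂μ - L = ∫ u, (g n u - L) ∂μ := by
    rw [integral_sub .of_finite .of_finite]
    simp
  rw [e1]
  calc |∫ u, (g n u - L) ∂μ| ≤ ∫ u, |g n u - L| ∂μ := abs_integral_le_integral_abs
    _ ≤ ∫ u, (ε / 2 + B.indicator (fun _ => (1 : ℝ)) u) ∂μ :=
        integral_mono .of_finite .of_finite hpt
    _ = ε / 2 + μ.real B := by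
        rw [integral_add .of_finite .of_finite, integral_indicator (Set.toFinite _).measurableSet]
        simp
    _ < ε := by linarith

section Sample
variable (P : Measure (Fin 2 × Fin 2)) [IsProbabilityMeasure P]

/-- The conditional law of the NN label given the base label. -/
noncomputable def rowLaw (i : Fin 2) : Measure (Fin 2) := (P[|{p | p.1 = i}]).map Prod.snd

lemma rowLaw_real_singleton (P : Measure (Fin 2 × Fin 2)) (i j : Fin 2) : (rowLaw P i).real {j} = rowProb P i j := by
  rw [rowLaw, map_measureReal_apply (measurable_of_finite _) (measurableSet_singleton _),
    measureReal_def, cond_apply (Set.toFinite _).measurableSet, ENNReal.toReal_mul,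
    ENNReal.toReal_inv, rowProb, div_eq_inv_mul, measureReal_def, measureReal_def]
  congr 3
  ext p
  simp [Prod.ext_iff]

lemma isProbabilityMeasure_rowLaw {i : Fin 2} (h : 0 < P.real {p | p.1 = i}) :
    IsProbabilityMeasure (rowLaw P i) := by
  have : IsProbabilityMeasure (P[|{p | p.1 = i}]) := by
    refine cond_isProbabilityMeasure fun h0 => h.ne' ?_
    rw [measureReal_def, h0]
    rfl
  exact Measure.isProbabilityMeasure_map (measurable_of_finite _).aemeasurable

lemma pi_real_singleton {ι Ω : Type*} [Fintype ι] [MeasurableSpace Ω] (μ : ι → Measure Ω)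
    [∀ i, IsProbabilityMeasure (μ i)] (x : ι → Ω) :
    (Measure.pi μ).real {x} = ∏ i, (μ i).real {x i} := by
  simp only [measureReal_def]
  rw [Measure.pi_singleton, ENNReal.toReal_prod]

lemma measureReal_eq_sum_indicator {Ω : Type*} [Fintype Ω] [MeasurableSpace Ω]
    [MeasurableSingletonClass Ω] (μ : Measure Ω) [IsFiniteMeasure μ] (S : Set Ω) :
    μ.real S = ∑ ω, μ.real {ω} * S.indicator (fun _ => (1 : ℝ)) ω := by
  have h : μ.real S = ∫ ω, S.indicator (fun _ => (1 : ℝ)) ω ∂μ := by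
    rw [integral_indicator (Set.toFinite _).measurableSet]
    simp
  rw [h, integral_fintype .of_finite]
  simp

/-- The rejection probability for i.i.d. pairs is a mixture over the base labels. -/
lemma samplePower_eq_integral (α : ℝ) (h0 : 0 < P.real {p | p.1 = 0})
    (h1 : 0 < P.real {p | p.1 = 1}) (n : ℕ) :
    samplePower α P n = ∫ u, (Measure.pi fun k : Fin n => rowLaw P (u k)).real
      {v | PielouRejects α u v} ∂(Measure.pi fun _ : Fin n => P.map Prod.fst) := by
  have hrow : ∀ i, IsProbabilityMeasure (rowLaw P i) := by
    intro i
    fin_cases i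
    · exact isProbabilityMeasure_rowLaw P h0
    · exact isProbabilityMeasure_rowLaw P h1
  have hfst : IsProbabilityMeasure (P.map Prod.fst) :=
    Measure.isProbabilityMeasure_map (measurable_of_finite _).aemeasurable
  -- Disintegration of one pair. On a product of finite spaces it multiplies up to: conditionally on
  -- the base labels, the NN labels are independent with the row laws.
  have hprod : ∀ i j, P.real {(i, j)} = (P.map Prod.fst).real {i} * (rowLaw P i).real {j} := by
    intro i j
    rw [rowLaw_real_singleton, rowProb, map_measureReal_apply (measurable_of_finite _)
      (measurableSet_singleton _)]
    have e : Prod.fst ⁻¹' {i} = {p : Fin 2 × Fin 2 | p.1 = i} := rfl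
    rw [e, mul_div_cancel₀]
    fin_cases i
    · exact h0.ne'
    · exact h1.ne'
  rw [integral_fintype .of_finite, samplePower, measureReal_eq_sum_indicator,
    ← (Equiv.arrowProdEquivProdArrow (Fin n) (fun _ => Fin 2) (fun _ => Fin 2)).symm.sum_comp,
    Fintype.sum_prod_type]
  refine Finset.sum_congr rfl fun u _ => ?_
  rw [measureReal_eq_sum_indicator (Measure.pi fun k : Fin n => rowLaw P (u k)), smul_eq_mul,
    Finset.mul_sum]
  refine Finset.sum_congr rfl fun v _ => ?_
  rw [pi_real_singleton, pi_real_singleton, pi_real_singleton, ← mul_assoc,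
    ← Finset.prod_mul_distrib]
  congr 1
  exact Finset.prod_congr rfl fun k _ => hprod _ _

lemma fst_real_singleton (P : Measure (Fin 2 × Fin 2)) (i : Fin 2) : (P.map Prod.fst).real {i} = P.real {p | p.1 = i} :=
  map_measureReal_apply (measurable_of_finite _) (measurableSet_singleton _)

lemma fst_real_lt_one (h1 : 0 < P.real {p | p.1 = 1}) : P.real {p | p.1 = 0} < 1 := by
  have e : {p : Fin 2 × Fin 2 | p.1 = 0} = {p | p.1 = 1}ᶜ := by
    ext p
    obtain ⟨i, j⟩ := p
    fin_cases i <;> simp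
  rw [e, probReal_compl_eq_one_sub (Set.toFinite _).measurableSet]
  linarith

theorem samplePower_tendsto_size {α : ℝ} (hα : 0 < α) (hα' : α < 1)
    (h0 : 0 < P.real {p | p.1 = 0}) (h1 : 0 < P.real {p | p.1 = 1})
    (heq : rowProb P 0 0 = rowProb P 1 0) (hp0 : 0 < rowProb P 0 0) (hp1 : rowProb P 0 0 < 1) :
    Tendsto (fun n => samplePower α P n) atTop (𝓝 α) := by
  have r0 := isProbabilityMeasure_rowLaw P h0
  have r1 := isProbabilityMeasure_rowLaw P h1
  have hfst : IsProbabilityMeasure (P.map Prod.fst) :=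
    Measure.isProbabilityMeasure_map (measurable_of_finite _).aemeasurable
  have hrow1 : rowLaw P 1 = rowLaw P 0 :=
    measure_fin_two_ext (by rw [rowLaw_real_singleton, rowLaw_real_singleton, heq])
  have hrow : ∀ i, rowLaw P i = rowLaw P 0 := by
    intro i
    fin_cases i
    · rfl
    · exact hrow1
  simp_rw [samplePower_eq_integral P α h0 h1, hrow]
  refine tendsto_integral_iid_labels _ (by rwa [fst_real_singleton])
    (by rw [fst_real_singleton]; exact fst_real_lt_one P h1) _ (fun n u => ?_) (fun n u g0 g1 => ?_)
  · have k0 := measureReal_nonneg (μ := Measure.pi fun _ : Fin n => rowLaw P 0)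
      (s := {v | PielouRejects α u v})
    have k1 := measureReal_le_one (μ := Measure.pi fun _ : Fin n => rowLaw P 0)
      (s := {v | PielouRejects α u v})
    rw [abs_le]
    constructor <;> linarith
  · exact tendsto_rejection_of_iid_nnLabels u hα hα' (rowLaw P 0)
      (by rwa [rowLaw_real_singleton]) (by rwa [rowLaw_real_singleton]) g0 g1

theorem samplePower_tendsto_one (α : ℝ)
    (h0 : 0 < P.real {p | p.1 = 0}) (h1 : 0 < P.real {p | p.1 = 1})
    (hne : rowProb P 0 0 ≠ rowProb P 1 0) :
    Tendsto (fun n => samplePower α P n) atTop (𝓝 1) := by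
  have hrow : ∀ i, IsProbabilityMeasure (rowLaw P i) := by
    intro i
    fin_cases i
    · exact isProbabilityMeasure_rowLaw P h0
    · exact isProbabilityMeasure_rowLaw P h1
  have hfst : IsProbabilityMeasure (P.map Prod.fst) :=
    Measure.isProbabilityMeasure_map (measurable_of_finite _).aemeasurable
  simp_rw [samplePower_eq_integral P α h0 h1]
  refine tendsto_integral_iid_labels _ (by rwa [fst_real_singleton])
    (by rw [fst_real_singleton]; exact fst_real_lt_one P h1) _ (fun n u => ?_) (fun n u g0 g1 => ?_)
  · have k0 := measureReal_nonneg (μ := Measure.pi fun k : Fin n => rowLaw P (u k))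
      (s := {v | PielouRejects α u v})
    have k1 := measureReal_le_one (μ := Measure.pi fun k : Fin n => rowLaw P (u k))
      (s := {v | PielouRejects α u v})
    rw [abs_le]
    constructor <;> linarith
  · refine tendsto_rejection_of_indep_nnLabels u α (rowLaw P) ?_ g0 g1
    rwa [rowLaw_real_singleton, rowLaw_real_singleton]

end Sample


/-! ### The quadratic form of a nearest-neighbour map -/

section NNForm
variable {ι : Type*} [Fintype ι] [DecidableEq ι]

/-- The in-degrees of `η` are at most `K`, and `η` has no fixed point. -/
structure IsBoundedMap (η : ι → ι) (K : ℕ) : Prop where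
  ne : ∀ i, η i ≠ i
  indegree_le : ∀ j, (Finset.univ.filter fun i => η i = j).card ≤ K

/-- The quadratic form `∑ u_i u_{η i}`. -/
def nnForm (η : ι → ι) (u : ι → ℝ) : ℝ := ∑ i, u i * u (η i)

/-- The gradient of `nnForm`. -/
def nnGrad (η : ι → ι) (u : ι → ℝ) (j : ι) : ℝ := u (η j) + ∑ i with η i = j, u i

/-- Euler's identity for a quadratic form. -/
lemma sum_mul_nnGrad (η : ι → ι) (u : ι → ℝ) : ∑ j, u j * nnGrad η u j = 2 * nnForm η u := by
  have h : ∑ j, u j * ∑ i with η i = j, u i = nnForm η u := by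
    simp_rw [Finset.mul_sum, Finset.sum_filter]
    rw [Finset.sum_comm]
    refine Finset.sum_congr rfl fun i _ => ?_
    rw [Finset.sum_ite_eq Finset.univ (η i) fun j => u j * u i, if_pos (Finset.mem_univ _), mul_comm]
  simp_rw [nnGrad, mul_add]
  rw [Finset.sum_add_distrib, h, nnForm]
  ring

/-- The second-order coefficient in the change of `nnForm` under a transposition. -/
def swapCoeff (η : ι → ι) (j k : ι) : ℝ := (if η j = k then 1 else 0) + (if η k = j then 1 else 0)

/-- A transposition adds `(u k - u j) (1_j - 1_k)` to `u`, and the second-order Taylor expansion of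
a quadratic form is exact. Without fixed points of `η`, only arrows between `j` and `k` contribute
to the second-order term. -/
lemma nnForm_swap (η : ι → ι) (hη : ∀ i, η i ≠ i) (u : ι → ℝ) (j k : ι) :
    nnForm η (u ∘ Equiv.swap j k) - nnForm η u =
      (u k - u j) * (nnGrad η u j - nnGrad η u k) - (u k - u j) ^ 2 * swapCoeff η j k := by
  rcases eq_or_ne j k with rfl | hjk
  · simp
  set e : ι → ℝ := fun i => (if i = j then 1 else 0) - (if i = k then 1 else 0) with he
  have hu : ∀ i, (u ∘ Equiv.swap j k) i = u i + (u k - u j) * e i := by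
    intro i
    simp only [Function.comp, he]
    rcases eq_or_ne i j with rfl | h1
    · rw [Equiv.swap_apply_left, if_pos rfl, if_neg hjk]; ring
    rcases eq_or_ne i k with rfl | h2
    · rw [Equiv.swap_apply_right, if_neg h1, if_pos rfl]; ring
    rw [Equiv.swap_apply_of_ne_of_ne h1 h2, if_neg h1, if_neg h2]; ring
  have s1 : ∑ i, e i * u (η i) = u (η j) - u (η k) := by
    simp [he, sub_mul, Finset.sum_sub_distrib]
  have s2 : ∑ i, u i * e (η i) = (∑ i with η i = j, u i) - ∑ i with η i = k, u i := by
    simp [he, mul_sub, Finset.sum_sub_distrib, Finset.sum_filter]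
  have s3 : ∑ i, e i * e (η i) = -swapCoeff η j k := by
    have : ∑ i, e i * e (η i) = e (η j) - e (η k) := by
      simp [he, sub_mul, Finset.sum_sub_distrib]
    rw [this]
    simp only [he, swapCoeff, if_neg (hη j), if_neg (hη k)]
    ring
  have hexp : nnForm η (u ∘ Equiv.swap j k) = nnForm η u +
      (u k - u j) * (∑ i, e i * u (η i) + ∑ i, u i * e (η i)) +
      (u k - u j) ^ 2 * ∑ i, e i * e (η i) := by
    simp only [nnForm]
    rw [← Finset.sum_add_distrib, Finset.mul_sum, Finset.mul_sum, ← Finset.sum_add_distrib,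
      ← Finset.sum_add_distrib]
    refine Finset.sum_congr rfl fun i _ => ?_
    rw [hu, hu]
    ring
  rw [hexp, s1, s2, s3, nnGrad, nnGrad]
  ring

variable {η : ι → ι} {K : ℕ} (hη : IsBoundedMap η K) {u : ι → ℝ} (hu : ∀ i, |u i| ≤ 1)
include hη hu

lemma abs_nnGrad_le (j : ι) : |nnGrad η u j| ≤ 1 + K := by
  refine (abs_add_le _ _).trans (add_le_add (hu _) ?_)
  refine (Finset.abs_sum_le_sum_abs _ _).trans ?_
  refine (Finset.sum_le_card_nsmul _ _ 1 fun i _ => hu i).trans ?_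
  rw [nsmul_eq_mul, mul_one]
  exact_mod_cast hη.indegree_le j

lemma abs_nnForm_swap_sub_le (j k : ι) :
    |nnForm η (u ∘ Equiv.swap j k) - nnForm η u| ≤ 12 + 4 * K := by
  rw [nnForm_swap η hη.ne]
  have h1 : |u k - u j| ≤ 2 := (abs_sub _ _).trans (by linarith [hu k, hu j])
  have h2 : |nnGrad η u j - nnGrad η u k| ≤ 2 * (1 + K) :=
    (abs_sub _ _).trans (by linarith [abs_nnGrad_le hη hu j, abs_nnGrad_le hη hu k])
  have h3 : |swapCoeff η j k| ≤ 2 := by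
    unfold swapCoeff
    split_ifs <;> norm_num
  refine (abs_sub _ _).trans ?_
  rw [abs_mul, abs_mul, abs_pow]
  -- The constant is `2 · 2 (1 + K) + 2² · 2`.
  have h4 := mul_le_mul h1 h2 (abs_nonneg _) (by norm_num)
  have h5 := mul_le_mul (pow_le_pow_left₀ (abs_nonneg _) h1 2) h3 (abs_nonneg _) (by norm_num)
  linarith

/-- The sum of the first-order effects of all transpositions. -/
lemma abs_sum_swap_effect_sub_le (h0 : ∑ i, u i = 0) :
    |∑ i, ∑ k with k ≠ i, u i * u k * (nnForm η (u ∘ Equiv.swap (η i) k) - nnForm η u) -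
      ((∑ k, u k ^ 2) * (∑ i, u i * nnGrad η u (η i)) + 2 * nnForm η u ^ 2)| ≤
      (8 + 8 * (K : ℝ)) * (Fintype.card ι : ℝ) := by
  set G := nnGrad η u with hG
  -- The first-order part summed over all `k` has a closed form: expanding gives four terms, two
  -- vanish because `u` sums to zero, and the last is `nnForm` times its own Euler sum.
  have hfull : ∑ i, ∑ k, u i * u k * ((u k - u (η i)) * (G (η i) - G k)) =
      (∑ k, u k ^ 2) * (∑ i, u i * G (η i)) + 2 * nnForm η u ^ 2 := by
    have hk : ∀ i, ∑ k, u i * u k * ((u k - u (η i)) * (G (η i) - G k)) =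
        u i * G (η i) * ∑ k, u k ^ 2 - u i * u (η i) * G (η i) * ∑ k, u k -
          u i * ∑ k, u k ^ 2 * G k + u i * u (η i) * ∑ k, u k * G k := by
      intro i
      simp_rw [Finset.mul_sum]
      rw [← Finset.sum_sub_distrib, ← Finset.sum_sub_distrib, ← Finset.sum_add_distrib]
      exact Finset.sum_congr rfl fun k _ => by ring
    simp_rw [hk, h0, hG, sum_mul_nnGrad]
    rw [Finset.sum_add_distrib, Finset.sum_sub_distrib, Finset.sum_sub_distrib, ← Finset.sum_mul,
      ← Finset.sum_mul, ← Finset.sum_mul, ← Finset.sum_mul, h0]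
    rw [show ∑ i, u i * u (η i) = nnForm η u from rfl]
    ring
  have hsplit : ∑ i, ∑ k with k ≠ i, u i * u k * (nnForm η (u ∘ Equiv.swap (η i) k) - nnForm η u) =
      ∑ i, ∑ k, u i * u k * ((u k - u (η i)) * (G (η i) - G k)) -
      ∑ i, (u i * u i * ((u i - u (η i)) * (G (η i) - G i)) +
        ∑ k with k ≠ i, u i * u k * ((u k - u (η i)) ^ 2 * swapCoeff η (η i) k)) := by
    rw [← Finset.sum_sub_distrib]
    refine Finset.sum_congr rfl fun i _ => ?_
    have : ∑ k, u i * u k * ((u k - u (η i)) * (G (η i) - G k)) =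
        u i * u i * ((u i - u (η i)) * (G (η i) - G i)) +
        ∑ k with k ≠ i, u i * u k * ((u k - u (η i)) * (G (η i) - G k)) := by
      rw [Finset.filter_ne']
      exact (Finset.add_sum_erase _ _ (Finset.mem_univ i)).symm
    rw [this, add_sub_add_left_eq_sub, ← Finset.sum_sub_distrib]
    refine Finset.sum_congr rfl fun k _ => ?_
    rw [nnForm_swap η hη.ne]
    ring
  rw [hsplit, hfull, sub_sub_cancel_left, abs_neg]
  refine (Finset.abs_sum_le_sum_abs _ _).trans ?_
  -- The error for each `i` is the spurious summand `k = i` plus the second-order terms. Those stay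
  -- bounded because the coefficients `swapCoeff η (η i) k` sum over `k` to at most `1 + K`.
  have hterm : ∀ i, |u i * u i * ((u i - u (η i)) * (G (η i) - G i)) +
      ∑ k with k ≠ i, u i * u k * ((u k - u (η i)) ^ 2 * swapCoeff η (η i) k)| ≤ 8 + 8 * K := by
    intro i
    have hd : ∀ j k, |u k - u j| ≤ 2 := fun j k => (abs_sub _ _).trans (by linarith [hu k, hu j])
    have h1 : |u i * u i * ((u i - u (η i)) * (G (η i) - G i))| ≤ 4 + 4 * K := by
      have h2 : |G (η i) - G i| ≤ 2 * (1 + K) :=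
        (abs_sub _ _).trans (by linarith [abs_nnGrad_le hη hu (η i), abs_nnGrad_le hη hu i])
      rw [abs_mul, abs_mul, abs_mul]
      have h3 := mul_le_mul (hd (η i) i) h2 (abs_nonneg _) (by norm_num)
      have h4 : |u i| * |u i| ≤ 1 := mul_le_one₀ (hu i) (abs_nonneg _) (hu i)
      have h5 := mul_le_of_le_one_left (mul_nonneg (abs_nonneg (u i - u (η i)))
        (abs_nonneg (G (η i) - G i))) h4
      linarith
    have h2 : |∑ k with k ≠ i, u i * u k * ((u k - u (η i)) ^ 2 * swapCoeff η (η i) k)| ≤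
        4 + 4 * K := by
      refine (Finset.abs_sum_le_sum_abs _ _).trans ?_
      calc ∑ k with k ≠ i, |u i * u k * ((u k - u (η i)) ^ 2 * swapCoeff η (η i) k)|
          ≤ ∑ k with k ≠ i, 4 * swapCoeff η (η i) k := by
            refine Finset.sum_le_sum fun k _ => ?_
            have hs : 0 ≤ swapCoeff η (η i) k := by unfold swapCoeff; split_ifs <;> norm_num
            rw [abs_mul, abs_mul, abs_mul, abs_pow, abs_of_nonneg hs]
            have k1 : |u i| * |u k| ≤ 1 := mul_le_one₀ (hu i) (abs_nonneg _) (hu k)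
            have k2 := mul_le_mul_of_nonneg_right (pow_le_pow_left₀ (abs_nonneg _) (hd (η i) k) 2) hs
            have k3 := mul_le_of_le_one_left (mul_nonneg (pow_nonneg (abs_nonneg (u k - u (η i))) 2)
              hs) k1
            linarith
        _ ≤ ∑ k, 4 * swapCoeff η (η i) k := by
            refine Finset.sum_le_sum_of_subset_of_nonneg (Finset.filter_subset _ _) fun k _ _ => ?_
            unfold swapCoeff; split_ifs <;> norm_num
        _ = 4 * (1 + ((Finset.univ.filter fun k => η k = η i).card : ℝ)) := by
            rw [← Finset.mul_sum]
            simp only [swapCoeff]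
            rw [Finset.sum_add_distrib]
            simp
        _ ≤ 4 + 4 * K := by
            have : ((Finset.univ.filter fun k => η k = η i).card : ℝ) ≤ K := by
              exact_mod_cast hη.indegree_le (η i)
            linarith
    refine (abs_add_le _ _).trans ?_
    linarith
  refine (Finset.sum_le_card_nsmul _ _ _ fun i _ => hterm i).trans (le_of_eq ?_)
  rw [nsmul_eq_mul, Finset.card_univ, mul_comm]

end NNForm

/-- Off-diagonal coefficients of the quadratic form `∑ u_i G_{η i}`. -/
def nnWeight {ι : Type*} [DecidableEq ι] (η : ι → ι) (i a : ι) : ℝ :=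
  (if a = η (η i) then 1 else 0) + (if η a = η i then 1 else 0)

lemma nnWeight_nonneg {ι : Type*} [DecidableEq ι] (η : ι → ι) (i a : ι) : 0 ≤ nnWeight η i a := by
  unfold nnWeight; split_ifs <;> norm_num

section NNWeight
variable {ι : Type*} [Fintype ι] [DecidableEq ι] (η : ι → ι)

/-- The diagonal coefficient at `i` is 1 from `η a = η i`, and one more exactly when `i` belongs to
a reflexive pair. This is where `R` enters the variance. -/
lemma sum_mul_nnGrad_comp (u : ι → ℝ) : ∑ i, u i * nnGrad η u (η i) =
    ∑ i, (1 + if η (η i) = i then (1 : ℝ) else 0) * u i ^ 2 +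
      ∑ i, ∑ a with a ≠ i, nnWeight η i a * (u i * u a) := by
  rw [← Finset.sum_add_distrib]
  refine Finset.sum_congr rfl fun i _ => ?_
  have h : u i * nnGrad η u (η i) = ∑ a, nnWeight η i a * (u i * u a) := by
    simp only [nnGrad, nnWeight, add_mul, Finset.sum_add_distrib, mul_add, Finset.mul_sum,
      Finset.sum_filter]
    simp
  rw [h, Finset.filter_ne', ← Finset.add_sum_erase _ _ (Finset.mem_univ i)]
  simp only [nnWeight, eq_comm (a := i)]
  simp
  ring

variable {η} {K : ℕ} (hη : IsBoundedMap η K)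
include hη

lemma sum_nnWeight_le (i : ι) : ∑ a, nnWeight η i a ≤ 1 + K := by
  simp only [nnWeight, Finset.sum_add_distrib]
  have : ((Finset.univ.filter fun k => η k = η i).card : ℝ) ≤ K := by
    exact_mod_cast hη.indegree_le (η i)
  simpa using this

/-- A point has at most `K ^ 2` preimages under two steps of `η`, and it shares its image with at
most `K` points (itself included). -/
lemma sum_nnWeight_le' (a : ι) : ∑ i, nnWeight η i a ≤ K ^ 2 + K := by
  simp only [nnWeight, Finset.sum_add_distrib]
  have h1 : ((Finset.univ.filter fun k => η k = η a).card : ℝ) ≤ K := by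
    exact_mod_cast hη.indegree_le (η a)
  have h2 : ∑ i, (if a = η (η i) then (1 : ℝ) else 0) ≤ K ^ 2 := by
    have e : ∀ i, (if a = η (η i) then (1 : ℝ) else 0) =
        ∑ b with η b = a, if η i = b then (1 : ℝ) else 0 := by
      intro i
      rw [Finset.sum_filter]
      simp_rw [← ite_and, and_comm (a := η _ = a), ite_and]
      rw [Finset.sum_ite_eq Finset.univ (η i)]
      simp [eq_comm]
    simp_rw [e]
    rw [Finset.sum_comm]
    have hb : ∀ b, ∑ i, (if η i = b then (1 : ℝ) else 0) ≤ K := by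
      intro b
      rw [Finset.sum_boole]
      exact_mod_cast hη.indegree_le b
    refine (Finset.sum_le_card_nsmul _ _ _ fun b _ => hb b).trans ?_
    rw [nsmul_eq_mul, sq]
    exact mul_le_mul_of_nonneg_right (by exact_mod_cast hη.indegree_le a) (by positivity)
  have h3 : ∑ i, (if η a = η i then (1 : ℝ) else 0) ≤ K := by
    simp_rw [eq_comm (a := η a)]
    rw [Finset.sum_boole]
    exact h1
  linarith

end NNWeight


/-! ### Exchangeable labels -/

lemma integral_abs_le_of_bound {Ω : Type*} [MeasurableSpace Ω] {P : Measure Ω}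
    [IsProbabilityMeasure P] (F : Ω → ℝ) {C : ℝ} (h : ∀ l, |F l| ≤ C) :
    |∫ l, F l ∂P| ≤ C := by
  have := norm_integral_le_of_norm_le_const (μ := P) (f := F) (.of_forall h)
  simpa using this

section Exchangeable
variable {ι : Type*} [Fintype ι] [DecidableEq ι]

/-- The law of the labels is invariant under transpositions. -/
def IsSwapInvariant (ν : Measure (ι → Fin 2)) : Prop :=
  ∀ j k : ι, ν.map (fun l => l ∘ Equiv.swap j k) = ν

lemma centredLabel_swap (l : ι → Fin 2) (j k : ι) :
    centredLabel (l ∘ Equiv.swap j k) = centredLabel l ∘ Equiv.swap j k := by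
  have h : labelCount (l ∘ Equiv.swap j k) 0 = labelCount l 0 := by
    have : (labelCount (l ∘ Equiv.swap j k) 0 : ℝ) = labelCount l 0 := by
      rw [labelCount_zero_cast, labelCount_zero_cast]
      exact Equiv.sum_comp (Equiv.swap j k) fun i => classInd (l i)
    exact_mod_cast this
  funext i
  simp [centredLabel, h]

variable {ν : Measure (ι → Fin 2)}

lemma IsSwapInvariant.integral_comp (hν : IsSwapInvariant ν) {E : Type*} [NormedAddCommGroup E]
    [NormedSpace ℝ E] (F : (ι → Fin 2) → E) (j k : ι) :
    ∫ l, F (l ∘ Equiv.swap j k) ∂ν = ∫ l, F l ∂ν := by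
  conv_rhs => rw [← hν j k]
  rw [integral_map (measurable_of_finite _).aemeasurable .of_discrete]

variable [IsProbabilityMeasure ν] (hν : IsSwapInvariant ν)
include hν

/-- Exchanging a label outside `S` for the average over all labels outside `S`. -/
lemma IsSwapInvariant.integral_mul_centredLabel (S : Finset ι) (m : ι)
    (F : (ι → Fin 2) → ℝ) (hF : ∀ l, ∀ m' ∉ S, F (l ∘ Equiv.swap m m') = F l) :
    ((Fintype.card ι : ℝ) - S.card) * ∫ l, F l * centredLabel l m ∂ν =
      -∫ l, F l * ∑ s ∈ S, centredLabel l s ∂ν := by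
  -- By invariance under the transposition of `m` and `m'`, all labels outside `S` have the same
  -- integral against `F`. Their sum is minus the sum over `S`, since the total is zero.
  have h1 : ∀ m' ∈ Sᶜ, ∫ l, F l * centredLabel l m' ∂ν = ∫ l, F l * centredLabel l m ∂ν := by
    intro m' hm'
    rw [← hν.integral_comp (fun l => F l * centredLabel l m') m m']
    refine integral_congr_ae (.of_forall fun l => ?_)
    simp only
    rw [hF l m' (Finset.mem_compl.1 hm'), centredLabel_swap]
    simp
  have h2 : ∑ m' ∈ Sᶜ, ∫ l, F l * centredLabel l m' ∂ν =
      -∫ l, F l * ∑ s ∈ S, centredLabel l s ∂ν := by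
    rw [← integral_finsetSum _ fun _ _ => .of_finite, ← integral_neg]
    refine integral_congr_ae (.of_forall fun l => ?_)
    simp only
    rw [← Finset.mul_sum, ← mul_neg]
    congr 1
    have := Finset.sum_compl_add_sum S (centredLabel l)
    rw [sum_centredLabel] at this
    linarith
  rw [← h2, Finset.sum_congr rfl h1, Finset.sum_const, Finset.card_compl, nsmul_eq_mul,
    Nat.cast_sub (Finset.card_le_univ S)]

/-- The other centred labels sum to `-u_i`, so by exchangeability the covariance is `-E[u_i²] / (n -
1)`. -/
lemma IsSwapInvariant.abs_integral_pair_le {i m : ι} (him : i ≠ m) :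
    ((Fintype.card ι : ℝ) - 1) * |∫ l, centredLabel l i * centredLabel l m ∂ν| ≤ 1 := by
  have h := hν.integral_mul_centredLabel {i} m
    (fun l => centredLabel l i) (fun l m' hm' => by
      rw [centredLabel_swap, Function.comp, Equiv.swap_apply_of_ne_of_ne him
        (by rintro rfl; simp at hm')])
  have hc : 1 ≤ (Fintype.card ι : ℝ) := by
    exact_mod_cast Fintype.card_pos_iff.2 ⟨i⟩
  simp only [Finset.card_singleton, Nat.cast_one, Finset.sum_singleton] at h
  rw [← abs_of_nonneg (show 0 ≤ (Fintype.card ι : ℝ) - 1 by linarith), ← abs_mul, h, abs_neg]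
  refine integral_abs_le_of_bound _ fun l => ?_
  rw [abs_mul]
  exact mul_le_one₀ (abs_centredLabel_le _ _) (abs_nonneg _) (abs_centredLabel_le _ _)

/-- Under the integral the fourth label may be replaced by `-(u_i + u_j + u_k) / (n - 3)`. Order `1
/ n` is enough: a sparse quadratic form has total weight of order `n`, so disjoint index pairs
contribute `O(n)` to its second moment. -/
lemma IsSwapInvariant.abs_integral_quadruple_le {i j k m : ι} (hij : i ≠ j) (hik : i ≠ k)
    (him : i ≠ m) (hjk : j ≠ k) (hjm : j ≠ m) (hkm : k ≠ m) :
    ((Fintype.card ι : ℝ) - 3) *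
      |∫ l, centredLabel l i * centredLabel l j * centredLabel l k * centredLabel l m ∂ν| ≤ 3 := by
  have hcard : ({i, j, k} : Finset ι).card = 3 := Finset.card_eq_three.2 ⟨i, j, k, hij, hik, hjk, rfl⟩
  have h := hν.integral_mul_centredLabel {i, j, k} m
    (fun l => centredLabel l i * centredLabel l j * centredLabel l k) (fun l m' hm' => by
      simp only [Finset.mem_insert, Finset.mem_singleton, not_or] at hm'
      rw [centredLabel_swap, Function.comp_apply, Function.comp_apply, Function.comp_apply,
        Equiv.swap_apply_of_ne_of_ne him (Ne.symm hm'.1),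
        Equiv.swap_apply_of_ne_of_ne hjm (Ne.symm hm'.2.1),
        Equiv.swap_apply_of_ne_of_ne hkm (Ne.symm hm'.2.2)])
  have hc : 3 ≤ (Fintype.card ι : ℝ) := by
    have := Finset.card_le_univ ({i, j, k} : Finset ι)
    rw [hcard] at this
    exact_mod_cast this
  rw [hcard] at h
  push_cast at h
  rw [← abs_of_nonneg (show 0 ≤ (Fintype.card ι : ℝ) - 3 by linarith), ← abs_mul, h, abs_neg]
  refine integral_abs_le_of_bound _ fun l => ?_
  have hb := abs_centredLabel_le l
  have hs : |∑ s ∈ ({i, j, k} : Finset ι), centredLabel l s| ≤ 3 := by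
    refine (Finset.abs_sum_le_sum_abs _ _).trans
      ((Finset.sum_le_card_nsmul _ _ 1 fun s _ => hb s).trans ?_)
    rw [hcard]
    norm_num
  have hp : |centredLabel l i * centredLabel l j * centredLabel l k| ≤ 1 := by
    rw [abs_mul, abs_mul]
    exact mul_le_one₀ (mul_le_one₀ (hb i) (abs_nonneg _) (hb j)) (abs_nonneg _) (hb k)
  rw [abs_mul]
  calc _ ≤ 1 * 3 := mul_le_mul hp hs (abs_nonneg _) (by norm_num)
    _ = 3 := by norm_num

/-- Second moment of a linear form in exchangeable labels. -/
lemma IsSwapInvariant.integral_linear_sq_le (hn : 2 ≤ Fintype.card ι) (w : ι → ℝ) {W : ℝ}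
    (hw : ∀ i, |w i| ≤ W) :
    ∫ l, (∑ i, w i * centredLabel l i) ^ 2 ∂ν ≤ 3 * Fintype.card ι * W ^ 2 := by
  have hn' : (2 : ℝ) ≤ Fintype.card ι := by exact_mod_cast hn
  have hexp : ∫ l, (∑ i, w i * centredLabel l i) ^ 2 ∂ν =
      ∑ i, ∑ j, w i * w j * ∫ l, centredLabel l i * centredLabel l j ∂ν := by
    simp_rw [← integral_const_mul]
    rw [← Finset.sum_congr rfl fun i _ => integral_finsetSum _ fun _ _ => .of_finite,
      ← integral_finsetSum _ fun _ _ => .of_finite]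
    refine integral_congr_ae (.of_forall fun l => ?_)
    simp only
    rw [sq, Finset.sum_mul_sum]
    exact Finset.sum_congr rfl fun i _ => Finset.sum_congr rfl fun j _ => by ring
  rw [hexp]
  -- For `n ≥ 2` the covariance bound `1 / (n - 1)` is at most `2 / n`. Diagonal and off-diagonal
  -- terms then account for 1 and 2 of the constant 3.
  have hterm : ∀ i j, w i * w j * ∫ l, centredLabel l i * centredLabel l j ∂ν ≤
      W ^ 2 * ((if i = j then 1 else 0) + 2 / Fintype.card ι) := by
    intro i j
    have hww : |w i * w j| ≤ W ^ 2 := by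
      rw [abs_mul, sq]
      exact mul_le_mul (hw i) (hw j) (abs_nonneg _) ((abs_nonneg _).trans (hw i))
    have hE : |∫ l, centredLabel l i * centredLabel l j ∂ν| ≤
        (if i = j then 1 else 0) + 2 / Fintype.card ι := by
      by_cases hij : i = j
      · rw [if_pos hij]
        have : |∫ l, centredLabel l i * centredLabel l j ∂ν| ≤ 1 := by
          refine integral_abs_le_of_bound _ fun l => ?_
          rw [abs_mul]
          exact mul_le_one₀ (abs_centredLabel_le _ _) (abs_nonneg _) (abs_centredLabel_le _ _)
        have : (0 : ℝ) ≤ 2 / Fintype.card ι := by positivity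
        linarith
      · rw [if_neg hij, zero_add, le_div_iff₀ (by linarith)]
        have h1 := hν.abs_integral_pair_le hij
        nlinarith [abs_nonneg (∫ l, centredLabel l i * centredLabel l j ∂ν)]
    refine (le_abs_self _).trans ?_
    rw [abs_mul]
    exact mul_le_mul hww hE (abs_nonneg _) (sq_nonneg _)
  refine (Finset.sum_le_sum fun i _ => Finset.sum_le_sum fun j _ => hterm i j).trans (le_of_eq ?_)
  simp_rw [← Finset.mul_sum, Finset.sum_add_distrib]
  simp
  field_simp
  ring

/-- Second moment of a sparse off-diagonal quadratic form in exchangeable labels. -/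
lemma IsSwapInvariant.integral_quadratic_sq_le (hn : 6 ≤ Fintype.card ι) (w : ι → ι → ℝ)
    (hw : ∀ i a, 0 ≤ w i a) {A : ℝ} (hA : 0 ≤ A) (hrow : ∀ i, ∑ a, w i a ≤ A)
    (hcol : ∀ a, ∑ i, w i a ≤ A) :
    ∫ l, (∑ i, ∑ a with a ≠ i, w i a * (centredLabel l i * centredLabel l a)) ^ 2 ∂ν ≤
      10 * Fintype.card ι * A ^ 2 := by
  have hn' : (6 : ℝ) ≤ Fintype.card ι := by exact_mod_cast hn
  set w' : ι × ι → ℝ := fun p => if p.2 ≠ p.1 then w p.1 p.2 else 0 with hw'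
  have hw0 : ∀ p, 0 ≤ w' p := fun p => by simp only [hw']; split_ifs <;> simp [hw]
  have hwle : ∀ p, w' p ≤ w p.1 p.2 := fun p => by simp only [hw']; split_ifs <;> simp [hw]
  have hform : ∀ l : ι → Fin 2, ∑ i, ∑ a with a ≠ i, w i a * (centredLabel l i * centredLabel l a) =
      ∑ p, w' p * (centredLabel l p.1 * centredLabel l p.2) := by
    intro l
    rw [Fintype.sum_prod_type]
    refine Finset.sum_congr rfl fun i _ => ?_
    rw [Finset.sum_filter]
    refine Finset.sum_congr rfl fun a _ => ?_
    simp only [hw']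
    split_ifs <;> simp
  simp_rw [hform]
  have hexp : ∫ l, (∑ p, w' p * (centredLabel l p.1 * centredLabel l p.2)) ^ 2 ∂ν =
      ∑ p, ∑ q, w' p * w' q *
        ∫ l, centredLabel l p.1 * centredLabel l p.2 * centredLabel l q.1 * centredLabel l q.2 ∂ν := by
    simp_rw [← integral_const_mul]
    rw [← Finset.sum_congr rfl fun i _ => integral_finsetSum _ fun _ _ => .of_finite,
      ← integral_finsetSum _ fun _ _ => .of_finite]
    refine integral_congr_ae (.of_forall fun l => ?_)
    simp only
    rw [sq, Finset.sum_mul_sum]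
    exact Finset.sum_congr rfl fun i _ => Finset.sum_congr rfl fun j _ => by ring
  rw [hexp]
  -- This counts coincidences between the two index pairs. Overlapping pairs are bounded trivially
  -- by 1; disjoint ones by `3 / (n - 3) ≤ 6 / n`, which needs `n ≥ 6`. Four coincidences and the 6
  -- give the constant 10.
  set δ : ι × ι → ι × ι → ℝ := fun p q => (if q.1 = p.1 then 1 else 0) + (if q.2 = p.1 then 1 else 0) +
    (if q.1 = p.2 then 1 else 0) + (if q.2 = p.2 then 1 else 0) with hδ
  have hterm : ∀ p q, w' p * w' q *
      ∫ l, centredLabel l p.1 * centredLabel l p.2 * centredLabel l q.1 * centredLabel l q.2 ∂ν ≤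
      w' p * (w' q * (6 / Fintype.card ι + δ p q)) := by
    intro p q
    rw [mul_assoc]
    have hδ0 : 0 ≤ 6 / (Fintype.card ι : ℝ) + δ p q := by
      simp only [hδ]
      positivity
    by_cases hp : p.2 = p.1
    · simp [hw', hp]
    by_cases hq : q.2 = q.1
    · simp [hw', hq]
    refine mul_le_mul_of_nonneg_left (mul_le_mul_of_nonneg_left ((le_abs_self _).trans ?_) (hw0 q))
      (hw0 p)
    by_cases hd : q.1 = p.1 ∨ q.2 = p.1 ∨ q.1 = p.2 ∨ q.2 = p.2
    · have h1 : 1 ≤ δ p q := by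
        simp only [hδ]
        rcases hd with h | h | h | h <;> rw [if_pos h] <;> split_ifs <;> norm_num
      have h2 : (0 : ℝ) ≤ 6 / Fintype.card ι := by positivity
      have h3 : |∫ l, centredLabel l p.1 * centredLabel l p.2 * centredLabel l q.1 *
          centredLabel l q.2 ∂ν| ≤ 1 := by
        refine integral_abs_le_of_bound _ fun l => ?_
        have hb := abs_centredLabel_le l
        rw [abs_mul, abs_mul, abs_mul]
        exact mul_le_one₀ (mul_le_one₀ (mul_le_one₀ (hb _) (abs_nonneg _) (hb _)) (abs_nonneg _)
          (hb _)) (abs_nonneg _) (hb _)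
      linarith
    · simp only [not_or] at hd
      have h1 := hν.abs_integral_quadruple_le (Ne.symm hp) (Ne.symm hd.1) (Ne.symm hd.2.1)
        (Ne.symm hd.2.2.1) (Ne.symm hd.2.2.2) (Ne.symm hq)
      have h2 : δ p q = 0 := by
        simp only [hδ, if_neg hd.1, if_neg hd.2.1, if_neg hd.2.2.1, if_neg hd.2.2.2]
        norm_num
      rw [h2, add_zero, le_div_iff₀ (by linarith)]
      nlinarith [abs_nonneg (∫ l, centredLabel l p.1 * centredLabel l p.2 * centredLabel l q.1 *
        centredLabel l q.2 ∂ν)]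
  have htot : ∑ p, w' p ≤ Fintype.card ι * A := by
    rw [Fintype.sum_prod_type]
    refine (Finset.sum_le_card_nsmul _ _ A fun i _ =>
      (Finset.sum_le_sum fun a _ => hwle (i, a)).trans (hrow i)).trans (le_of_eq ?_)
    rw [nsmul_eq_mul, Finset.card_univ]
  have hr : ∀ c, ∑ q, w' q * (if q.1 = c then 1 else 0) ≤ A := by
    intro c
    rw [Fintype.sum_prod_type]
    refine le_trans (le_of_eq ?_) ((Finset.sum_le_sum fun a _ => hwle (c, a)).trans (hrow c))
    rw [Finset.sum_eq_single c] <;> simp +contextual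
  have hc : ∀ c, ∑ q, w' q * (if q.2 = c then 1 else 0) ≤ A := by
    intro c
    rw [Fintype.sum_prod_type_right]
    refine le_trans (le_of_eq ?_) ((Finset.sum_le_sum fun a _ => hwle (a, c)).trans (hcol c))
    rw [Finset.sum_eq_single c] <;> simp +contextual
  have hinner : ∀ p, ∑ q, w' q * (6 / Fintype.card ι + δ p q) ≤ 10 * A := by
    intro p
    have e : ∑ q, w' q * (6 / Fintype.card ι + δ p q) = 6 / Fintype.card ι * ∑ q, w' q +
        (∑ q, w' q * (if q.1 = p.1 then 1 else 0) + ∑ q, w' q * (if q.2 = p.1 then 1 else 0) +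
        ∑ q, w' q * (if q.1 = p.2 then 1 else 0) + ∑ q, w' q * (if q.2 = p.2 then 1 else 0)) := by
      rw [Finset.mul_sum, ← Finset.sum_add_distrib, ← Finset.sum_add_distrib,
        ← Finset.sum_add_distrib, ← Finset.sum_add_distrib]
      exact Finset.sum_congr rfl fun q _ => by simp only [hδ]; ring
    have h6 : 6 / (Fintype.card ι : ℝ) * ∑ q, w' q ≤ 6 * A := by
      rw [div_mul_eq_mul_div, div_le_iff₀ (by linarith)]
      nlinarith
    rw [e]
    linarith [hr p.1, hr p.2, hc p.1, hc p.2]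
  calc _ ≤ ∑ p, ∑ q, w' p * (w' q * (6 / Fintype.card ι + δ p q)) :=
        Finset.sum_le_sum fun p _ => Finset.sum_le_sum fun q _ => hterm p q
    _ = ∑ p, w' p * ∑ q, w' q * (6 / Fintype.card ι + δ p q) :=
        Finset.sum_congr rfl fun p _ => (Finset.mul_sum _ _ _).symm
    _ ≤ ∑ p, w' p * (10 * A) :=
        Finset.sum_le_sum fun p _ => mul_le_mul_of_nonneg_left (hinner p) (hw0 p)
    _ = (∑ p, w' p) * (10 * A) := (Finset.sum_mul _ _ _).symm
    _ ≤ (Fintype.card ι * A) * (10 * A) := mul_le_mul_of_nonneg_right htot (by positivity)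
    _ = _ := by ring

end Exchangeable


/-- Indicators are idempotent, so the square is an affine function of the label. Diagonal parts of
quadratic forms therefore reduce to a constant plus a linear form. -/
lemma centredLabel_sq {ι : Type*} [Fintype ι] (l : ι → Fin 2) (i : ι) : centredLabel l i ^ 2 =
    (labelCount l 0 / Fintype.card ι) * (1 - labelCount l 0 / Fintype.card ι) +
      (1 - 2 * (labelCount l 0 / Fintype.card ι)) * centredLabel l i := by
  rw [centredLabel, sub_sq, classInd_sq]
  ring

/-! ### Central limit theorem for the quadratic form, by random transpositions -/

section NNClt
variable {ι : Type*} [Fintype ι] [DecidableEq ι] {ν : Measure (ι → Fin 2)} [IsProbabilityMeasure ν]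

/-- A differential inequality characterising approximate normality. -/
lemma norm_sub_gaussian_le_of_deriv {ψ ψ' : ℝ → ℂ} (hψ : ∀ s, HasDerivAt ψ (ψ' s) s) (h0 : ψ 0 = 1)
    {t ε : ℝ} (hε : ∀ s, |s| ≤ |t| → ‖ψ' s + s * ψ s‖ ≤ ε) :
    ‖ψ t - Complex.exp (-t ^ 2 / 2)‖ ≤ |t| * ε := by
  -- The integrating factor turns `ψ' + s ψ` into a derivative, and the mean value inequality
  -- integrates it. The factor at the endpoint is cancelled by `exp (-t² / 2)`.
  have hg : ∀ s : ℝ, HasDerivAt (fun s : ℝ => ψ s * Complex.exp ((s ^ 2 / 2 : ℝ)))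
      ((ψ' s + s * ψ s) * Complex.exp ((s ^ 2 / 2 : ℝ))) s := by
    intro s
    have h1 : HasDerivAt (fun s : ℝ => s ^ 2 / 2) s s := by
      exact ((hasDerivAt_pow 2 s).div_const 2).congr_deriv (by push_cast; ring)
    have h2 := (hψ s).fun_mul (h1.ofReal_comp.cexp)
    exact h2.congr_deriv (by ring)
  have hmv := Convex.norm_image_sub_le_of_norm_hasDerivWithin_le (s := Set.uIcc 0 t)
    (C := ε * Real.exp (t ^ 2 / 2)) (fun s _ => (hg s).hasDerivWithinAt) (fun s hs => ?_)
    (convex_uIcc 0 t) Set.left_mem_uIcc Set.right_mem_uIcc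
  · have e0 : ψ 0 * Complex.exp (((0 : ℝ) ^ 2 / 2 : ℝ)) = 1 := by simp [h0]
    rw [e0] at hmv
    have e1 : ψ t - Complex.exp (-t ^ 2 / 2) =
        (ψ t * Complex.exp ((t ^ 2 / 2 : ℝ)) - 1) * Complex.exp (-(t ^ 2 / 2 : ℝ)) := by
      rw [sub_mul, mul_assoc, ← Complex.exp_add, add_neg_cancel, Complex.exp_zero, mul_one, one_mul]
      congr 2
      push_cast
      ring
    have e2 : ‖Complex.exp (-(t ^ 2 / 2 : ℝ))‖ = Real.exp (-(t ^ 2 / 2)) := by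
      rw [← Complex.ofReal_neg, ← Complex.ofReal_exp, Complex.norm_real, Real.norm_eq_abs,
        abs_of_pos (Real.exp_pos _)]
    rw [e1, norm_mul, e2]
    refine (mul_le_mul_of_nonneg_right hmv (Real.exp_pos _).le).trans (le_of_eq ?_)
    rw [sub_zero, Real.norm_eq_abs, Real.exp_neg]
    field_simp
  · have hs' : |s| ≤ |t| := by
      rcases le_total 0 t with h | h
      · rw [Set.uIcc_of_le h] at hs
        rw [abs_of_nonneg hs.1, abs_of_nonneg h]
        exact hs.2
      · rw [Set.uIcc_of_ge h] at hs
        rw [abs_of_nonpos hs.2, abs_of_nonpos h]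
        linarith [hs.1]
    rw [norm_mul, ← Complex.ofReal_exp, Complex.norm_real, Real.norm_eq_abs,
      abs_of_pos (Real.exp_pos _)]
    have h1 := hε s hs'
    have h2 : s ^ 2 ≤ t ^ 2 := sq_le_sq.2 hs'
    exact mul_le_mul h1 (Real.exp_le_exp.2 (by linarith)) (Real.exp_pos _).le
      ((norm_nonneg _).trans h1)

lemma norm_exp_I_sub_taylor_one_le {x : ℝ} (hx : |x| ≤ 1) :
    ‖Complex.exp (x * Complex.I) - 1 - x * Complex.I‖ ≤ x ^ 2 := by
  have := Complex.norm_exp_sub_one_sub_id_le (x := x * Complex.I) (by simpa using hx)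
  simpa using this

lemma integral_abs_le_sqrt {Ω : Type*} [Finite Ω] [MeasurableSpace Ω] [DiscreteMeasurableSpace Ω]
    {P : Measure Ω} [IsProbabilityMeasure P] (F : Ω → ℝ) {C : ℝ} (h : ∫ ω, F ω ^ 2 ∂P ≤ C) :
    ∫ ω, |F ω| ∂P ≤ √C := by
  refine Real.le_sqrt_of_sq_le (le_trans ?_ h)
  have hvar := variance_nonneg (fun ω => |F ω|) P
  rw [variance_eq_sub .of_discrete] at hvar
  simp only [Pi.pow_apply, sq_abs] at hvar
  linarith

/-- Exchange identity for the quadratic form of a nearest-neighbour map. -/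
lemma IsSwapInvariant.integral_nnForm_mul (hν : IsSwapInvariant ν) (η : ι → ι) (hη : ∀ i, η i ≠ i)
    (F : ℝ → ℂ) :
    ((Fintype.card ι : ℂ) - 1) *
        ∫ l, (nnForm η (centredLabel l) : ℂ) * F (nnForm η (centredLabel l)) ∂ν +
      ∫ l, ((∑ i, centredLabel l i ^ 2 : ℝ) : ℂ) * F (nnForm η (centredLabel l)) ∂ν =
    ∫ l, ∑ i, ∑ k with k ≠ i, ((centredLabel l i * centredLabel l k : ℝ) : ℂ) *
      (F (nnForm η (centredLabel l ∘ Equiv.swap (η i) k)) - F (nnForm η (centredLabel l))) ∂ν := by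
  -- The transposition of `η i` and `k` carries the label of `k` to `η i` and leaves `i` alone, as
  -- both `k` and `η i` differ from `i`.
  have hswap : ∀ i k, k ≠ i →
      ∫ l, ((centredLabel l i * centredLabel l k : ℝ) : ℂ) *
        F (nnForm η (centredLabel l ∘ Equiv.swap (η i) k)) ∂ν =
      ∫ l, ((centredLabel l i * centredLabel l (η i) : ℝ) : ℂ) *
        F (nnForm η (centredLabel l)) ∂ν := by
    intro i k hk
    rw [← hν.integral_comp (fun l => ((centredLabel l i * centredLabel l (η i) : ℝ) : ℂ) *
      F (nnForm η (centredLabel l))) (η i) k]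
    refine integral_congr_ae (.of_forall fun l => ?_)
    simp only
    rw [centredLabel_swap, Function.comp_apply, Function.comp_apply, Equiv.swap_apply_left,
      Equiv.swap_apply_of_ne_of_ne (hη i).symm hk.symm]
  have hR : ∫ l, ∑ i, ∑ k with k ≠ i, ((centredLabel l i * centredLabel l k : ℝ) : ℂ) *
      (F (nnForm η (centredLabel l ∘ Equiv.swap (η i) k)) - F (nnForm η (centredLabel l))) ∂ν =
      ∑ i, ∑ k with k ≠ i, (∫ l, ((centredLabel l i * centredLabel l (η i) : ℝ) : ℂ) *
        F (nnForm η (centredLabel l)) ∂ν -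
        ∫ l, ((centredLabel l i * centredLabel l k : ℝ) : ℂ) * F (nnForm η (centredLabel l)) ∂ν) := by
    rw [integral_finsetSum _ fun _ _ => .of_finite]
    refine Finset.sum_congr rfl fun i _ => ?_
    rw [integral_finsetSum _ fun _ _ => .of_finite]
    refine Finset.sum_congr rfl fun k hk => ?_
    rw [← hswap i k (Finset.mem_filter.1 hk).2, ← integral_sub .of_finite .of_finite]
    simp_rw [mul_sub]
  rw [hR]
  -- The first integral does not depend on `k` and is counted `n - 1` times; in the second, the
  -- labels other than `i` sum to minus the label of `i`.
  have hi : ∀ i, ∑ k with k ≠ i, (∫ l, ((centredLabel l i * centredLabel l (η i) : ℝ) : ℂ) *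
        F (nnForm η (centredLabel l)) ∂ν -
        ∫ l, ((centredLabel l i * centredLabel l k : ℝ) : ℂ) * F (nnForm η (centredLabel l)) ∂ν) =
      ((Fintype.card ι : ℂ) - 1) * ∫ l, ((centredLabel l i * centredLabel l (η i) : ℝ) : ℂ) *
        F (nnForm η (centredLabel l)) ∂ν +
      ∫ l, ((centredLabel l i ^ 2 : ℝ) : ℂ) * F (nnForm η (centredLabel l)) ∂ν := by
    intro i
    rw [Finset.sum_sub_distrib, Finset.sum_const, ← integral_finsetSum _ fun _ _ => .of_finite,
      Finset.filter_ne', Finset.card_erase_of_mem (Finset.mem_univ i), Finset.card_univ,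
      nsmul_eq_mul, Nat.cast_sub (Fintype.card_pos_iff.2 ⟨i⟩), Nat.cast_one, sub_eq_add_neg]
    congr 1
    rw [← integral_neg]
    refine integral_congr_ae (.of_forall fun l => ?_)
    simp only
    rw [← Finset.sum_mul, ← neg_mul]
    congr 1
    have h1 := Finset.add_sum_erase Finset.univ (centredLabel l) (Finset.mem_univ i)
    rw [sum_centredLabel] at h1
    have h2 : ∑ k ∈ Finset.univ.erase i, centredLabel l i * centredLabel l k =
        -(centredLabel l i ^ 2) := by
      rw [← Finset.mul_sum]
      have : ∑ k ∈ Finset.univ.erase i, centredLabel l k = -centredLabel l i := by linarith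
      rw [this]; ring
    rw [← Complex.ofReal_sum, h2]
    simp
  simp_rw [hi]
  rw [Finset.sum_add_distrib, ← Finset.mul_sum, ← integral_finsetSum _ fun _ _ => .of_finite,
    ← integral_finsetSum _ fun _ _ => .of_finite]
  congr 1
  · congr 1
    refine integral_congr_ae (.of_forall fun l => ?_)
    simp only
    rw [← Finset.sum_mul, ← Complex.ofReal_sum]
    rfl
  · refine integral_congr_ae (.of_forall fun l => ?_)
    simp only
    rw [← Finset.sum_mul, ← Complex.ofReal_sum]

variable {η : ι → ι} {K : ℕ}

lemma IsSwapInvariant.integral_nnForm_sq_le (hν : IsSwapInvariant ν) (hη : IsBoundedMap η K)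
    (hn : 6 ≤ Fintype.card ι) :
    ∫ l, nnForm η (centredLabel l) ^ 2 ∂ν ≤ 10 * Fintype.card ι * (1 + K) ^ 2 := by
  have h := hν.integral_quadratic_sq_le hn (fun i a => if η i = a then 1 else 0)
    (fun i a => by split_ifs <;> norm_num) (A := 1 + K) (by positivity)
    (fun i => by simp) (fun a => by
      rw [Finset.sum_boole]
      have : ((Finset.univ.filter fun i => η i = a).card : ℝ) ≤ K := by
        exact_mod_cast hη.indegree_le a
      linarith)
  refine le_of_eq_of_le ?_ h
  refine integral_congr_ae (.of_forall fun l => ?_)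
  simp only
  congr 1
  rw [nnForm]
  refine Finset.sum_congr rfl fun i _ => ?_
  rw [Finset.sum_eq_single (η i) (fun b _ hb => by rw [if_neg hb.symm, zero_mul])
    (fun h => absurd (by simpa using hη.ne i) h), if_pos rfl, one_mul]

end NNClt


section NNClt
variable {ι : Type*} [Fintype ι] [DecidableEq ι] {ν : Measure (ι → Fin 2)} [IsProbabilityMeasure ν]
  {η : ι → ι} {K : ℕ}

/-- Concentration of the conditional variance of the quadratic form under random transpositions. -/
lemma IsSwapInvariant.integral_abs_condVar_sub_le (hν : IsSwapInvariant ν) (hη : IsBoundedMap η K)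
    (hn : 6 ≤ Fintype.card ι) {p : ℝ} (hp0 : 0 ≤ p) (hp1 : p ≤ 1)
    (hm : ∀ᵐ l ∂ν, (labelCount l 0 : ℝ) / Fintype.card ι = p) :
    ∫ l, |∑ i, centredLabel l i * nnGrad η (centredLabel l) (η i) - p * (1 - p) *
      (Fintype.card ι + (Finset.univ.filter fun i => η (η i) = i).card)| ∂ν ≤
      8 * (1 + K) ^ 2 * √(Fintype.card ι) := by
  set n : ℝ := (Fintype.card ι : ℝ) with hndef
  have hn0 : 0 ≤ n := by positivity
  set w : ι → ℝ := fun i => (1 + if η (η i) = i then (1 : ℝ) else 0) * (1 - 2 * p) with hw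
  have hwle : ∀ i, |w i| ≤ 2 := by
    intro i
    have h1 : |1 - 2 * p| ≤ 1 := by rw [abs_le]; constructor <;> linarith
    have h2 : |1 + if η (η i) = i then (1 : ℝ) else 0| ≤ 2 := by split_ifs <;> norm_num
    rw [hw, abs_mul]
    calc _ ≤ 2 * 1 := mul_le_mul h2 h1 (abs_nonneg _) (by norm_num)
      _ = 2 := by norm_num
  have hK1 : (1 : ℝ) ≤ (1 + K) ^ 2 := by
    have : (1 : ℝ) ≤ 1 + K := by linarith [(Nat.cast_nonneg K : (0 : ℝ) ≤ K)]
    nlinarith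
  have hlin := integral_abs_le_sqrt _ (hν.integral_linear_sq_le (by omega) w hwle)
  have hoff := integral_abs_le_sqrt _ (hν.integral_quadratic_sq_le hn (nnWeight η)
    (nnWeight_nonneg η) (A := (1 + K) ^ 2) (by positivity)
    (fun i => (sum_nnWeight_le hη i).trans (by nlinarith [(Nat.cast_nonneg K : (0 : ℝ) ≤ K)]))
    (fun a => (sum_nnWeight_le' hη a).trans (by nlinarith [(Nat.cast_nonneg K : (0 : ℝ) ≤ K)])))
  have hs1 : √(3 * n * 2 ^ 2) ≤ 4 * (1 + K) ^ 2 * √n := by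
    rw [show 3 * n * 2 ^ 2 = 12 * n by ring, Real.sqrt_mul (by norm_num)]
    have : √12 ≤ 4 := by rw [Real.sqrt_le_left (by norm_num)]; norm_num
    exact mul_le_mul_of_nonneg_right (by linarith) (Real.sqrt_nonneg _)
  have hs2 : √(10 * n * ((1 + (K : ℝ)) ^ 2) ^ 2) ≤ 4 * (1 + K) ^ 2 * √n := by
    rw [Real.sqrt_mul (by positivity), Real.sqrt_sq (by positivity), Real.sqrt_mul (by norm_num)]
    have : √10 ≤ 4 := by rw [Real.sqrt_le_left (by norm_num)]; norm_num
    have h2 : 0 ≤ (1 + (K : ℝ)) ^ 2 * √n := by positivity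
    nlinarith [mul_le_mul_of_nonneg_right this h2]
  calc _ ≤ ∫ l, (|∑ i, w i * centredLabel l i| + |∑ i, ∑ a with a ≠ i, nnWeight η i a *
        (centredLabel l i * centredLabel l a)|) ∂ν := by
        refine integral_mono_ae .of_finite .of_finite ?_
        filter_upwards [hm] with l hl
        refine le_of_eq_of_le ?_ (abs_add_le _ _)
        congr 1
        rw [sum_mul_nnGrad_comp]
        -- The constant parts sum to `p (1 - p) (n + R)`. The rest is a linear form with weights
        -- `w`, whose mean absolute value is of order `√n`, like that of the off-diagonal form.
        have hd : ∀ i, (1 + if η (η i) = i then (1 : ℝ) else 0) * centredLabel l i ^ 2 =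
            (1 + if η (η i) = i then (1 : ℝ) else 0) * (p * (1 - p)) + w i * centredLabel l i := by
          intro i
          rw [centredLabel_sq, hl]
          simp only [hw]
          ring
        simp_rw [hd]
        rw [Finset.sum_add_distrib, ← Finset.sum_mul, Finset.sum_add_distrib, Finset.sum_boole]
        simp
        ring
    _ = ∫ l, |∑ i, w i * centredLabel l i| ∂ν + ∫ l, |∑ i, ∑ a with a ≠ i, nnWeight η i a *
        (centredLabel l i * centredLabel l a)| ∂ν := integral_add .of_finite .of_finite
    _ ≤ 4 * (1 + K) ^ 2 * √n + 4 * (1 + K) ^ 2 * √n := add_le_add (hlin.trans hs1) (hoff.trans hs2)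
    _ = _ := by ring

/-- The first-order expansion of the exchange identity for the characteristic function. -/
lemma IsSwapInvariant.norm_exchange_expansion_le (hν : IsSwapInvariant ν) (hη : IsBoundedMap η K)
    {τ : ℝ} (hτ : |τ| * (12 + 4 * K) ≤ 1) :
    ‖((Fintype.card ι : ℂ) - 1) * ∫ l, (nnForm η (centredLabel l) : ℂ) *
          Complex.exp ((τ * nnForm η (centredLabel l) : ℝ) * Complex.I) ∂ν +
        ∫ l, ((∑ i, centredLabel l i ^ 2 : ℝ) : ℂ) *
          Complex.exp ((τ * nnForm η (centredLabel l) : ℝ) * Complex.I) ∂ν -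
        ∫ l, ((τ * ∑ i, ∑ k with k ≠ i, centredLabel l i * centredLabel l k *
          (nnForm η (centredLabel l ∘ Equiv.swap (η i) k) - nnForm η (centredLabel l)) : ℝ) : ℂ) *
          Complex.I * Complex.exp ((τ * nnForm η (centredLabel l) : ℝ) * Complex.I) ∂ν‖ ≤
      (Fintype.card ι : ℝ) ^ 2 * (|τ| * (12 + 4 * K)) ^ 2 := by
  rw [hν.integral_nnForm_mul η hη.ne fun x => Complex.exp ((τ * x : ℝ) * Complex.I),
    ← integral_sub .of_finite .of_finite]
  -- The estimate holds for each labelling separately: at most `n²` transpositions, each with a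
  -- first-order Taylor remainder of the exponential.
  have hbound : ∀ l : ι → Fin 2, ‖∑ i, ∑ k with k ≠ i, ((centredLabel l i * centredLabel l k : ℝ) : ℂ) *
      (Complex.exp ((τ * nnForm η (centredLabel l ∘ Equiv.swap (η i) k) : ℝ) * Complex.I) -
        Complex.exp ((τ * nnForm η (centredLabel l) : ℝ) * Complex.I)) -
      ((τ * ∑ i, ∑ k with k ≠ i, centredLabel l i * centredLabel l k *
        (nnForm η (centredLabel l ∘ Equiv.swap (η i) k) - nnForm η (centredLabel l)) : ℝ) : ℂ) *
        Complex.I * Complex.exp ((τ * nnForm η (centredLabel l) : ℝ) * Complex.I)‖ ≤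
      (Fintype.card ι : ℝ) ^ 2 * (|τ| * (12 + 4 * K)) ^ 2 := by
    intro l
    set T := nnForm η (centredLabel l) with hT
    set d : ι → ι → ℝ := fun i k => nnForm η (centredLabel l ∘ Equiv.swap (η i) k) - T with hd
    have hdle : ∀ i k, |τ * d i k| ≤ |τ| * (12 + 4 * K) := by
      intro i k
      rw [abs_mul]
      exact mul_le_mul_of_nonneg_left
        (abs_nnForm_swap_sub_le hη (abs_centredLabel_le l) (η i) k) (abs_nonneg _)
    have e : ∑ i, ∑ k with k ≠ i, ((centredLabel l i * centredLabel l k : ℝ) : ℂ) *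
        (Complex.exp ((τ * nnForm η (centredLabel l ∘ Equiv.swap (η i) k) : ℝ) * Complex.I) -
          Complex.exp ((τ * T : ℝ) * Complex.I)) -
        ((τ * ∑ i, ∑ k with k ≠ i, centredLabel l i * centredLabel l k * d i k : ℝ) : ℂ) *
          Complex.I * Complex.exp ((τ * T : ℝ) * Complex.I) =
        ∑ i, ∑ k with k ≠ i, ((centredLabel l i * centredLabel l k : ℝ) : ℂ) *
          (Complex.exp ((τ * T : ℝ) * Complex.I) *
            (Complex.exp ((τ * d i k : ℝ) * Complex.I) - 1 - (τ * d i k : ℝ) * Complex.I)) := by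
      rw [Finset.mul_sum, Complex.ofReal_sum, Finset.sum_mul, Finset.sum_mul,
        ← Finset.sum_sub_distrib]
      refine Finset.sum_congr rfl fun i _ => ?_
      rw [Finset.mul_sum, Complex.ofReal_sum, Finset.sum_mul, Finset.sum_mul,
        ← Finset.sum_sub_distrib]
      refine Finset.sum_congr rfl fun k _ => ?_
      have hT' : τ * nnForm η (centredLabel l ∘ Equiv.swap (η i) k) = τ * T + τ * d i k := by
        simp only [hd]; ring
      rw [hT', Complex.ofReal_add, add_mul, Complex.exp_add]
      push_cast
      ring
    rw [e]
    have hterm : ∀ i k, ‖((centredLabel l i * centredLabel l k : ℝ) : ℂ) *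
          (Complex.exp ((τ * T : ℝ) * Complex.I) *
            (Complex.exp ((τ * d i k : ℝ) * Complex.I) - 1 - (τ * d i k : ℝ) * Complex.I))‖ ≤
          (|τ| * (12 + 4 * K)) ^ 2 := by
      intro i k
      rw [norm_mul, norm_mul, Complex.norm_exp_ofReal_mul_I, one_mul, Complex.norm_real,
        Real.norm_eq_abs, abs_mul]
      have h1 : |centredLabel l i| * |centredLabel l k| ≤ 1 :=
        mul_le_one₀ (abs_centredLabel_le l i) (abs_nonneg _) (abs_centredLabel_le l k)
      refine (mul_le_of_le_one_left (norm_nonneg _) h1).trans ?_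
      refine (norm_exp_I_sub_taylor_one_le ((hdle i k).trans hτ)).trans ?_
      rw [← sq_abs (τ * d i k)]
      exact pow_le_pow_left₀ (abs_nonneg _) (hdle i k) 2
    have hC : 0 ≤ (|τ| * (12 + 4 * (K : ℝ))) ^ 2 := by positivity
    refine (norm_sum_le _ _).trans ?_
    have hrow : ∀ i, ‖∑ k with k ≠ i, ((centredLabel l i * centredLabel l k : ℝ) : ℂ) *
          (Complex.exp ((τ * T : ℝ) * Complex.I) *
            (Complex.exp ((τ * d i k : ℝ) * Complex.I) - 1 - (τ * d i k : ℝ) * Complex.I))‖ ≤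
          (Fintype.card ι : ℝ) * (|τ| * (12 + 4 * K)) ^ 2 := by
      intro i
      refine (norm_sum_le _ _).trans ((Finset.sum_le_card_nsmul _ _ _ fun k _ => hterm i k).trans ?_)
      rw [nsmul_eq_mul]
      exact mul_le_mul_of_nonneg_right (by exact_mod_cast Finset.card_le_univ _) hC
    refine (Finset.sum_le_card_nsmul _ _ _ fun i _ => hrow i).trans (le_of_eq ?_)
    rw [nsmul_eq_mul, Finset.card_univ]
    ring
  have := norm_integral_le_of_norm_le_const (μ := ν) (.of_forall hbound)
  simpa using this

/-- The sum of squares of the centred labels. -/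
lemma ae_sum_centredLabel_sq_eq {ι : Type*} [Fintype ι] {ν : Measure (ι → Fin 2)} {p : ℝ}
    (hm : ∀ᵐ l ∂ν, (labelCount l 0 : ℝ) / Fintype.card ι = p) :
    ∀ᵐ l ∂ν, ∑ i, centredLabel l i ^ 2 = Fintype.card ι * (p * (1 - p)) := by
  filter_upwards [hm] with l hl
  rcases isEmpty_or_nonempty ι with h | h
  · simp
  have hn : (Fintype.card ι : ℝ) ≠ 0 := by exact_mod_cast Fintype.card_ne_zero
  have h1 : (labelCount l 1 : ℝ) = Fintype.card ι - labelCount l 0 := by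
    rw [← labelCount_add l]; push_cast; ring
  have h2 : (labelCount l 0 : ℝ) = Fintype.card ι * p := by rw [← hl]; field_simp
  rw [sum_centredLabel_sq, h1, h2]
  field_simp

lemma norm_integral_sum_sq_mul_exp_le {ι : Type*} [Fintype ι] {ν : Measure (ι → Fin 2)}
    [IsProbabilityMeasure ν] {p : ℝ} (hp0 : 0 ≤ p) (hp1 : p ≤ 1)
    (hm : ∀ᵐ l ∂ν, (labelCount l 0 : ℝ) / Fintype.card ι = p) (g : (ι → Fin 2) → ℝ) :
    ‖∫ l, ((∑ i, centredLabel l i ^ 2 : ℝ) : ℂ) * Complex.exp ((g l : ℝ) * Complex.I) ∂ν‖ ≤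
      Fintype.card ι := by
  have hp : 0 ≤ p * (1 - p) := mul_nonneg hp0 (by linarith)
  have : ∀ᵐ l ∂ν, ‖((∑ i, centredLabel l i ^ 2 : ℝ) : ℂ) *
      Complex.exp ((g l : ℝ) * Complex.I)‖ ≤ Fintype.card ι := by
    filter_upwards [ae_sum_centredLabel_sq_eq hm] with l hl
    rw [hl, norm_mul, Complex.norm_exp_ofReal_mul_I, mul_one, Complex.norm_real, Real.norm_eq_abs,
      abs_of_nonneg (by positivity)]
    exact mul_le_of_le_one_right (by positivity) (by nlinarith)
  have h2 := norm_integral_le_of_norm_le_const this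
  rwa [probReal_univ, mul_one] at h2

/-- With `v = p (1 - p)`, `T = nnForm` and `H = ∑ u_i G_{η i}`, the sum of effects is `n v H + 2 T²
+ O(n)`. Here `H` is within order `√n` of `v (n + R)` in mean and `T²` has mean `O(n)`, so the sum
is `(n - 1) S` up to order `n √n`. The constant is `38 = 8 + 20 + 8 + 2`: from `H`, from `2 T²`,
from the deterministic error, and from `S ≤ 2 n`. -/
lemma IsSwapInvariant.integral_abs_swapEffect_sub_le (hν : IsSwapInvariant ν)
    (hη : IsBoundedMap η K) (hn : 6 ≤ Fintype.card ι) {p : ℝ} (hp0 : 0 ≤ p) (hp1 : p ≤ 1)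
    (hm : ∀ᵐ l ∂ν, (labelCount l 0 : ℝ) / Fintype.card ι = p) {S : ℝ}
    (hS : S = (p * (1 - p)) ^ 2 *
      (Fintype.card ι + (Finset.univ.filter fun i => η (η i) = i).card)) :
    ∫ l, |∑ i, ∑ k with k ≠ i, centredLabel l i * centredLabel l k *
        (nnForm η (centredLabel l ∘ Equiv.swap (η i) k) - nnForm η (centredLabel l)) -
      ((Fintype.card ι : ℝ) - 1) * S| ∂ν ≤
      38 * (1 + K) ^ 2 * (Fintype.card ι * √(Fintype.card ι)) := by
  have hVae := ae_sum_centredLabel_sq_eq hm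
  have hcv := hν.integral_abs_condVar_sub_le hη hn hp0 hp1 hm
  have hT2 := hν.integral_nnForm_sq_le hη hn
  have hn6 : (6 : ℝ) ≤ (Fintype.card ι : ℝ) := by exact_mod_cast hn
  have hRn : ((Finset.univ.filter fun i => η (η i) = i).card : ℝ) ≤ Fintype.card ι := by
    exact_mod_cast Finset.card_le_univ _
  have hR0 : (0 : ℝ) ≤ ((Finset.univ.filter fun i => η (η i) = i).card : ℝ) := by positivity
  have hv0 : 0 ≤ p * (1 - p) := mul_nonneg hp0 (by linarith)
  have hv1 : p * (1 - p) ≤ 1 := by nlinarith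
  have hdet : ∀ l : ι → Fin 2, _ := fun l =>
    abs_sum_swap_effect_sub_le hη (abs_centredLabel_le l) (sum_centredLabel l)
  generalize ((Finset.univ.filter fun i => η (η i) = i).card : ℝ) = R at *
  generalize p * (1 - p) = v at *
  generalize (Fintype.card ι : ℝ) = n at *
  have hK : (0 : ℝ) ≤ K := by positivity
  have hL1 : (1 : ℝ) ≤ (1 + K) ^ 2 := by nlinarith
  have hsn1 : 1 ≤ √n := Real.one_le_sqrt.2 (by linarith)
  have hn0 : 0 ≤ n := by linarith
  have hs2n : S ≤ 2 * n := by
    rw [hS]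
    have : v ^ 2 ≤ 1 := by nlinarith
    nlinarith
  have hS0 : 0 ≤ S := by rw [hS]; positivity
  have hpt : ∀ᵐ l ∂ν, |∑ i, ∑ k with k ≠ i, centredLabel l i * centredLabel l k *
        (nnForm η (centredLabel l ∘ Equiv.swap (η i) k) - nnForm η (centredLabel l)) -
      (n - 1) * S| ≤ ((8 + 8 * (K : ℝ)) * n + 2 * n) + (n * |∑ i, centredLabel l i *
        nnGrad η (centredLabel l) (η i) - v * (n + R)| + 2 * nnForm η (centredLabel l) ^ 2) := by
    filter_upwards [hVae] with l hl
    have h1 := hdet l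
    rw [hl] at h1
    generalize ∑ i, centredLabel l i * nnGrad η (centredLabel l) (η i) = H at *
    generalize ∑ i, ∑ k with k ≠ i, centredLabel l i * centredLabel l k *
        (nnForm η (centredLabel l ∘ Equiv.swap (η i) k) - nnForm η (centredLabel l)) = Q at *
    generalize nnForm η (centredLabel l) = T at *
    have e : Q - (n - 1) * S = (Q - (n * v * H + 2 * T ^ 2)) +
        (n * v * (H - v * (n + R)) + S + 2 * T ^ 2) := by
      rw [hS]; ring
    rw [e]
    refine (abs_add_le _ _).trans ?_
    have h2 : |n * v * (H - v * (n + R)) + S + 2 * T ^ 2| ≤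
        n * |H - v * (n + R)| + 2 * n + 2 * T ^ 2 := by
      refine (abs_add_le _ _).trans (add_le_add ((abs_add_le _ _).trans (add_le_add ?_ ?_)) ?_)
      · rw [abs_mul, abs_of_nonneg (mul_nonneg hn0 hv0)]
        exact mul_le_mul_of_nonneg_right (mul_le_of_le_one_right hn0 hv1) (abs_nonneg _)
      · rwa [abs_of_nonneg hS0]
      · rw [abs_of_nonneg (by positivity)]
    linarith
  refine (integral_mono_ae .of_finite .of_finite hpt).trans ?_
  rw [integral_add .of_finite .of_finite, integral_const, probReal_univ, one_smul,
    integral_add .of_finite .of_finite, integral_const_mul, integral_const_mul]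
  have h3 := mul_le_mul_of_nonneg_left hcv hn0
  have k1 : n ≤ n * √n := le_mul_of_one_le_right hn0 hsn1
  have k2 : n * (1 + (K : ℝ)) ^ 2 ≤ n * √n * (1 + K) ^ 2 :=
    mul_le_mul_of_nonneg_right k1 (by positivity)
  have k3 : (1 + (K : ℝ)) * n ≤ n * (1 + K) ^ 2 := by
    nlinarith [mul_nonneg hK hn0, mul_nonneg (mul_nonneg hK hK) hn0]
  have k4 : n ≤ n * (1 + (K : ℝ)) ^ 2 := le_mul_of_one_le_right hn0 hL1
  linarith

/-- Normal approximation for the quadratic form of a nearest-neighbour map under random labelling. -/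
theorem IsSwapInvariant.norm_charFun_nnForm_sub_le (hν : IsSwapInvariant ν)
    (hη : IsBoundedMap η K) (hn : 6 ≤ Fintype.card ι) {p c : ℝ} (hp0 : 0 < p) (hp1 : p < 1)
    (hc : 0 < c) (hcp : c ≤ p * (1 - p))
    (hm : ∀ᵐ l ∂ν, (labelCount l 0 : ℝ) / Fintype.card ι = p) {s : ℝ} (hs : 0 < s)
    (hs2 : s ^ 2 = (p * (1 - p)) ^ 2 *
      (Fintype.card ι + (Finset.univ.filter fun i => η (η i) = i).card)) {t : ℝ}
    (ht : |t| * (12 + 4 * K) ≤ c * √(Fintype.card ι)) :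
    ‖charFun (ν.map fun l => nnForm η (centredLabel l) / s) t - Complex.exp (-t ^ 2 / 2)‖ ≤
      |t| * ((2 * (12 + 4 * K) ^ 2 * t ^ 2 / c ^ 3 + 2 / c + 76 * (1 + K) ^ 2 * |t| / c ^ 2) /
        √(Fintype.card ι)) := by
  set n : ℝ := (Fintype.card ι : ℝ) with hndef
  have hn6 : (6 : ℝ) ≤ n := by rw [hndef]; exact_mod_cast hn
  set R : ℝ := ((Finset.univ.filter fun i => η (η i) = i).card : ℝ) with hR
  have hR0 : 0 ≤ R := by positivity
  have hRn : R ≤ n := by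
    rw [hR, hndef]
    exact_mod_cast Finset.card_le_univ _
  set v := p * (1 - p) with hv
  have hv0 : 0 < v := hc.trans_le hcp
  have hv1 : v ≤ 1 := by nlinarith
  have hsn : 0 < √n := Real.sqrt_pos.2 (by linarith)
  have hsqn : √n ^ 2 = n := Real.sq_sqrt (by linarith)
  -- The normalisation is of order `√n`, so one transposition changes `T / s` by `O(1 / √n)`.
  have hcs : c * √n ≤ s := by
    refine (sq_le_sq₀ (by positivity) hs.le).1 ?_
    rw [hs2, mul_pow, hsqn]
    have h1 : c ^ 2 ≤ v ^ 2 := pow_le_pow_left₀ hc.le hcp 2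
    have h2 : v ^ 2 * n ≤ v ^ 2 * (n + R) := mul_le_mul_of_nonneg_left (by linarith) (sq_nonneg _)
    nlinarith
  set T : (ι → Fin 2) → ℝ := fun l => nnForm η (centredLabel l) with hT
  set ψ : ℝ → ℂ := fun t => ∫ l, Complex.exp ((t / s * T l : ℝ) * Complex.I) ∂ν with hψ
  set ψ' : ℝ → ℂ := fun t => ∫ l, ((T l / s : ℝ) : ℂ) * Complex.I *
    Complex.exp ((t / s * T l : ℝ) * Complex.I) ∂ν with hψ'
  have hcf : charFun (ν.map fun l => T l / s) t = ψ t := by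
    rw [charFun_apply_real, integral_map (measurable_of_finite _).aemeasurable (by fun_prop)]
    refine integral_congr_ae (.of_forall fun l => ?_)
    simp only
    congr 2
    push_cast
    ring
  have hder : ∀ t, HasDerivAt ψ (ψ' t) t := by
    intro t
    simp only [hψ, hψ']
    simp_rw [integral_fintype (μ := ν) .of_finite]
    refine HasDerivAt.fun_sum fun l _ => HasDerivAt.fun_const_smul _ ?_
    have h1 : HasDerivAt (fun t : ℝ => t / s * T l) (T l / s) t :=
      (((hasDerivAt_id t).div_const s).mul_const (T l)).congr_deriv (by ring)
    exact ((h1.ofReal_comp.mul_const Complex.I).cexp).congr_deriv (by ring)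
  rw [hcf]
  refine norm_sub_gaussian_le_of_deriv hder (by simp [hψ]) fun t' ht' => ?_
  set τ := t' / s with hτ
  have hτs : |τ| = |t'| / s := by rw [hτ, abs_div, abs_of_pos hs]
  have hD : (0 : ℝ) < 12 + 4 * K := by positivity
  have hτD : |τ| * (12 + 4 * K) ≤ 1 := by
    rw [hτs, div_mul_eq_mul_div, div_le_one hs]
    exact ((mul_le_mul_of_nonneg_right ht' hD.le).trans ht).trans hcs
  set SS : (ι → Fin 2) → ℝ := fun l => ∑ i, ∑ k with k ≠ i, centredLabel l i * centredLabel l k *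
    (nnForm η (centredLabel l ∘ Equiv.swap (η i) k) - nnForm η (centredLabel l)) with hSS
  set A : ℂ := ∫ l, (T l : ℂ) * Complex.exp ((τ * T l : ℝ) * Complex.I) ∂ν with hA
  set B : ℂ := ∫ l, ((∑ i, centredLabel l i ^ 2 : ℝ) : ℂ) *
    Complex.exp ((τ * T l : ℝ) * Complex.I) ∂ν with hB
  set J : ℂ := ∫ l, ((τ * SS l : ℝ) : ℂ) * Complex.I *
    Complex.exp ((τ * T l : ℝ) * Complex.I) ∂ν with hJ
  have hexch : ‖((n : ℂ) - 1) * A + B - J‖ ≤ n ^ 2 * (|τ| * (12 + 4 * K)) ^ 2 := by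
    have := hν.norm_exchange_expansion_le hη hτD
    rw [hndef]
    push_cast
    exact this
  have hBle : ‖B‖ ≤ n := norm_integral_sum_sq_mul_exp_le hp0.le hp1.le hm _
  have hSSle := hν.integral_abs_swapEffect_sub_le hη hn hp0.le hp1.le hm hs2
  -- Here `ψ' = (I / s) A`. The exchange identity gives `(n - 1) A + B ≈ J`, and replacing the sum
  -- of effects by `(n - 1) s²` gives `I J ≈ -(n - 1) s t' ψ`. The term `B` is only of order `n`,
  -- against the normalisation `(n - 1) s`.
  have hkey : ((n - 1 : ℝ) : ℂ) * s * (ψ' t' + t' * ψ t') =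
      Complex.I * (((n : ℂ) - 1) * A + B - J) - Complex.I * B +
        (Complex.I * J + ((n - 1 : ℝ) : ℂ) * s * t' * ψ t') := by
    have h1 : ψ' t' = Complex.I / s * A := by
      simp only [hψ', hA]
      rw [← integral_const_mul]
      refine integral_congr_ae (.of_forall fun l => ?_)
      simp only [hτ]
      push_cast
      ring
    rw [h1]
    have hs' : (s : ℂ) ≠ 0 := by exact_mod_cast hs.ne'
    field_simp
    push_cast
    ring
  have hlast : ‖Complex.I * J + ((n - 1 : ℝ) : ℂ) * s * t' * ψ t'‖ ≤
      |τ| * (38 * (1 + K) ^ 2 * (n * √n)) := by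
    have e : Complex.I * J + ((n - 1 : ℝ) : ℂ) * s * t' * ψ t' =
        ∫ l, ((-τ * (SS l - (n - 1) * s ^ 2) : ℝ) : ℂ) *
          Complex.exp ((τ * T l : ℝ) * Complex.I) ∂ν := by
      simp only [hJ, hψ]
      rw [← integral_const_mul, ← integral_const_mul, ← integral_add .of_finite .of_finite]
      refine integral_congr_ae (.of_forall fun l => ?_)
      simp only
      have hts : t' = τ * s := by rw [hτ]; field_simp
      rw [← hτ]
      conv_lhs => rw [hts]
      push_cast
      linear_combination (-(τ : ℂ) * s ^ 2 * 0 + (τ : ℂ) * SS l *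
        Complex.exp (τ * T l * Complex.I)) * Complex.I_sq
    rw [e]
    refine (norm_integral_le_integral_norm _).trans ?_
    calc _ = ∫ l, |τ| * |SS l - (n - 1) * s ^ 2| ∂ν := by
          refine integral_congr_ae (.of_forall fun l => ?_)
          simp only
          rw [norm_mul, Complex.norm_exp_ofReal_mul_I, mul_one, Complex.norm_real,
            Real.norm_eq_abs, abs_mul, abs_neg]
      _ = |τ| * ∫ l, |SS l - (n - 1) * s ^ 2| ∂ν := integral_const_mul _ _
      _ ≤ _ := mul_le_mul_of_nonneg_left hSSle (abs_nonneg _)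
  have hn1 : 0 < n - 1 := by linarith
  have htot : (n - 1) * s * ‖ψ' t' + t' * ψ t'‖ ≤
      n ^ 2 * (|τ| * (12 + 4 * K)) ^ 2 + n + |τ| * (38 * (1 + K) ^ 2 * (n * √n)) := by
    have h1 : (n - 1) * s * ‖ψ' t' + t' * ψ t'‖ = ‖((n - 1 : ℝ) : ℂ) * s * (ψ' t' + t' * ψ t')‖ := by
      rw [norm_mul, norm_mul, Complex.norm_real, Complex.norm_real, Real.norm_eq_abs,
        Real.norm_eq_abs, abs_of_pos hn1, abs_of_pos hs]
    rw [h1, hkey]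
    refine (norm_add_le _ _).trans (add_le_add ((norm_sub_le _ _).trans (add_le_add ?_ ?_)) hlast)
    · rw [norm_mul, Complex.norm_I, one_mul]
      exact hexch
    · rw [norm_mul, Complex.norm_I, one_mul]
      exact hBle
  -- Passing from `n - 1` to `n / 2` doubles the constants, so 38 becomes 76.
  have hhalf : n * s / 2 * ‖ψ' t' + t' * ψ t'‖ ≤ (n - 1) * s * ‖ψ' t' + t' * ψ t'‖ := by
    refine mul_le_mul_of_nonneg_right ?_ (norm_nonneg _)
    nlinarith
  have hfin : ‖ψ' t' + t' * ψ t'‖ ≤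
      2 * n * (12 + 4 * K) ^ 2 * |t'| ^ 2 / s ^ 3 + 2 / s + 76 * (1 + K) ^ 2 * |t'| * √n / s ^ 2 := by
    have h1 := hhalf.trans htot
    rw [hτs] at h1
    have hns : 0 < n * s / 2 := by positivity
    rw [mul_comm, ← le_div_iff₀ hns] at h1
    refine h1.trans (le_of_eq ?_)
    have hn0 : n ≠ 0 := by linarith
    field_simp
    ring
  refine hfin.trans ?_
  have hcs0 : 0 < c * √n := by positivity
  have q1 : 2 * n * (12 + 4 * K) ^ 2 * |t'| ^ 2 / s ^ 3 ≤
      2 * n * (12 + 4 * K) ^ 2 * |t| ^ 2 / (c * √n) ^ 3 := by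
    have hn0 : 0 ≤ n := by linarith
    gcongr
  have q2 : 2 / s ≤ 2 / (c * √n) := by gcongr
  have q3 : 76 * (1 + K) ^ 2 * |t'| * √n / s ^ 2 ≤
      76 * (1 + K) ^ 2 * |t| * √n / (c * √n) ^ 2 := by gcongr
  refine (add_le_add (add_le_add q1 q2) q3).trans (le_of_eq ?_)
  rw [sq_abs]
  have e3 : n = √n ^ 2 := hsqn.symm
  generalize √n = r at *
  rw [e3]
  field_simp

end NNClt


/-! ### Random labelling -/

/-- The labels under random labelling. -/
noncomputable def randomLabels (m₁ m₂ : ℕ) : Measure (Fin (m₁ + m₂) → Fin 2) :=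
  uniformOn {l | (Finset.univ.filter fun k => l k = 0).card = m₁}

section RandomLabels
variable (m₁ m₂ : ℕ)

instance : IsProbabilityMeasure (randomLabels m₁ m₂) :=
  isProbabilityMeasure_uniformOn (Set.toFinite _)
    ⟨blockLabels m₁ m₂, labelCount_blockLabels_zero m₁ m₂⟩

lemma ae_randomLabels : ∀ᵐ l ∂(randomLabels m₁ m₂), labelCount l 0 = m₁ := by
  have h : randomLabels m₁ m₂ {l | labelCount l 0 = m₁} = 1 :=
    uniformOn_self (Set.toFinite _) ⟨blockLabels m₁ m₂, labelCount_blockLabels_zero m₁ m₂⟩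
  exact (prob_compl_eq_zero_iff (Set.toFinite _).measurableSet).2 h

lemma labelCount_comp_perm {ι : Type*} [Fintype ι] (l : ι → Fin 2) (σ : Equiv.Perm ι) (i : Fin 2) :
    labelCount (l ∘ σ) i = labelCount l i := by
  have h0 : ∀ l : ι → Fin 2, labelCount (l ∘ σ) 0 = labelCount l 0 := by
    intro l
    have : (labelCount (l ∘ σ) 0 : ℝ) = labelCount l 0 := by
      rw [labelCount_zero_cast, labelCount_zero_cast]
      exact Equiv.sum_comp σ fun i => classInd (l i)
    exact_mod_cast this
  have h1 := labelCount_add l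
  have h2 := labelCount_add (l ∘ σ)
  have h3 := h0 l
  fin_cases i
  · exact h3
  · show labelCount (l ∘ σ) 1 = labelCount l 1
    omega

/-- The mass of a labelling depends only on its number of class 1 labels, which a permutation
preserves. -/
lemma randomLabels_map_perm (σ : Equiv.Perm (Fin (m₁ + m₂))) :
    (randomLabels m₁ m₂).map (fun l => l ∘ σ) = randomLabels m₁ m₂ := by
  refine Measure.ext_of_singleton fun x => ?_
  rw [Measure.map_apply (measurable_of_finite _) (measurableSet_singleton x)]
  have hpre : (fun l : Fin (m₁ + m₂) → Fin 2 => l ∘ σ) ⁻¹' {x} = {x ∘ σ.symm} := by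
    ext l
    simp only [Set.mem_preimage, Set.mem_singleton_iff]
    constructor
    · rintro rfl
      ext k
      simp
    · rintro rfl
      ext k
      simp
  have hval : ∀ y : Fin (m₁ + m₂) → Fin 2, randomLabels m₁ m₂ {y} =
      (Measure.count {l : Fin (m₁ + m₂) → Fin 2 | labelCount l 0 = m₁})⁻¹ *
        (if labelCount y 0 = m₁ then 1 else 0) := by
    intro y
    have : randomLabels m₁ m₂ {y} =
        (Measure.count {l : Fin (m₁ + m₂) → Fin 2 | labelCount l 0 = m₁})⁻¹ *
          Measure.count ({l : Fin (m₁ + m₂) → Fin 2 | labelCount l 0 = m₁} ∩ {y}) :=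
      cond_apply (Set.toFinite _).measurableSet _ _
    rw [this]
    congr 1
    split_ifs with h
    · have h' : y ∈ {l : Fin (m₁ + m₂) → Fin 2 | labelCount l 0 = m₁} := h
      rw [Set.inter_eq_right.2 (Set.singleton_subset_iff.2 h'), Measure.count_singleton]
    · have h' : y ∉ {l : Fin (m₁ + m₂) → Fin 2 | labelCount l 0 = m₁} := h
      rw [Set.inter_singleton_eq_empty.2 h', measure_empty]
  rw [hpre, hval, hval, labelCount_comp_perm]

lemma isSwapInvariant_randomLabels : IsSwapInvariant (randomLabels m₁ m₂) :=
  fun j k => randomLabels_map_perm m₁ m₂ (Equiv.swap j k)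

end RandomLabels

lemma measureReal_abs_ge_le {Ω : Type*} [Finite Ω] [MeasurableSpace Ω] [DiscreteMeasurableSpace Ω]
    (P : Measure Ω) [IsProbabilityMeasure P] (F : Ω → ℝ) {r : ℝ} (hr : 0 < r) :
    P.real {ω | r ≤ |F ω|} ≤ (∫ ω, F ω ^ 2 ∂P) / r ^ 2 := by
  rw [le_div_iff₀ (by positivity), mul_comm]
  have h := mul_meas_ge_le_integral_of_nonneg (μ := P) (f := fun ω => F ω ^ 2)
    (.of_forall fun ω => sq_nonneg _) .of_finite (r ^ 2)
  have e : {ω | r ≤ |F ω|} = {ω | r ^ 2 ≤ F ω ^ 2} := by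
    ext ω
    show r ≤ |F ω| ↔ r ^ 2 ≤ F ω ^ 2
    rw [← sq_abs (F ω), sq_le_sq₀ hr.le (abs_nonneg _)]
  rw [e]
  exact h

/-- The number of points with a NN of class 1 is concentrated around its mean. -/
lemma IsSwapInvariant.measureReal_colSum_ge_le {ι : Type*} [Fintype ι] [DecidableEq ι]
    {ν : Measure (ι → Fin 2)} [IsProbabilityMeasure ν] (hν : IsSwapInvariant ν) {η : ι → ι} {K : ℕ}
    (hη : IsBoundedMap η K) (hn : 2 ≤ Fintype.card ι) {r : ℝ} (hr : 0 < r) :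
    ν.real {l | r ≤ |(colSum l (l ∘ η) 0 : ℝ) - labelCount l 0|} ≤
      3 * Fintype.card ι * K ^ 2 / r ^ 2 := by
  -- Each label is counted as often as its point is a nearest neighbour, so the weights are the
  -- in-degrees.
  have hlin : ∀ l : ι → Fin 2, (colSum l (l ∘ η) 0 : ℝ) - labelCount l 0 =
      ∑ j, ((Finset.univ.filter fun i => η i = j).card : ℝ) * centredLabel l j := by
    intro l
    have hn0 : (Fintype.card ι : ℝ) ≠ 0 := by
      have : 0 < Fintype.card ι := by omega
      exact_mod_cast this.ne'
    have h1 : ∑ i, centredLabel l (η i) = (colSum l (l ∘ η) 0 : ℝ) - labelCount l 0 := by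
      rw [colSum_zero_cast]
      simp only [centredLabel, Function.comp, Finset.sum_sub_distrib]
      simp
      field_simp
    rw [← h1, ← Finset.sum_fiberwise Finset.univ η]
    refine Finset.sum_congr rfl fun j _ => ?_
    rw [Finset.sum_congr rfl fun i hi => by rw [(Finset.mem_filter.1 hi).2], Finset.sum_const,
      nsmul_eq_mul]
  simp_rw [hlin]
  refine (measureReal_abs_ge_le ν _ hr).trans (div_le_div_of_nonneg_right ?_ (sq_nonneg _))
  refine hν.integral_linear_sq_le hn _ fun j => ?_
  rw [abs_of_nonneg (by positivity)]
  exact_mod_cast hη.indegree_le j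

/-- The free constant in the linear form is taken to be the class proportion, which centres the NN
labels as well. -/
lemma cellCount_comp_sub_expected {ι : Type*} [Fintype ι] (η : ι → ι) (l : ι → Fin 2) :
    (cellCount l (l ∘ η) 0 0 : ℝ) - labelCount l 0 * colSum l (l ∘ η) 0 / Fintype.card ι =
      nnForm η (centredLabel l) :=
  cellCount_sub_expected_eq_sum l (l ∘ η) _

/-- Asymptotic lower bound for the level of Pielou's test under random labelling, uniformly over
NN maps with bounded in-degrees and a given proportion of reflexive pairs. -/
theorem exists_forall_chiTail_le_rlLevel {α : ℝ} (hα : 0 < α) (hα' : α < 1) {c ρ y ε : ℝ}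
    (hc : 0 < c) (hρ : 0 ≤ ρ) (hy : chiSqOneQuantile (1 - α) < y * (1 + ρ)) (hε : 0 < ε) (K : ℕ) :
    ∃ N : ℕ, ∀ (m₁ m₂ : ℕ) (η : Fin (m₁ + m₂) → Fin (m₁ + m₂)), N ≤ m₁ + m₂ →
      c * ((m₁ : ℝ) + m₂) ≤ m₁ → c * ((m₁ : ℝ) + m₂) ≤ m₂ → IsBoundedMap η K →
      ρ * ((m₁ : ℝ) + m₂) ≤ reflexiveCount η → chiTail y - ε ≤ rlLevel α m₁ m₂ η := by
  -- Uniformity comes from compactness by contradiction: a counterexample for every `N` gives a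
  -- sequence of NN maps to which the limit theorem applies.
  by_contra hcon
  push Not at hcon
  choose m₁ m₂ η hN hm1 hm2 hη hR hlt using hcon
  obtain ⟨-, hx0⟩ := chiTail_quantile hα hα'
  set x := chiSqOneQuantile (1 - α) with hx
  set n : ℕ → ℝ := fun k => (m₁ k : ℝ) + m₂ k with hn
  have hcard : ∀ k, (Fintype.card (Fin (m₁ k + m₂ k)) : ℝ) = n k := by
    intro k
    rw [Fintype.card_fin]
    push_cast
    rfl
  have hnk : ∀ k : ℕ, (k : ℝ) ≤ n k := by
    intro k
    have := hN k
    simp only [hn]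
    exact_mod_cast this
  have hnlim : Tendsto n atTop atTop := tendsto_atTop_mono hnk tendsto_natCast_atTop_atTop
  have hsqrt : Tendsto (fun k => √(n k)) atTop atTop := Real.tendsto_sqrt_atTop.comp hnlim
  set p : ℕ → ℝ := fun k => m₁ k / n k with hp
  set v : ℕ → ℝ := fun k => p k * (1 - p k) with hv
  set s : ℕ → ℝ := fun k => v k * √(n k + reflexiveCount (η k)) with hs
  set ν : ∀ k, Measure (Fin (m₁ k + m₂ k) → Fin 2) := fun k => randomLabels (m₁ k) (m₂ k) with hν
  have hν' : ∀ k, IsProbabilityMeasure (ν k) := fun k => by simp only [hν]; infer_instance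
  have hpc : ∀ k, 0 < n k → c ≤ p k ∧ c ≤ 1 - p k := by
    intro k hk
    have h1 : 1 - p k = m₂ k / n k := by
      simp only [hp, hn] at hk ⊢
      field_simp
      ring
    rw [h1]
    exact ⟨(le_div_iff₀ hk).2 (hm1 k), (le_div_iff₀ hk).2 (hm2 k)⟩
  have hcv : ∀ k, 0 < n k → c ^ 2 ≤ v k := by
    intro k hk
    obtain ⟨h1, h2⟩ := hpc k hk
    rw [sq]
    exact mul_le_mul h1 h2 hc.le (hc.le.trans h1)
  set W : ∀ k, (Fin (m₁ k + m₂ k) → Fin 2) → ℝ :=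
    fun k l => nnForm (η k) (centredLabel l) / s k with hW
  have hcf : ∀ t : ℝ, Tendsto (fun k => charFun ((ν k).map (W k)) t) atTop
      (𝓝 (Complex.exp (-t ^ 2 / 2))) := by
    intro t
    rw [tendsto_iff_norm_sub_tendsto_zero]
    set D : ℝ := 2 * (12 + 4 * K) ^ 2 * t ^ 2 / (c ^ 2) ^ 3 + 2 / c ^ 2 +
      76 * (1 + K) ^ 2 * |t| / (c ^ 2) ^ 2 with hD
    have hlim : Tendsto (fun k => |t| * (D / √(n k))) atTop (𝓝 0) := by
      simpa using (hsqrt.const_div_atTop D).const_mul |t|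
    refine squeeze_zero' (Eventually.of_forall fun _ => norm_nonneg _) ?_ hlim
    filter_upwards [eventually_ge_atTop 6, hsqrt.eventually_ge_atTop (|t| * (12 + 4 * K) / c ^ 2)]
      with k hk6 hkt
    have hnk0 : 0 < n k := lt_of_lt_of_le (by positivity) ((Nat.cast_le.2 hk6).trans (hnk k))
    obtain ⟨hp0, hp1⟩ := hpc k hnk0
    have hvk : 0 < v k := (pow_pos hc 2).trans_le (hcv k hnk0)
    have hae : ∀ᵐ l ∂(ν k), (labelCount l 0 : ℝ) / Fintype.card (Fin (m₁ k + m₂ k)) = p k := by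
      filter_upwards [ae_randomLabels (m₁ k) (m₂ k)] with l hl
      rw [hl, hcard]
    have := (isSwapInvariant_randomLabels (m₁ k) (m₂ k)).norm_charFun_nnForm_sub_le (hη k)
      (by rw [Fintype.card_fin]; exact hk6.trans (hN k)) (hc.trans_le hp0) (by linarith)
      (pow_pos hc 2) (hcv k hnk0) hae (s := s k) (by positivity) (by
        rw [hcard, hs, mul_pow, Real.sq_sqrt (by positivity)]
        rfl) (t := t) (by rwa [hcard, mul_comm (c ^ 2), ← div_le_iff₀ (by positivity)])
    rw [hcard] at this
    exact this
  have hmap : ∀ k, IsProbabilityMeasure ((ν k).map (W k)) :=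
    fun k => Measure.isProbabilityMeasure_map (measurable_of_finite _).aemeasurable
  have htail := tendsto_sq_tail_of_charFun (fun k => (ν k).map (W k)) hcf y
  have htail' : Tendsto (fun k => (ν k).real {l | y < W k l ^ 2}) atTop (𝓝 (chiTail y)) := by
    refine htail.congr fun k => ?_
    rw [map_measureReal_apply (measurable_of_finite _)
      (measurableSet_lt (by fun_prop) (by fun_prop))]
    rfl
  -- The gap between `x` and `y (1 + ρ)` pays for the relative error of the estimated variance.
  set κ := min (1 / 2) ((y * (1 + ρ) - x) / x) with hκ
  have hκ0 : 0 < κ := lt_min (by norm_num) (div_pos (by linarith) hx0)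
  have hκ1 : κ ≤ 1 / 2 := min_le_left _ _
  have hκx : (1 + κ) * x ≤ y * (1 + ρ) := by
    have : κ * x ≤ y * (1 + ρ) - x := (le_div_iff₀ hx0).1 (min_le_right _ _)
    linarith
  have hy0 : 0 < y := by
    by_contra h
    have : y * (1 + ρ) ≤ 0 := mul_nonpos_of_nonpos_of_nonneg (not_lt.1 h) (by linarith)
    linarith
  have hbadlim : Tendsto (fun k => 3 * K ^ 2 / (κ * c ^ 2) ^ 2 / n k) atTop (𝓝 0) :=
    hnlim.const_div_atTop _
  have hev : ∀ᶠ k in atTop, chiTail y - ε ≤ (ν k).real {l | PielouRejects α l (l ∘ η k)} := by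
    filter_upwards [eventually_ge_atTop 6, htail'.eventually (lt_mem_nhds
      (show chiTail y - ε / 2 < chiTail y by linarith)),
      hbadlim.eventually (gt_mem_nhds (show (0 : ℝ) < ε / 2 by linarith))] with k hk6 ht hb
    have hnk0 : 0 < n k := lt_of_lt_of_le (by positivity) ((Nat.cast_le.2 hk6).trans (hnk k))
    obtain ⟨hp0, hp1⟩ := hpc k hnk0
    have hvk : 0 < v k := (pow_pos hc 2).trans_le (hcv k hnk0)
    set B : Set (Fin (m₁ k + m₂ k) → Fin 2) :=
      {l | κ * (n k * c ^ 2) ≤ |(colSum l (l ∘ η k) 0 : ℝ) - labelCount l 0|} with hB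
    have hBle : (ν k).real B ≤ 3 * K ^ 2 / (κ * c ^ 2) ^ 2 / n k := by
      refine ((isSwapInvariant_randomLabels (m₁ k) (m₂ k)).measureReal_colSum_ge_le (hη k)
        (by rw [Fintype.card_fin]; exact le_trans (by omega) (hN k)) (by positivity)).trans
        (le_of_eq ?_)
      rw [hcard]
      field_simp
    have hsub : (ν k).real {l | y < W k l ^ 2} ≤
        (ν k).real ({l | PielouRejects α l (l ∘ η k)} ∪ B) := by
      refine ENNReal.toReal_mono (measure_ne_top _ _) (measure_mono_ae ?_)
      filter_upwards [ae_randomLabels (m₁ k) (m₂ k)] with l hl hyl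
      by_cases hlB : l ∈ B
      · exact Or.inr hlB
      left
      have hyl' : y < W k l ^ 2 := hyl
      have hlB' : |(colSum l (l ∘ η k) 0 : ℝ) - labelCount l 0| < κ * (n k * c ^ 2) := not_le.1 hlB
      have hN0 : (labelCount l 0 : ℝ) = n k * p k := by
        rw [hl]
        simp only [hp]
        field_simp
      have hN1 : (labelCount l 1 : ℝ) = n k * (1 - p k) := by
        have := labelCount_add l
        have h2 : (labelCount l 0 : ℝ) + labelCount l 1 = n k := by
          rw [← hcard, ← this]; push_cast; ring
        linarith
      have hN0' : 0 < labelCount l 0 := by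
        have : (0 : ℝ) < labelCount l 0 := by rw [hN0]; exact mul_pos hnk0 (by linarith)
        exact_mod_cast this
      have hN1' : 0 < labelCount l 1 := by
        have : (0 : ℝ) < labelCount l 1 := by rw [hN1]; exact mul_pos hnk0 (by linarith)
        exact_mod_cast this
      have hsand := (pielouStat_sandwich l (l ∘ η k) (q := p k) (κ := κ) (by linarith) (by linarith)
        hκ1 (by rwa [rowSum_eq_labelCount]) (by rwa [rowSum_eq_labelCount]) (by
          rw [hcard, ← hN0]
          refine hlB'.le.trans (mul_le_mul_of_nonneg_left ?_ hκ0.le)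
          exact mul_le_mul_of_nonneg_left (hcv k hnk0) hnk0.le)).1
      rw [rowSum_eq_labelCount, rowSum_eq_labelCount, cellCount_comp_sub_expected, hcard, hN0,
        hN1] at hsand
      -- The source of liberality: Pielou's normalisation omits the reflexive pairs, so the
      -- statistic is asymptotically the square of a standard normal variable inflated by `1 + R /
      -- n`.
      have hWs : nnForm (η k) (centredLabel l) ^ 2 * n k /
          (n k * p k * (n k * (1 - p k)) * (p k * (1 - p k))) =
          W k l ^ 2 * (1 + reflexiveCount (η k) / n k) := by
        have hv2 : v k = p k * (1 - p k) := rfl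
        have hp0' : p k ≠ 0 := by linarith
        have hp1' : 1 - p k ≠ 0 := by linarith
        have hnR : n k + reflexiveCount (η k) ≠ 0 := by positivity
        simp only [hW, hs]
        rw [div_pow, mul_pow, Real.sq_sqrt (by positivity), hv2]
        field_simp
      rw [hWs] at hsand
      have h1 : 1 + ρ ≤ 1 + reflexiveCount (η k) / n k := by
        have := (le_div_iff₀ hnk0).2 (hR k)
        linarith
      have h2 : y * (1 + ρ) < W k l ^ 2 * (1 + reflexiveCount (η k) / n k) :=
        mul_lt_mul hyl' h1 (by linarith) (sq_nonneg _)
      have h3 : (1 + κ) * x < (1 + κ) * pielouStat l (l ∘ η k) := by linarith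
      exact lt_of_mul_lt_mul_left h3 (by linarith)
    have hun := measureReal_union_le (μ := ν k) {l | PielouRejects α l (l ∘ η k)} B
    linarith
  obtain ⟨k, hk⟩ := hev.exists
  exact absurd (hlt k) (not_lt.2 hk)


/-! ### Nearest neighbours in the plane -/

/-- The side opposite the origin is the longest of the triangle, so the angle at the origin is at
least 60 degrees and the chord of the unit vectors is at least 1. -/
lemma one_le_dist_normalize {w z : Plane} (hw : w ≠ 0) (hz : z ≠ 0) (h1 : ‖w‖ ≤ ‖w - z‖)
    (h2 : ‖z‖ ≤ ‖w - z‖) : 1 ≤ ‖‖w‖⁻¹ • w - ‖z‖⁻¹ • z‖ := by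
  have hw0 : 0 < ‖w‖ := norm_pos_iff.2 hw
  have hz0 : 0 < ‖z‖ := norm_pos_iff.2 hz
  have hexp := norm_sub_sq_real w z
  have h1' : ‖w‖ ^ 2 ≤ ‖w - z‖ ^ 2 := pow_le_pow_left₀ hw0.le h1 2
  have h2' : ‖z‖ ^ 2 ≤ ‖w - z‖ ^ 2 := pow_le_pow_left₀ hz0.le h2 2
  have hin : 2 * inner ℝ w z ≤ ‖w‖ * ‖z‖ := by
    rcases le_total ‖w‖ ‖z‖ with h | h <;> nlinarith
  have hexp2 := norm_sub_sq_real (‖w‖⁻¹ • w) (‖z‖⁻¹ • z)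
  have n1 : ‖‖w‖⁻¹ • w‖ = 1 := by rw [norm_smul, norm_inv, norm_norm, inv_mul_cancel₀ hw0.ne']
  have n2 : ‖‖z‖⁻¹ • z‖ = 1 := by rw [norm_smul, norm_inv, norm_norm, inv_mul_cancel₀ hz0.ne']
  rw [n1, n2, real_inner_smul_left, real_inner_smul_right] at hexp2
  have h3 : 2 * (‖w‖⁻¹ * (‖z‖⁻¹ * inner ℝ w z)) ≤ 1 := by
    have : 2 * (‖w‖⁻¹ * (‖z‖⁻¹ * inner ℝ w z)) = 2 * inner ℝ w z / (‖w‖ * ‖z‖) := by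
      field_simp
    rw [this, div_le_one (by positivity)]
    exact hin
  have h4 : 1 ≤ ‖‖w‖⁻¹ • w - ‖z‖⁻¹ • z‖ ^ 2 := by
    rw [hexp2]; linarith
  by_contra hcon
  have := pow_lt_one₀ (norm_nonneg _) (not_le.1 hcon) two_ne_zero
  linarith

/-- In the plane, a point is the nearest neighbour of at most 25 other points. -/
lemma card_isNN_le {n : ℕ} {x : Fin n → Plane} (hx : Function.Injective x) (j : Fin n)
    (s : Finset (Fin n)) (hs : ∀ i ∈ s, IsNN x i j) : s.card ≤ 25 := by
  classical
  set g : Fin n → Plane := fun i => ‖x i - x j‖⁻¹ • (x i - x j) with hg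
  have hne : ∀ i ∈ s, x i - x j ≠ 0 := fun i hi h => (hs i hi).1 (hx (sub_eq_zero.1 h)).symm
  have hsep : ∀ a ∈ s, ∀ b ∈ s, a ≠ b → 1 ≤ ‖g a - g b‖ := by
    intro a ha b hb hab
    refine one_le_dist_normalize (hne a ha) (hne b hb) ?_ ?_
    · rw [sub_sub_sub_cancel_right, ← dist_eq_norm, ← dist_eq_norm]
      exact (hs a ha).2 b hab.symm
    · rw [sub_sub_sub_cancel_right, ← dist_eq_norm, ← dist_eq_norm, dist_comm (x a)]
      exact (hs b hb).2 a hab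
  have hinj : Set.InjOn g s := by
    intro a ha b hb hab
    by_contra h
    have := hsep a ha b hb h
    rw [hab, sub_self, norm_zero] at this
    linarith
  -- The unit directions from `x j` are pairwise at distance at least 1, and the volume bound for
  -- such sets is `5 ^ 2` in the plane. Any finite bound would do.
  have h := Besicovitch.card_le_of_separated (s.image g) (by
    intro c hc
    obtain ⟨i, hi, rfl⟩ := Finset.mem_image.1 hc
    simp only [hg]
    rw [norm_smul, norm_inv, norm_norm, inv_mul_cancel₀ (norm_ne_zero_iff.2 (hne i hi))]
    norm_num) (by
    intro c hc d hd hcd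
    obtain ⟨a, ha, rfl⟩ := Finset.mem_image.1 hc
    obtain ⟨b, hb, rfl⟩ := Finset.mem_image.1 hd
    exact hsep a ha b hb fun h => hcd (by rw [h]))
  rw [Finset.card_image_of_injOn hinj, finrank_euclideanSpace_fin] at h
  exact h

lemma isBoundedMap_of_isNN {n : ℕ} {x : Fin n → Plane} (hx : Function.Injective x)
    {η : Fin n → Fin n} (hη : ∀ i, IsNN x i (η i)) : IsBoundedMap η 25 where
  ne i := (hη i).1
  indegree_le j := card_isNN_le hx j _ fun i hi => by
    rw [← (Finset.mem_filter.1 hi).2]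
    exact hη i

/-- A point strictly between `x / (1 + ρ)` and the quantile `x` serves, as the tail is strictly
decreasing; this gap is the origin of `δ`. -/
lemma exists_lt_chiTail_gt {α : ℝ} (hα : 0 < α) (hα' : α < 1) {ρ : ℝ} (hρ : 0 < ρ) :
    ∃ y, chiSqOneQuantile (1 - α) < y * (1 + ρ) ∧ α < chiTail y := by
  obtain ⟨hx, hx0⟩ := chiTail_quantile hα hα'
  set x := chiSqOneQuantile (1 - α)
  refine ⟨x / (1 + ρ / 2), ?_, ?_⟩
  · rw [div_mul_eq_mul_div, lt_div_iff₀ (by linarith)]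
    exact mul_lt_mul_of_pos_left (by linarith) hx0
  · nth_rewrite 1 [← hx]
    refine chiTail_lt (by positivity) ?_
    rw [div_lt_iff₀ (by linarith)]
    nlinarith

/-- Under random labelling, Pielou's test is liberal. -/
theorem rlLevel_liberal {α : ℝ} (hα : 0 < α) (hα' : α < 1) {m₁ m₂ : ℕ → ℕ}
    (hm : Tendsto (fun k => m₁ k + m₂ k) atTop atTop) {c : ℝ} (hc : 0 < c)
    (hmc : ∀ᶠ k in atTop, c * ((m₁ k : ℝ) + m₂ k) ≤ m₁ k ∧ c * ((m₁ k : ℝ) + m₂ k) ≤ m₂ k)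
    (x : ∀ k, Fin (m₁ k + m₂ k) → Plane) (nn : ∀ k, Fin (m₁ k + m₂ k) → Fin (m₁ k + m₂ k))
    (hnn : ∀ᶠ k in atTop, Function.Injective (x k) ∧ ∀ i, IsNN (x k) i (nn k i))
    (hR : ∀ᶠ k in atTop, c * ((m₁ k : ℝ) + m₂ k) ≤ reflexiveCount (nn k)) :
    ∃ δ : ℝ, 0 < δ ∧ ∀ᶠ k in atTop, α + δ ≤ rlLevel α (m₁ k) (m₂ k) (nn k) := by
  obtain ⟨y, hy, hyα⟩ := exists_lt_chiTail_gt hα hα' hc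
  obtain ⟨N, hN⟩ := exists_forall_chiTail_le_rlLevel hα hα' hc hc.le hy
    (show 0 < (chiTail y - α) / 2 by linarith) 25
  refine ⟨(chiTail y - α) / 2, by linarith, ?_⟩
  filter_upwards [hm.eventually_ge_atTop N, hmc, hnn, hR] with k h1 h2 h3 h4
  have := hN (m₁ k) (m₂ k) (nn k) h1 h2.1 h2.2 (isBoundedMap_of_isNN h3.1 h3.2) h4
  linarith

/-! ### The nearest-neighbour map with ties broken by index -/

section Nearest
variable {n : ℕ} {x : Fin n → Plane}

lemma exists_isNN (hn : 2 ≤ n) (x : Fin n → Plane) (i : Fin n) : ∃ j, IsNN x i j := by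
  classical
  have hne : (Finset.univ.erase i).Nonempty := by
    rw [← Finset.card_pos, Finset.card_erase_of_mem (Finset.mem_univ i), Finset.card_univ,
      Fintype.card_fin]
    omega
  obtain ⟨j, hj, hmin⟩ := Finset.exists_min_image _ (fun j => dist (x i) (x j)) hne
  exact ⟨j, (Finset.mem_erase.1 hj).1, fun k hk =>
    hmin k (Finset.mem_erase.2 ⟨hk, Finset.mem_univ k⟩)⟩

lemma isNN_nearest_of_exists {i : Fin n} (h : ∃ j, IsNN x i j) : IsNN x i (nearest x i) := by
  classical
  have hne : (Finset.univ.filter fun j => IsNN x i j).Nonempty := by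
    obtain ⟨j, hj⟩ := h
    exact ⟨j, Finset.mem_filter.2 ⟨Finset.mem_univ j, hj⟩⟩
  have hmem := Finset.min'_mem _ hne
  have : nearest x i = (Finset.univ.filter fun j => IsNN x i j).min' hne := by
    unfold nearest
    rw [dif_pos hne]
  rw [this]
  exact (Finset.mem_filter.1 hmem).2

lemma isNN_nearest (hn : 2 ≤ n) (x : Fin n → Plane) (i : Fin n) : IsNN x i (nearest x i) :=
  isNN_nearest_of_exists (exists_isNN hn x i)

lemma nearest_eq_of_unique {i j : Fin n} (hj : IsNN x i j) (hu : ∀ k, IsNN x i k → k = j) :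
    nearest x i = j :=
  hu _ (isNN_nearest_of_exists ⟨j, hj⟩)

/-- No point is equidistant from two others. -/
def NoTies (x : Fin n → Plane) : Prop :=
  ∀ i j k, i ≠ j → i ≠ k → j ≠ k → dist (x i) (x j) ≠ dist (x i) (x k)

lemma NoTies.nearest_eq (hx : NoTies x) {i j : Fin n} (hj : IsNN x i j) : nearest x i = j := by
  refine nearest_eq_of_unique hj fun k hk => ?_
  by_contra hne
  exact hx i k j hk.1.symm hj.1.symm hne (le_antisymm (hk.2 j hj.1) (hj.2 k hk.1))

/-- Breaking ties by the least index is not equivariant under permutations; without ties the nearest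
neighbour is determined by the distances alone. -/
lemma NoTies.nearest_comp_perm (hx : NoTies x) (hn : 2 ≤ n) (σ : Equiv.Perm (Fin n)) (i : Fin n) :
    σ (nearest (x ∘ σ) i) = nearest x (σ i) := by
  have h := isNN_nearest hn (x ∘ σ) i
  refine (hx.nearest_eq ⟨fun h' => h.1 (σ.injective h'), fun k hk => ?_⟩).symm
  have := h.2 (σ.symm k) (fun h' => hk (by rw [← h', Equiv.apply_symm_apply]))
  simpa using this

/-- Nearest neighbours depend measurably on the locations. -/
lemma measurable_nearest : Measurable (nearest : (Fin n → Plane) → Fin n → Fin n) := by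
  classical
  -- The map factors through the relation `IsNN`, which takes values in a finite type, so only the
  -- measurability of that relation needs proof.
  set g : (Fin n → Fin n → Prop) → Fin n → Fin n := fun r i =>
    if h : (Finset.univ.filter fun j => r i j).Nonempty
    then (Finset.univ.filter fun j => r i j).min' h else i with hg
  have h1 : Measurable fun x : Fin n → Plane => fun i j => IsNN x i j := by
    refine measurable_pi_iff.2 fun i => measurable_pi_iff.2 fun j => measurableSet_setOfPred.1 ?_
    have : {x : Fin n → Plane | IsNN x i j} =
        {x | j ≠ i} ∩ ⋂ k, {x | k ≠ i → dist (x i) (x j) ≤ dist (x i) (x k)} := by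
      ext x
      simp [IsNN]
    rw [this]
    refine (MeasurableSet.const _).inter (MeasurableSet.iInter fun k => ?_)
    by_cases hk : k = i
    · simp [hk]
    · simp only [ne_eq, hk, not_false_eq_true, forall_const]
      exact measurableSet_le (by fun_prop) (by fun_prop)
  have h2 : Measurable g := measurable_of_finite g
  have h3 : (nearest : (Fin n → Plane) → Fin n → Fin n) = g ∘ fun x i j => IsNN x i j := by
    funext x i
    simp only [nearest, hg, Function.comp]
  rw [h3]
  exact h2.comp h1

end Nearest


/-! ### Exchangeability of independent points -/

lemma cellCount_comp_perm {ι : Type*} [Fintype ι] (u v : ι → Fin 2) (σ : Equiv.Perm ι)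
    (i j : Fin 2) : cellCount (u ∘ σ) (v ∘ σ) i j = cellCount u v i j := by
  unfold cellCount
  exact Finset.card_equiv σ fun k => by simp

lemma pielouStat_comp_perm {ι : Type*} [Fintype ι] (u v : ι → Fin 2) (σ : Equiv.Perm ι) :
    pielouStat (u ∘ σ) (v ∘ σ) = pielouStat u v := by
  simp only [pielouStat, expectedCount, rowSum, colSum, cellCount_comp_perm]

lemma exists_perm_comp_eq {ι : Type*} [Fintype ι] {l l' : ι → Fin 2}
    (h : labelCount l 0 = labelCount l' 0) : ∃ σ : Equiv.Perm ι, l' ∘ σ = l := by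
  classical
  have hc : ∀ c, Fintype.card {a // l a = c} = Fintype.card {b // l' b = c} := by
    intro c
    rw [Fintype.card_subtype, Fintype.card_subtype]
    change labelCount l c = labelCount l' c
    have h1 := labelCount_add l
    have h2 := labelCount_add l'
    fin_cases c
    · exact h
    · show labelCount l 1 = labelCount l' 1
      omega
  refine ⟨Equiv.ofFiberEquiv fun c => Fintype.equivOfCardEq (hc c), funext fun a => ?_⟩
  exact Equiv.ofFiberEquiv_map _ a

section Product
variable {ι : Type*} [Fintype ι]

lemma map_comp_perm_pi {E : Type*} [MeasurableSpace E] (U : Measure E) [SigmaFinite U]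
    (σ : Equiv.Perm ι) :
    MeasurePreserving (fun x : ι → E => x ∘ σ) (Measure.pi fun _ => U) (Measure.pi fun _ => U) := by
  have h := measurePreserving_piCongrLeft (α := fun _ : ι => E) (fun _ => U) σ.symm
  convert h using 1
  funext x i
  simp [MeasurableEquiv.piCongrLeft, Equiv.piCongrLeft, Equiv.piCongrLeft']

variable {E : ι → Type*} [∀ i, MeasurableSpace (E i)] (μ : ∀ i, Measure (E i))
  [∀ i, IsProbabilityMeasure (μ i)]

lemma pi_map_pair {i j : ι} (hij : i ≠ j) :
    (Measure.pi μ).map (fun x => (x i, x j)) = (μ i).prod (μ j) := by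
  have hI : iIndepFun (fun i (x : ∀ i, E i) => x i) (Measure.pi μ) :=
    iIndepFun_pi (X := fun i (x : E i) => x) fun i => aemeasurable_id
  rw [(indepFun_iff_map_prod_eq_prod_map_map (measurable_pi_apply i).aemeasurable
    (measurable_pi_apply j).aemeasurable).1 (hI.indepFun hij)]
  congr
  · exact (measurePreserving_eval μ i).map_eq
  · exact (measurePreserving_eval μ j).map_eq

lemma pi_map_triple {i j k : ι} (hij : i ≠ j) (hik : i ≠ k) (hjk : j ≠ k) :
    (Measure.pi μ).map (fun x => ((x i, x j), x k)) = ((μ i).prod (μ j)).prod (μ k) := by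
  have hI : iIndepFun (fun i (x : ∀ i, E i) => x i) (Measure.pi μ) :=
    iIndepFun_pi (X := fun i (x : E i) => x) fun i => aemeasurable_id
  rw [(indepFun_iff_map_prod_eq_prod_map_map (by fun_prop)
    (measurable_pi_apply k).aemeasurable).1
    (hI.indepFun_prodMk (fun i => measurable_pi_apply i) i j k hik hjk)]
  congr
  · exact pi_map_pair μ hij
  · exact (measurePreserving_eval μ k).map_eq

end Product

section Uniform
variable {n : ℕ} {U : Measure Plane} [IsProbabilityMeasure U]

lemma ae_injective_pi (hU : U ≪ volume) :
    ∀ᵐ x ∂(Measure.pi fun _ : Fin n => U), Function.Injective x := by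
  have h : ∀ i j : Fin n, i ≠ j → ∀ᵐ x ∂(Measure.pi fun _ : Fin n => U), x i ≠ x j := by
    intro i j hij
    have hm : MeasurableSet {p : Plane × Plane | p.1 = p.2} :=
      measurableSet_eq_fun measurable_fst measurable_snd
    have h0 : (U.prod U) {p : Plane × Plane | p.1 = p.2} = 0 := by
      refine (Measure.measure_prod_null hm).2 (ae_of_all _ fun a => hU ?_)
      have : Prod.mk a ⁻¹' {p : Plane × Plane | p.1 = p.2} = {a} := by
        ext b
        exact eq_comm
      rw [this]
      exact measure_singleton a
    rw [← pi_map_pair (fun _ : Fin n => U) hij, Measure.map_apply (by fun_prop) hm] at h0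
    exact measure_eq_zero_iff_ae_notMem.1 h0
  have h' := ae_all_iff.2 fun i => ae_all_iff.2 fun j => ae_all_iff.2 (h i j)
  filter_upwards [h'] with x hx i j hij
  by_contra hne
  exact hx i j hne hij

/-- Given two of the points, a tie forces the third onto a circle, which has area zero. -/
lemma ae_noTies_pi (hU : U ≪ volume) :
    ∀ᵐ x ∂(Measure.pi fun _ : Fin n => U), NoTies x := by
  have h : ∀ i j k : Fin n, i ≠ j → i ≠ k → j ≠ k →
      ∀ᵐ x ∂(Measure.pi fun _ : Fin n => U), dist (x i) (x j) ≠ dist (x i) (x k) := by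
    intro i j k hij hik hjk
    have hm : MeasurableSet {p : (Plane × Plane) × Plane | dist p.1.1 p.1.2 = dist p.1.1 p.2} :=
      measurableSet_eq_fun (by fun_prop) (by fun_prop)
    have h0 : ((U.prod U).prod U)
        {p : (Plane × Plane) × Plane | dist p.1.1 p.1.2 = dist p.1.1 p.2} = 0 := by
      refine (Measure.measure_prod_null hm).2 (ae_of_all _ fun a => hU ?_)
      have : Prod.mk a ⁻¹' {p : (Plane × Plane) × Plane | dist p.1.1 p.1.2 = dist p.1.1 p.2} =
          Metric.sphere a.1 (dist a.1 a.2) := by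
        ext b
        simp only [Set.mem_preimage, Metric.mem_sphere]
        rw [dist_comm b]
        exact eq_comm
      rw [this]
      exact Measure.addHaar_sphere _ _ _
    rw [← pi_map_triple (fun _ : Fin n => U) hij hik hjk, Measure.map_apply (by fun_prop) hm] at h0
    exact measure_eq_zero_iff_ae_notMem.1 h0
  simp only [NoTies, ae_all_iff]
  exact h

lemma measurable_comp_nearest (l : Fin n → Fin 2) :
    Measurable fun x : Fin n → Plane => l ∘ nearest x :=
  (measurable_of_finite fun η : Fin n → Fin n => l ∘ η).comp measurable_nearest

variable {m₁ m₂ : ℕ}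

/-- The two labellings differ by a permutation of the indices, under which both the law of the
i.i.d. points and the statistic are invariant. Equivariance of `nearest` holds off the null set of
ties. -/
lemma pi_rejects_eq_of_labelCount (hU : U ≪ volume) (hn : 2 ≤ n) (α : ℝ) {l l' : Fin n → Fin 2}
    (h : labelCount l 0 = labelCount l' 0) :
    (Measure.pi fun _ : Fin n => U) {x | PielouRejects α l (l ∘ nearest x)} =
      (Measure.pi fun _ : Fin n => U) {x | PielouRejects α l' (l' ∘ nearest x)} := by
  obtain ⟨σ, rfl⟩ := exists_perm_comp_eq h
  have hm : MeasurableSet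
      {x : Fin n → Plane | PielouRejects α (l' ∘ σ) ((l' ∘ σ) ∘ nearest x)} :=
    measurable_comp_nearest (l' ∘ σ) (Set.toFinite
      {v : Fin n → Fin 2 | PielouRejects α (l' ∘ σ) v}).measurableSet
  rw [← (map_comp_perm_pi U σ).measure_preimage hm.nullMeasurableSet]
  refine measure_congr ?_
  filter_upwards [ae_noTies_pi (n := n) hU] with x hx
  have : (l' ∘ σ) ∘ nearest (x ∘ σ) = (l' ∘ nearest x) ∘ σ := by
    funext i
    simp only [Function.comp_apply]
    rw [hx.nearest_comp_perm hn]
  refine propext ?_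
  change PielouRejects α (l' ∘ σ) ((l' ∘ σ) ∘ nearest (x ∘ σ)) ↔ _
  rw [this]
  unfold PielouRejects
  rw [pielouStat_comp_perm]
  rfl

/-- Under CSR independence the level is the mean of the conditional levels given the locations. -/
lemma pi_rejects_eq_integral_rlLevel (hU : U ≪ volume) (hn : 2 ≤ m₁ + m₂) (α : ℝ) :
    (Measure.pi fun _ : Fin (m₁ + m₂) => U).real
        {x | PielouRejects α (blockLabels m₁ m₂) (blockLabels m₁ m₂ ∘ nearest x)} =
      ∫ x, rlLevel α m₁ m₂ (nearest x) ∂(Measure.pi fun _ : Fin (m₁ + m₂) => U) := by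
  set μ := Measure.pi fun _ : Fin (m₁ + m₂) => U
  set ν := randomLabels m₁ m₂
  -- Locations and random labels are taken independent, and the rejection event is integrated in
  -- both orders. Given the locations this is the random labelling level; given the labels the
  -- probability is constant.
  set S : Set ((Fin (m₁ + m₂) → Plane) × (Fin (m₁ + m₂) → Fin 2)) :=
    {p | PielouRejects α p.2 (p.2 ∘ nearest p.1)} with hS
  have hSm : MeasurableSet S := by
    have : Measurable fun p : (Fin (m₁ + m₂) → Plane) × (Fin (m₁ + m₂) → Fin 2) =>
        (nearest p.1, p.2) := (measurable_nearest.comp measurable_fst).prodMk measurable_snd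
    exact this (Set.toFinite {q : (Fin (m₁ + m₂) → Fin (m₁ + m₂)) × (Fin (m₁ + m₂) → Fin 2) |
      PielouRejects α q.2 (q.2 ∘ q.1)}).measurableSet
  have h1 : ∫ x, rlLevel α m₁ m₂ (nearest x) ∂μ = (μ.prod ν).real S := by
    rw [Measure.real, Measure.prod_apply hSm]
    exact integral_toReal (measurable_measure_prodMk_left hSm).aemeasurable
      (ae_of_all _ fun x => measure_lt_top _ _)
  rw [h1, Measure.real, Measure.real, Measure.prod_apply_symm hSm]
  congr 1
  have h2 : ∀ᵐ l ∂ν, μ ((fun x => (x, l)) ⁻¹' S) =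
      μ {x | PielouRejects α (blockLabels m₁ m₂) (blockLabels m₁ m₂ ∘ nearest x)} := by
    filter_upwards [ae_randomLabels m₁ m₂] with l hl
    exact pi_rejects_eq_of_labelCount hU hn α (hl.trans (labelCount_blockLabels_zero m₁ m₂).symm)
  rw [lintegral_congr_ae h2, lintegral_const, measure_univ, mul_one]

end Uniform


/-! ### Reflexive pairs among independent points -/

section Reflexive
variable {n : ℕ}

/-- The points `x i` and `x j` are within distance `r`, and isolated from all other points. -/
def IsolatedPair (r : ℝ) (x : Fin n → Plane) (i j : Fin n) : Prop :=
  dist (x i) (x j) ≤ r ∧ ∀ k, k ≠ i → k ≠ j → r < dist (x i) (x k) ∧ r < dist (x j) (x k)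

lemma IsolatedPair.symm {r : ℝ} {x : Fin n → Plane} {i j : Fin n} (h : IsolatedPair r x i j) :
    IsolatedPair r x j i :=
  ⟨by rw [dist_comm]; exact h.1, fun k h1 h2 => (h.2 k h2 h1).symm⟩

lemma IsolatedPair.nearest_eq {r : ℝ} {x : Fin n → Plane} {i j : Fin n} (h : IsolatedPair r x i j)
    (hij : i ≠ j) : nearest x i = j := by
  refine nearest_eq_of_unique ⟨hij.symm, fun k hk => ?_⟩ fun k hk => ?_
  · by_cases hkj : k = j
    · rw [hkj]
    · exact h.1.trans (h.2 k hk hkj).1.le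
  · by_contra hkj
    have h1 := (h.2 k hk.1 hkj).1
    have h2 := hk.2 j hij.symm
    linarith [h.1]

open Classical in
-- The members of an isolated pair are each other's nearest neighbours. So for given `i` at most one
-- `j` contributes, and only if `i` is reflexive.
lemma sum_isolatedPair_le_reflexiveCount (r : ℝ) (x : Fin n → Plane) :
    ∑ i, ∑ j ∈ Finset.univ.erase i, (if IsolatedPair r x i j then (1 : ℝ) else 0) ≤
      reflexiveCount (nearest x) := by
  unfold reflexiveCount
  rw [Finset.card_filter]
  push_cast
  refine Finset.sum_le_sum fun i _ => ?_
  have hle : ∀ j ∈ Finset.univ.erase i, (if IsolatedPair r x i j then (1 : ℝ) else 0) ≤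
      if j = nearest x i then (if nearest x (nearest x i) = i then (1 : ℝ) else 0) else 0 := by
    intro j hj
    have hij : i ≠ j := (Finset.mem_erase.1 hj).1.symm
    by_cases h : IsolatedPair r x i j
    · have h1 := h.nearest_eq hij
      rw [if_pos h, if_pos h1.symm, h1, if_pos (h.symm.nearest_eq hij.symm)]
    · rw [if_neg h]
      split_ifs <;> norm_num
  refine (Finset.sum_le_sum hle).trans ?_
  rw [Finset.sum_ite_eq']
  split_ifs <;> norm_num

variable {U : Measure Plane} [IsProbabilityMeasure U]

lemma measurableSet_isolatedPair (r : ℝ) (i j : Fin n) :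
    MeasurableSet {x : Fin n → Plane | IsolatedPair r x i j} := by
  have : {x : Fin n → Plane | IsolatedPair r x i j} = {x | dist (x i) (x j) ≤ r} ∩
      ⋂ k, {x | k ≠ i → k ≠ j → r < dist (x i) (x k) ∧ r < dist (x j) (x k)} := by
    ext x
    simp [IsolatedPair]
  rw [this]
  refine (measurableSet_le (by fun_prop) (by fun_prop)).inter (MeasurableSet.iInter fun k => ?_)
  by_cases hi : k = i
  · simp [hi]
  by_cases hj : k = j
  · simp [hj]
  simp only [ne_eq, hi, hj, not_false_eq_true, forall_const]
  have hlt : ∀ i : Fin n, MeasurableSet {x : Fin n → Plane | r < dist (x i) (x k)} :=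
    fun i => measurableSet_lt (by fun_prop) (by fun_prop)
  exact (hlt i).inter (hlt j)

/-- Union bound: given the close pair, each of at most `n` further points lies within `r` of one of
the two with probability at most `2 θ`. -/
lemma measureReal_isolatedPair_ge {r θ : ℝ} (hθ : ∀ a, U.real (Metric.closedBall a r) ≤ θ)
    {i j : Fin n} (hij : i ≠ j) :
    (U.prod U).real {p | dist p.1 p.2 ≤ r} * (1 - 2 * n * θ) ≤
      (Measure.pi fun _ : Fin n => U).real {x | IsolatedPair r x i j} := by
  classical
  set μ := Measure.pi fun _ : Fin n => U
  set q := (U.prod U).real {p : Plane × Plane | dist p.1 p.2 ≤ r}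
  have hθ0 : 0 ≤ θ := measureReal_nonneg.trans (hθ 0)
  have hm : MeasurableSet {p : Plane × Plane | dist p.1 p.2 ≤ r} :=
    measurableSet_le (by fun_prop) (by fun_prop)
  have hA : μ.real {x | dist (x i) (x j) ≤ r} = q := by
    simp only [q]
    rw [← pi_map_pair (fun _ : Fin n => U) hij, map_measureReal_apply (by fun_prop) hm]
    rfl
  have hB : ∀ i j k : Fin n, i ≠ j → i ≠ k → j ≠ k →
      μ.real {x | dist (x i) (x j) ≤ r ∧ dist (x i) (x k) ≤ r} ≤ q * θ := by
    intro i j k hij hik hjk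
    have hm3 : MeasurableSet
        {p : (Plane × Plane) × Plane | dist p.1.1 p.1.2 ≤ r ∧ dist p.1.1 p.2 ≤ r} := by
      have ha : MeasurableSet {p : (Plane × Plane) × Plane | dist p.1.1 p.1.2 ≤ r} :=
        measurableSet_le (by fun_prop) (by fun_prop)
      have hb : MeasurableSet {p : (Plane × Plane) × Plane | dist p.1.1 p.2 ≤ r} :=
        measurableSet_le (by fun_prop) (by fun_prop)
      exact ha.inter hb
    have h1 : μ {x | dist (x i) (x j) ≤ r ∧ dist (x i) (x k) ≤ r} = ((U.prod U).prod U)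
        {p : (Plane × Plane) × Plane | dist p.1.1 p.1.2 ≤ r ∧ dist p.1.1 p.2 ≤ r} := by
      rw [← pi_map_triple (fun _ : Fin n => U) hij hik hjk, Measure.map_apply (by fun_prop) hm3]
      rfl
    have h2 : μ {x | dist (x i) (x j) ≤ r ∧ dist (x i) (x k) ≤ r} ≤
        (U.prod U) {p : Plane × Plane | dist p.1 p.2 ≤ r} * ENNReal.ofReal θ := by
      rw [h1, Measure.prod_apply hm3, mul_comm, ← lintegral_indicator_const hm]
      refine lintegral_mono fun p => ?_
      by_cases hp : dist p.1 p.2 ≤ r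
      · rw [Set.indicator_of_mem (show p ∈ {p : Plane × Plane | dist p.1 p.2 ≤ r} from hp)]
        refine (measure_mono (t := Metric.closedBall p.1 r) ?_).trans ?_
        · rintro y ⟨-, hy⟩
          rw [Metric.mem_closedBall, dist_comm]
          exact hy
        · rw [← ofReal_measureReal]
          exact ENNReal.ofReal_le_ofReal (hθ p.1)
      · rw [Set.indicator_of_notMem (show p ∉ {p : Plane × Plane | dist p.1 p.2 ≤ r} from hp)]
        refine le_of_eq ?_
        convert measure_empty (μ := U)
        ext y
        simp [hp]
    have h3 := ENNReal.toReal_mono (ENNReal.mul_ne_top (measure_ne_top _ _) ENNReal.ofReal_ne_top) h2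
    rwa [ENNReal.toReal_mul, ENNReal.toReal_ofReal hθ0] at h3
  have hsub : {x : Fin n → Plane | dist (x i) (x j) ≤ r} ⊆ {x | IsolatedPair r x i j} ∪
      ⋃ k ∈ (Finset.univ.erase i).erase j,
        ({x | dist (x i) (x j) ≤ r ∧ dist (x i) (x k) ≤ r} ∪
          {x | dist (x j) (x i) ≤ r ∧ dist (x j) (x k) ≤ r}) := by
    intro x hx
    have hx' : dist (x i) (x j) ≤ r := hx
    by_cases h : IsolatedPair r x i j
    · exact Or.inl h
    · right
      unfold IsolatedPair at h
      push Not at h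
      obtain ⟨k, hki, hkj, hk⟩ := h hx'
      refine Set.mem_biUnion (x := k)
        (by simp [hki, hkj]) ?_
      by_cases h1 : dist (x i) (x k) ≤ r
      · exact Or.inl ⟨hx', h1⟩
      · exact Or.inr ⟨by rw [dist_comm]; exact hx', hk (not_le.1 h1)⟩
  have hle := (measureReal_mono (μ := μ) hsub).trans (measureReal_union_le _ _)
  have hle2 := measureReal_biUnion_finset_le (μ := μ) ((Finset.univ.erase i).erase j) fun k =>
    ({x | dist (x i) (x j) ≤ r ∧ dist (x i) (x k) ≤ r} ∪
          {x | dist (x j) (x i) ≤ r ∧ dist (x j) (x k) ≤ r})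
  have hle3 : ∑ k ∈ (Finset.univ.erase i).erase j,
      μ.real ({x | dist (x i) (x j) ≤ r ∧ dist (x i) (x k) ≤ r} ∪
          {x | dist (x j) (x i) ≤ r ∧ dist (x j) (x k) ≤ r}) ≤ n * (2 * (q * θ)) := by
    have hq : 0 ≤ q * θ := mul_nonneg measureReal_nonneg hθ0
    refine (Finset.sum_le_card_nsmul _ _ (2 * (q * θ)) fun k hk => ?_).trans ?_
    · have hkj := (Finset.mem_erase.1 hk).1
      have hki := (Finset.mem_erase.1 (Finset.mem_erase.1 hk).2).1
      refine (measureReal_union_le _ _).trans ?_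
      linarith [hB i j k hij hki.symm hkj.symm, hB j i k hij.symm hkj.symm hki.symm]
    · rw [nsmul_eq_mul]
      refine mul_le_mul_of_nonneg_right ?_ (by positivity)
      refine Nat.cast_le.2 ((Finset.card_le_univ _).trans ?_)
      rw [Fintype.card_fin]
  rw [hA] at hle
  nlinarith

lemma integral_reflexiveCount_ge {r θ : ℝ} (hθ : ∀ a, U.real (Metric.closedBall a r) ≤ θ) :
    n * (n - 1) * ((U.prod U).real {p | dist p.1 p.2 ≤ r} * (1 - 2 * n * θ)) ≤
      ∫ x, (reflexiveCount (nearest x) : ℝ) ∂(Measure.pi fun _ : Fin n => U) := by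
  classical
  have hint : ∀ i j : Fin n, Integrable (fun x : Fin n → Plane =>
      if IsolatedPair r x i j then (1 : ℝ) else 0) (Measure.pi fun _ : Fin n => U) := by
    intro i j
    exact (integrable_const (1 : ℝ)).indicator (measurableSet_isolatedPair r i j)
  have hval : ∀ i j : Fin n, ∫ x, (if IsolatedPair r x i j then (1 : ℝ) else 0)
      ∂(Measure.pi fun _ : Fin n => U) =
        (Measure.pi fun _ : Fin n => U).real {x | IsolatedPair r x i j} := by
    intro i j
    exact integral_indicator_one (measurableSet_isolatedPair r i j)
  have hR : Integrable (fun x : Fin n → Plane => (reflexiveCount (nearest x) : ℝ))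
      (Measure.pi fun _ : Fin n => U) := by
    refine Integrable.of_bound (C := n) ?_ (ae_of_all _ fun x => ?_)
    · exact ((measurable_of_finite fun η : Fin n → Fin n => (reflexiveCount η : ℝ)).comp
        measurable_nearest).aestronglyMeasurable
    · rw [Real.norm_natCast]
      refine Nat.cast_le.2 ((Finset.card_le_univ _).trans ?_)
      rw [Fintype.card_fin]
  refine le_trans ?_ (integral_mono (integrable_finsetSum _ fun i _ => integrable_finsetSum _
    fun j _ => hint i j) hR fun x => sum_isolatedPair_le_reflexiveCount r x)
  rw [integral_finsetSum _ fun i _ => integrable_finsetSum _ fun j _ => hint i j]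
  have hi : ∀ i : Fin n, (n - 1 : ℝ) *
      ((U.prod U).real {p | dist p.1 p.2 ≤ r} * (1 - 2 * n * θ)) ≤
      ∫ x, ∑ j ∈ Finset.univ.erase i, (if IsolatedPair r x i j then (1 : ℝ) else 0)
        ∂(Measure.pi fun _ : Fin n => U) := by
    intro i
    rw [integral_finsetSum _ fun j _ => hint i j]
    have := Finset.card_nsmul_le_sum (Finset.univ.erase i) (fun j => ∫ x,
      (if IsolatedPair r x i j then (1 : ℝ) else 0) ∂(Measure.pi fun _ : Fin n => U))
      ((U.prod U).real {p | dist p.1 p.2 ≤ r} * (1 - 2 * n * θ)) fun j hj => by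
        rw [hval]
        exact measureReal_isolatedPair_ge hθ (Finset.mem_erase.1 hj).1.symm
    rw [nsmul_eq_mul, Finset.card_erase_of_mem (Finset.mem_univ i), Finset.card_univ,
      Fintype.card_fin, Nat.cast_sub (Nat.one_le_of_lt i.2), Nat.cast_one] at this
    exact this
  have := Finset.card_nsmul_le_sum Finset.univ _ _ fun i (_ : i ∈ Finset.univ) => hi i
  rw [nsmul_eq_mul, Finset.card_univ, Fintype.card_fin] at this
  linarith

end Reflexive

/-- For the uniform law on a set of positive area, a small ball around a random point has on
average asymptotically the full density. -/
lemma eventually_prod_dist_le_ge {D : Set Plane} (hD : MeasurableSet D) (h0 : volume D ≠ 0)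
    (h1 : volume D ≠ ⊤) :
    ∀ᶠ r in 𝓝[>] (0 : ℝ), (volume.real (Metric.closedBall (0 : Plane) r) / volume.real D) / 2 ≤
      (((volume : Measure Plane)[|D]).prod ((volume : Measure Plane)[|D])).real
        {p | dist p.1 p.2 ≤ r} := by
  set U := (volume : Measure Plane)[|D] with hU
  have : IsProbabilityMeasure U := cond_isProbabilityMeasure_of_finite h0 h1
  have hball : ∀ (a : Plane) (r : ℝ),
      volume (Metric.closedBall a r) = volume (Metric.closedBall (0 : Plane) r) := fun a r =>
    Measure.addHaar_closedBall_center _ a r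
  set f : ℝ → Plane → ENNReal := fun r a =>
    volume (D ∩ Metric.closedBall a r) / volume (Metric.closedBall (0 : Plane) r) with hf
  have hmeas : ∀ r, Measurable fun a => volume (D ∩ Metric.closedBall a r) := by
    intro r
    have hm : MeasurableSet {p : Plane × Plane | p.2 ∈ D ∧ dist p.2 p.1 ≤ r} := by
      have hb : MeasurableSet {p : Plane × Plane | dist p.2 p.1 ≤ r} :=
        measurableSet_le (by fun_prop) (by fun_prop)
      exact (measurable_snd hD).inter hb
    exact measurable_measure_prodMk_left hm
  have hfm : ∀ r, Measurable (f r) := fun r => (hmeas r).div_const _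
  have hlim : ∀ᵐ a ∂U, liminf (fun r => f r a) (𝓝[>] 0) = 1 := by
    have h : ∀ᵐ a ∂(volume.restrict D), Tendsto (fun r => f r a) (𝓝[>] 0) (𝓝 1) := by
      filter_upwards [Besicovitch.ae_tendsto_measure_inter_div (volume : Measure Plane) D] with a ha
      refine ha.congr fun r => ?_
      rw [hball]
    have hac : U ≪ volume.restrict D := Measure.smul_absolutelyContinuous
    filter_upwards [hac.ae_le h] with a ha using ha.liminf_eq
  -- Almost every point of `D` is a Lebesgue density point, so by Fatou the mean relative density
  -- has lower limit at least 1 and is eventually above `1 / 2`. No regularity of the boundary is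
  -- required.
  have hfatou := lintegral_liminf_le (μ := U) (u := 𝓝[>] (0 : ℝ)) hfm
  rw [lintegral_congr_ae hlim, lintegral_one, measure_univ] at hfatou
  have hev : ∀ᶠ r in 𝓝[>] (0 : ℝ), (1 / 2 : ENNReal) < ∫⁻ a, f r a ∂U :=
    eventually_lt_of_lt_liminf (lt_of_lt_of_le (by
      rw [ENNReal.div_lt_iff (by norm_num) (by norm_num)]; norm_num) hfatou)
  filter_upwards [hev, self_mem_nhdsWithin] with r hr hr0
  have hr0 : 0 < r := hr0
  have hV0 : volume (Metric.closedBall (0 : Plane) r) ≠ 0 :=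
    (Metric.measure_closedBall_pos _ _ hr0).ne'
  have hV1 : volume (Metric.closedBall (0 : Plane) r) ≠ ⊤ := measure_closedBall_lt_top.ne
  have hm : MeasurableSet {p : Plane × Plane | dist p.1 p.2 ≤ r} :=
    measurableSet_le (by fun_prop) (by fun_prop)
  have hq : (U.prod U) {p | dist p.1 p.2 ≤ r} =
      volume (Metric.closedBall (0 : Plane) r) / volume D * ∫⁻ a, f r a ∂U := by
    rw [Measure.prod_apply hm, ← lintegral_const_mul _ (hfm r)]
    refine lintegral_congr fun a => ?_
    rw [hU, cond_apply hD]
    have : Prod.mk a ⁻¹' {p : Plane × Plane | dist p.1 p.2 ≤ r} = Metric.closedBall a r := by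
      ext b
      simp only [Set.mem_preimage, Metric.mem_closedBall]
      rw [dist_comm b]
      rfl
    rw [this]
    simp only [hf]
    rw [ENNReal.div_eq_inv_mul, ENNReal.div_eq_inv_mul, mul_assoc]
    congr 1
    rw [← mul_assoc, ENNReal.mul_inv_cancel hV0 hV1, one_mul]
  have hle : volume (Metric.closedBall (0 : Plane) r) / volume D * (1 / 2) ≤
      (U.prod U) {p | dist p.1 p.2 ≤ r} := by
    rw [hq]
    gcongr
  have := ENNReal.toReal_mono (measure_ne_top _ _) hle
  rw [ENNReal.toReal_mul, ENNReal.toReal_div] at this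
  refine le_trans (le_of_eq ?_) this
  simp [Measure.real, div_eq_mul_inv]


/-- The radius is such that a ball has uniform mass at most `1 / (4 n)`. Then a pair is close with
probability at least `1 / (8 n)`, and isolated given this with probability at least `1 / 2`. Summing
over ordered pairs gives `(n - 1) / 16`, which is at least `n / 32` for `n ≥ 2`. -/
lemma eventually_integral_reflexiveCount_ge {D : Set Plane} (hD : MeasurableSet D)
    (h0 : volume D ≠ 0) (h1 : volume D ≠ ⊤) :
    ∀ᶠ n : ℕ in atTop, (n : ℝ) / 32 ≤ ∫ x, (reflexiveCount (nearest x) : ℝ)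
      ∂(Measure.pi fun _ : Fin n => (volume : Measure Plane)[|D]) := by
  have hprob : IsProbabilityMeasure ((volume : Measure Plane)[|D]) :=
    cond_isProbabilityMeasure_of_finite h0 h1
  set v := volume.real (Metric.ball (0 : Plane) 1) with hv
  have hv0 : 0 < v := ENNReal.toReal_pos (Metric.measure_ball_pos _ _ one_pos).ne'
    measure_ball_lt_top.ne
  set d := volume.real D with hd
  have hd0 : 0 < d := ENNReal.toReal_pos h0 h1
  have hball : ∀ (a : Plane) {r : ℝ}, 0 ≤ r → volume.real (Metric.closedBall a r) = r ^ 2 * v := by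
    intro a r hr
    rw [Measure.addHaar_real_closedBall _ _ hr, finrank_euclideanSpace_fin]
  set r : ℕ → ℝ := fun n => √(d / (4 * v) * (n : ℝ)⁻¹) with hr
  have hrlim : Tendsto r atTop (𝓝[>] 0) := by
    refine tendsto_nhdsWithin_iff.2 ⟨?_, ?_⟩
    · have h := ((tendsto_inv_atTop_nhds_zero_nat (𝕜 := ℝ)).const_mul (d / (4 * v))).sqrt
      rwa [mul_zero, Real.sqrt_zero] at h
    · filter_upwards [eventually_gt_atTop 0] with n hn
      exact Real.sqrt_pos.2 (by positivity)
  filter_upwards [hrlim.eventually (eventually_prod_dist_le_ge hD h0 h1), eventually_ge_atTop 2]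
    with n hn hn2
  have hn0 : (0 : ℝ) < n := by positivity
  have hn2' : (2 : ℝ) ≤ n := by exact_mod_cast hn2
  have hr0 : 0 ≤ r n := Real.sqrt_nonneg _
  have hrsq : r n ^ 2 * v / d = 1 / (4 * n) := by
    simp only [hr]
    rw [Real.sq_sqrt (by positivity)]
    field_simp
  have hθ : ∀ a, ((volume : Measure Plane)[|D]).real (Metric.closedBall a (r n)) ≤
      1 / (4 * n) := by
    intro a
    rw [← hrsq, ← hball a hr0, Measure.real, cond_apply hD, ENNReal.toReal_mul,
      ENNReal.toReal_inv, div_eq_inv_mul]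
    refine mul_le_mul_of_nonneg_left ?_ (by positivity)
    exact ENNReal.toReal_mono measure_closedBall_lt_top.ne (measure_mono Set.inter_subset_right)
  refine le_trans ?_ (integral_reflexiveCount_ge hθ)
  rw [hball 0 hr0, hrsq] at hn
  have h2 : 1 - 2 * (n : ℝ) * (1 / (4 * n)) = 1 / 2 := by field_simp; norm_num
  rw [h2]
  calc (n : ℝ) / 32 ≤ n * (n - 1) * (1 / (4 * n) / 2 * (1 / 2)) := by
        have : (n : ℝ) * (n - 1) * (1 / (4 * n) / 2 * (1 / 2)) = (n - 1) / 16 := by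
          field_simp; ring
        rw [this]
        linarith
    _ ≤ _ := by
        refine mul_le_mul_of_nonneg_left ?_ (mul_nonneg hn0.le (by linarith))
        exact mul_le_mul_of_nonneg_right hn (by norm_num)

lemma exists_gt_quantile_chiTail_ge {α : ℝ} (hα : 0 < α) (hα' : α < 1) {ε : ℝ} (hε : 0 < ε) :
    ∃ y, chiSqOneQuantile (1 - α) < y ∧ α - ε ≤ chiTail y := by
  obtain ⟨hx, -⟩ := chiTail_quantile hα hα'
  have h := continuous_chiTail.tendsto (chiSqOneQuantile (1 - α))
  rw [hx] at h
  have h2 := (h.mono_left (nhdsWithin_le_nhds (s := Set.Ioi (chiSqOneQuantile (1 - α))))).eventually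
    (lt_mem_nhds (show α - ε < α by linarith))
  obtain ⟨y, hy1, hy2⟩ := (h2.and self_mem_nhdsWithin).exists
  exact ⟨y, hy2, hy1.le⟩

/-! ### The level under CSR independence -/

lemma rlLevel_nonneg (α : ℝ) (m₁ m₂ : ℕ) (η : Fin (m₁ + m₂) → Fin (m₁ + m₂)) :
    0 ≤ rlLevel α m₁ m₂ η := measureReal_nonneg

lemma rlLevel_le_one (α : ℝ) (m₁ m₂ : ℕ) (η : Fin (m₁ + m₂) → Fin (m₁ + m₂)) :
    rlLevel α m₁ m₂ η ≤ 1 :=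
  measureReal_le_one (μ := randomLabels m₁ m₂)

/-- Under CSR independence, Pielou's test is liberal. -/
theorem csrLevel_liberal {α : ℝ} (hα : 0 < α) (hα' : α < 1) {D : Set Plane} (hD : MeasurableSet D)
    (h0 : volume D ≠ 0) (h1 : volume D ≠ ⊤) {m₁ m₂ : ℕ → ℕ}
    (hm : Tendsto (fun k => m₁ k + m₂ k) atTop atTop) {c : ℝ} (hc : 0 < c)
    (hmc : ∀ᶠ k in atTop, c * ((m₁ k : ℝ) + m₂ k) ≤ m₁ k ∧ c * ((m₁ k : ℝ) + m₂ k) ≤ m₂ k) :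
    ∃ δ : ℝ, 0 < δ ∧ ∀ᶠ k in atTop, α + δ ≤ csrLevel α D (m₁ k) (m₂ k) := by
  have hprob : IsProbabilityMeasure ((volume : Measure Plane)[|D]) :=
    cond_isProbabilityMeasure_of_finite h0 h1
  have hac : (volume : Measure Plane)[|D] ≪ volume := cond_absolutelyContinuous
  -- The threshold is half the lower bound `1 / 32` for the mean of `R / n`. Configurations above it
  -- gain nearly `g`; those below it lose at most `2 · g / 256`.
  obtain ⟨y₁, hy₁, hyα⟩ := exists_lt_chiTail_gt hα hα' (show (0 : ℝ) < 1 / 64 by norm_num)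
  set g := chiTail y₁ - α with hg
  have hg0 : 0 < g := by simp only [hg]; linarith
  have hε : 0 < g / 256 := by positivity
  obtain ⟨y₀, hy₀, hyα₀⟩ := exists_gt_quantile_chiTail_ge hα hα' hε
  obtain ⟨N₁, hN₁⟩ := exists_forall_chiTail_le_rlLevel hα hα' hc
    (show (0 : ℝ) ≤ 1 / 64 by norm_num) hy₁ hε 25
  obtain ⟨N₀, hN₀⟩ := exists_forall_chiTail_le_rlLevel hα hα' hc le_rfl
    (show chiSqOneQuantile (1 - α) < y₀ * (1 + 0) by linarith) hε 25
  refine ⟨g / 128, by positivity, ?_⟩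
  filter_upwards [hm.eventually_ge_atTop N₀, hm.eventually_ge_atTop N₁, hm.eventually_ge_atTop 2,
    hmc, hm.eventually (eventually_integral_reflexiveCount_ge hD h0 h1)] with k k0 k1 k2 kc kR
  set n := m₁ k + m₂ k with hn
  have hncast : (m₁ k : ℝ) + m₂ k = n := by rw [hn]; push_cast; rfl
  rw [hncast] at kc
  have hn0 : (0 : ℝ) < n := by exact_mod_cast (show 0 < n by omega)
  set μ := Measure.pi fun _ : Fin n => (volume : Measure Plane)[|D] with hμ
  have hRle : ∀ x : Fin n → Plane, (reflexiveCount (nearest x) : ℝ) ≤ n := by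
    intro x
    refine Nat.cast_le.2 ((Finset.card_le_univ _).trans ?_)
    rw [Fintype.card_fin]
  have hcomp : ∀ f : (Fin n → Fin n) → ℝ, Measurable fun x : Fin n → Plane => f (nearest x) :=
    fun f => (measurable_of_finite f).comp measurable_nearest
  have hRint : Integrable (fun x : Fin n → Plane => (reflexiveCount (nearest x) : ℝ)) μ :=
    Integrable.of_bound (hcomp fun η => (reflexiveCount η : ℝ)).aestronglyMeasurable n
      (ae_of_all _ fun x => by rw [Real.norm_natCast]; exact hRle x)
  have hLint : Integrable (fun x : Fin n → Plane => rlLevel α (m₁ k) (m₂ k) (nearest x)) μ :=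
    Integrable.of_bound (hcomp (rlLevel α (m₁ k) (m₂ k))).aestronglyMeasurable 1
      (ae_of_all _ fun x => by
        rw [Real.norm_of_nonneg (rlLevel_nonneg _ _ _ _)]
        exact rlLevel_le_one _ _ _ _)
  -- A lower bound affine in `R / n` covers both cases, so only the mean of `R` is needed:
  -- integration yields at least `α - g / 128 + g / 64`.
  have hpt : ∀ᵐ x ∂μ, α - g / 128 + g * ((reflexiveCount (nearest x) : ℝ) / n - 1 / 64) ≤
      rlLevel α (m₁ k) (m₂ k) (nearest x) := by
    filter_upwards [ae_injective_pi (n := n) hac] with x hx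
    have hb : IsBoundedMap (nearest x) 25 := isBoundedMap_of_isNN hx (isNN_nearest k2 x)
    by_cases hR : 1 / 64 * (n : ℝ) ≤ reflexiveCount (nearest x)
    · have h := hN₁ (m₁ k) (m₂ k) (nearest x) k1 (by rw [hncast]; exact kc.1)
        (by rw [hncast]; exact kc.2) hb (by rw [hncast]; exact hR)
      have h2 : (reflexiveCount (nearest x) : ℝ) / n ≤ 1 := (div_le_one hn0).2 (hRle x)
      have h3 : g * ((reflexiveCount (nearest x) : ℝ) / n - 1 / 64) ≤ g * 1 :=
        mul_le_mul_of_nonneg_left (by linarith) hg0.le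
      simp only [hg] at h3 h ⊢
      linarith
    · have h := hN₀ (m₁ k) (m₂ k) (nearest x) k0 (by rw [hncast]; exact kc.1)
        (by rw [hncast]; exact kc.2) hb (by rw [zero_mul]; positivity)
      have h2 : (reflexiveCount (nearest x) : ℝ) / n ≤ 1 / 64 := by
        rw [div_le_iff₀ hn0]
        exact (not_le.1 hR).le
      have h3 : g * ((reflexiveCount (nearest x) : ℝ) / n - 1 / 64) ≤ g * 0 :=
        mul_le_mul_of_nonneg_left (by linarith) hg0.le
      linarith
  have hmul : Integrable (fun x : Fin n → Plane =>
      g * ((reflexiveCount (nearest x) : ℝ) / n - 1 / 64)) μ :=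
    ((hRint.div_const _).sub (integrable_const _)).const_mul _
  have hlow : Integrable (fun x : Fin n → Plane =>
      α - g / 128 + g * ((reflexiveCount (nearest x) : ℝ) / n - 1 / 64)) μ :=
    (integrable_const _).add hmul
  have hint := integral_mono_ae hlow hLint hpt
  rw [integral_add (integrable_const _) hmul,
    integral_const_mul, integral_sub (hRint.div_const _) (integrable_const _), integral_div,
    integral_const, integral_const, probReal_univ, one_smul, one_smul] at hint
  have hval : csrLevel α D (m₁ k) (m₂ k) = ∫ x, rlLevel α (m₁ k) (m₂ k) (nearest x) ∂μ :=
    pi_rejects_eq_integral_rlLevel hac k2 α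
  rw [hval]
  refine le_trans ?_ hint
  have h5 : 1 / 32 ≤ (∫ x, (reflexiveCount (nearest x) : ℝ) ∂μ) / n := by
    rw [le_div_iff₀ hn0]
    linarith
  have h6 : g * (1 / 64) ≤ g * ((∫ x, (reflexiveCount (nearest x) : ℝ) ∂μ) / n - 1 / 64) :=
    mul_le_mul_of_nonneg_left (by linarith) hg0.le
  linarith


/-! ### A form of the Efron–Stein inequality -/

section EfronStein
variable {ι E : Type*} [DecidableEq ι]

/-- The configuration that takes its coordinates in `s` from the second component. -/
def mixture (s : Finset ι) (z : ι → E × E) (i : ι) : E := if i ∈ s then (z i).2 else (z i).1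

/-- Exchange the two components of the coordinate `k`. -/
def swapAt (k : ι) (z : ι → E × E) (i : ι) : E × E := if i = k then (z i).swap else z i

lemma mixture_swapAt_of_notMem {s : Finset ι} {k : ι} (hk : k ∉ s) (z : ι → E × E) :
    mixture s (swapAt k z) = mixture (insert k s) z := by
  funext i
  unfold mixture swapAt
  by_cases hi : i = k
  · subst hi
    simp [hk]
  · simp [hi]

lemma mixture_insert_swapAt {s : Finset ι} {k : ι} (hk : k ∉ s) (z : ι → E × E) :
    mixture (insert k s) (swapAt k z) = mixture s z := by
  funext i
  unfold mixture swapAt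
  by_cases hi : i = k
  · subst hi
    simp [hk]
  · simp [hi]

lemma mixture_insert_eq {s : Finset ι} {k i : ι} (hi : i ≠ k) (z : ι → E × E) :
    mixture s z i = mixture (insert k s) z i := by
  unfold mixture
  simp [hi]

variable [Fintype ι] [MeasurableSpace E] (μ : ι → Measure E) [∀ i, IsProbabilityMeasure (μ i)]

lemma measurePreserving_mixture (s : Finset ι) :
    MeasurePreserving (mixture s) (Measure.pi fun i => (μ i).prod (μ i)) (Measure.pi μ) := by
  refine measurePreserving_pi _ _ (f := fun i (p : E × E) => if i ∈ s then p.2 else p.1) fun i => ?_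
  by_cases hi : i ∈ s
  · simp only [hi, if_true]
    exact measurePreserving_snd
  · simp only [hi, if_false]
    exact measurePreserving_fst

lemma measurePreserving_swapAt (k : ι) :
    MeasurePreserving (swapAt k) (Measure.pi fun i => (μ i).prod (μ i))
      (Measure.pi fun i => (μ i).prod (μ i)) := by
  refine measurePreserving_pi _ _ (f := fun i (p : E × E) => if i = k then p.swap else p)
    fun i => ?_
  by_cases hi : i = k
  · simp only [hi, if_true]
    exact Measure.measurePreserving_swap
  · simp only [hi, if_false]
    exact MeasurePreserving.id _

lemma integral_mixture_mul {f g : (ι → E) → ℝ} :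
    ∫ z, f (mixture ∅ z) * g (mixture Finset.univ z) ∂(Measure.pi fun i => (μ i).prod (μ i)) =
      (∫ x, f x ∂(Measure.pi μ)) * ∫ x, g x ∂(Measure.pi μ) := by
  have h := measurePreserving_arrowProdEquivProdArrow E E ι μ μ
  rw [← integral_prod_mul, ← h.map_eq, integral_map_equiv]
  refine integral_congr_ae (ae_of_all _ fun z => ?_)
  have h1 : mixture ∅ z = fun i => (z i).1 := by
    funext i
    simp [mixture]
  have h2 : mixture Finset.univ z = fun i => (z i).2 := by
    funext i
    simp [mixture]
  simp only [h1, h2]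
  rfl

variable {f : (ι → E) → ℝ} {h : ι → (ι → E) → ℝ} {B : ℝ}

/-- The variables are replaced by independent copies one coordinate at a time. Each increment is
symmetrised into half the mean of a product of two differences of `f` in that coordinate, and such a
product is bounded by squares. -/
lemma integral_mul_sub_mixture_le (hf : Measurable f) (hh : ∀ k, Measurable (h k))
    (hfB : ∀ x, |f x| ≤ B) (hhB : ∀ k x, |h k x| ≤ B)
    (hfh : ∀ k x y, (∀ i, i ≠ k → x i = y i) → |f x - f y| ≤ h k x + h k y) (s : Finset ι) :
    ∫ z, f (mixture ∅ z) * (f (mixture ∅ z) - f (mixture s z))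
        ∂(Measure.pi fun i => (μ i).prod (μ i)) ≤
      2 * ∑ k ∈ s, ∫ x, h k x ^ 2 ∂(Measure.pi μ) := by
  set ν := Measure.pi fun i => (μ i).prod (μ i)
  have hmix : ∀ s : Finset ι, Measurable (mixture s : (ι → E × E) → ι → E) :=
    fun s => (measurePreserving_mixture μ s).measurable
  have hfi : ∀ s : Finset ι, Measurable fun z : ι → E × E => f (mixture s z) :=
    fun s => hf.comp (hmix s)
  have hint : ∀ s t u : Finset ι, Integrable
      (fun z => f (mixture s z) * (f (mixture t z) - f (mixture u z))) ν := by
    intro s t u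
    refine Integrable.of_bound (C := B * (B + B)) ((hfi s).mul ((hfi t).sub (hfi u))).aestronglyMeasurable
      (ae_of_all _ fun z => ?_)
    rw [Real.norm_eq_abs, abs_mul]
    exact mul_le_mul (hfB _) ((abs_sub _ _).trans (add_le_add (hfB _) (hfB _))) (abs_nonneg _)
      ((abs_nonneg _).trans (hfB fun i => (mixture s z i)))
  have hsqi : ∀ k, Integrable (fun x => h k x ^ 2) (Measure.pi μ) := by
    intro k
    refine Integrable.of_bound (C := B ^ 2) ((hh k).pow_const 2).aestronglyMeasurable
      (ae_of_all _ fun x => ?_)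
    rw [Real.norm_eq_abs, abs_pow]
    exact pow_le_pow_left₀ (abs_nonneg _) (hhB k x) 2
  have hsq : ∀ k (s : Finset ι), Integrable (fun z => h k (mixture s z) ^ 2) ν := fun k s =>
    (measurePreserving_mixture μ s).integrable_comp_of_integrable (hsqi k)
  have hsqv : ∀ k (s : Finset ι), ∫ z, h k (mixture s z) ^ 2 ∂ν = ∫ x, h k x ^ 2 ∂(Measure.pi μ) := by
    intro k s
    rw [← (measurePreserving_mixture μ s).map_eq, integral_map (hmix s).aemeasurable]
    rw [(measurePreserving_mixture μ s).map_eq]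
    exact (hsqi k).aestronglyMeasurable
  induction s using Finset.induction_on with
  | empty => simp
  | insert k s hk ih =>
    rw [Finset.sum_insert hk, mul_add]
    have hsplit : ∫ z, f (mixture ∅ z) * (f (mixture ∅ z) - f (mixture (insert k s) z)) ∂ν =
        ∫ z, f (mixture ∅ z) * (f (mixture s z) - f (mixture (insert k s) z)) ∂ν +
        ∫ z, f (mixture ∅ z) * (f (mixture ∅ z) - f (mixture s z)) ∂ν := by
      rw [← integral_add (hint _ _ _) (hint _ _ _)]
      exact integral_congr_ae (ae_of_all _ fun z => by ring)
    rw [hsplit]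
    refine add_le_add ?_ ih
    -- Exchanging coordinate `k` with its copy preserves the law and reverses the sign of the
    -- difference; averaging with the original produces a difference in the first factor too.
    have hswap : ∫ z, f (mixture ∅ z) * (f (mixture s z) - f (mixture (insert k s) z)) ∂ν =
        ∫ z, f (mixture {k} z) * (f (mixture (insert k s) z) - f (mixture s z)) ∂ν := by
      have hsw : MeasurePreserving (swapAt k) ν ν := measurePreserving_swapAt μ k
      conv_lhs => rw [← hsw.map_eq]
      rw [integral_map hsw.measurable.aemeasurable
        (by rw [hsw.map_eq]; exact (hint _ _ _).aestronglyMeasurable)]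
      refine integral_congr_ae (ae_of_all _ fun z => ?_)
      simp only
      rw [mixture_swapAt_of_notMem (Finset.notMem_empty k), mixture_swapAt_of_notMem hk,
        mixture_insert_swapAt hk, insert_empty_eq]
    have hhalf : ∫ z, f (mixture ∅ z) * (f (mixture s z) - f (mixture (insert k s) z)) ∂ν =
        ∫ z, (f (mixture ∅ z) * (f (mixture s z) - f (mixture (insert k s) z)) +
          f (mixture {k} z) * (f (mixture (insert k s) z) - f (mixture s z))) / 2 ∂ν := by
      rw [integral_div, integral_add (hint _ _ _) (hint _ _ _), ← hswap]
      ring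
    rw [hhalf]
    have hpt : ∀ z, (f (mixture ∅ z) * (f (mixture s z) - f (mixture (insert k s) z)) +
          f (mixture {k} z) * (f (mixture (insert k s) z) - f (mixture s z))) / 2 ≤
        (h k (mixture ∅ z) ^ 2 + h k (mixture {k} z) ^ 2) / 2 +
          (h k (mixture s z) ^ 2 + h k (mixture (insert k s) z) ^ 2) / 2 := by
      intro z
      have h1 := hfh k (mixture ∅ z) (mixture {k} z) fun i hi => by
        rw [mixture_insert_eq (s := ∅) hi, insert_empty_eq]
      have h2 := hfh k (mixture s z) (mixture (insert k s) z) fun i hi => mixture_insert_eq hi z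
      have h1' := sq_le_sq' (by linarith [neg_abs_le (f (mixture ∅ z) - f (mixture {k} z))])
        ((le_abs_self _).trans h1)
      have h2' := sq_le_sq' (by linarith [neg_abs_le (f (mixture s z) - f (mixture (insert k s) z))])
        ((le_abs_self _).trans h2)
      nlinarith [sq_nonneg (f (mixture ∅ z) - f (mixture {k} z) -
        (f (mixture s z) - f (mixture (insert k s) z))),
        sq_nonneg (h k (mixture ∅ z) - h k (mixture {k} z)),
        sq_nonneg (h k (mixture s z) - h k (mixture (insert k s) z))]
    have hpair : ∀ t u : Finset ι, Integrable
        (fun z => (h k (mixture t z) ^ 2 + h k (mixture u z) ^ 2) / 2) ν := fun t u =>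
      ((hsq k t).add (hsq k u)).div_const 2
    refine (integral_mono (((hint _ _ _).add (hint _ _ _)).div_const 2)
      ((hpair ∅ {k}).add (hpair s (insert k s))) hpt).trans (le_of_eq ?_)
    change ∫ z, ((h k (mixture ∅ z) ^ 2 + h k (mixture {k} z) ^ 2) / 2 +
          (h k (mixture s z) ^ 2 + h k (mixture (insert k s) z) ^ 2) / 2) ∂ν = _
    rw [integral_add (hpair ∅ {k}) (hpair s (insert k s)),
      integral_div, integral_div, integral_add (hsq k _) (hsq k _),
      integral_add (hsq k _) (hsq k _)]
    simp only [hsqv]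
    ring

/-- **Efron–Stein inequality**: the variance of a function of independent variables is bounded in
terms of its changes under modification of single variables. -/
theorem integral_sq_sub_integral_le (hf : Measurable f) (hh : ∀ k, Measurable (h k))
    (hfB : ∀ x, |f x| ≤ B) (hhB : ∀ k x, |h k x| ≤ B)
    (hfh : ∀ k x y, (∀ i, i ≠ k → x i = y i) → |f x - f y| ≤ h k x + h k y) :
    ∫ x, (f x - ∫ y, f y ∂(Measure.pi μ)) ^ 2 ∂(Measure.pi μ) ≤
      2 * ∑ k, ∫ x, h k x ^ 2 ∂(Measure.pi μ) := by
  have hmain := integral_mul_sub_mixture_le μ hf hh hfB hhB hfh Finset.univ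
  refine le_trans (le_of_eq ?_) hmain
  set ν := Measure.pi fun i => (μ i).prod (μ i)
  have hfi : Integrable f (Measure.pi μ) :=
    Integrable.of_bound hf.aestronglyMeasurable B (ae_of_all _ hfB)
  have hf2 : Integrable (fun x => f x * f x) (Measure.pi μ) := by
    refine Integrable.of_bound (hf.mul hf).aestronglyMeasurable (B * B) (ae_of_all _ fun x => ?_)
    rw [Real.norm_eq_abs, abs_mul]
    exact mul_le_mul (hfB _) (hfB _) (abs_nonneg _) ((abs_nonneg _).trans (hfB x))
  set m := ∫ y, f y ∂(Measure.pi μ) with hm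
  have hL : ∫ x, (f x - m) ^ 2 ∂(Measure.pi μ) = ∫ x, f x * f x ∂(Measure.pi μ) - m * m := by
    have : ∀ x, (f x - m) ^ 2 = f x * f x - (2 * m * f x - m * m) := fun x => by ring
    simp only [this]
    have hi : Integrable (fun x => 2 * m * f x - m * m) (Measure.pi μ) :=
      (hfi.const_mul _).sub (integrable_const _)
    rw [integral_sub hf2 hi, integral_sub (hfi.const_mul _) (integrable_const _), integral_const_mul, integral_const,
      probReal_univ, one_smul, ← hm]
    ring
  have hmp := measurePreserving_mixture μ (∅ : Finset ι)
  have hprod : Integrable (fun z : ι → E × E => f (mixture ∅ z) * f (mixture Finset.univ z)) ν := by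
    refine Integrable.of_bound (C := B * B) ((hf.comp hmp.measurable).mul
      (hf.comp (measurePreserving_mixture μ Finset.univ).measurable)).aestronglyMeasurable
      (ae_of_all _ fun z => ?_)
    rw [Real.norm_eq_abs, abs_mul]
    exact mul_le_mul (hfB _) (hfB _) (abs_nonneg _) ((abs_nonneg _).trans (hfB (mixture ∅ z)))
  -- When all coordinates have been replaced, the second argument is an independent copy, so the
  -- telescoped integral is exactly the variance.
  have hR : ∫ z, f (mixture ∅ z) * (f (mixture ∅ z) - f (mixture Finset.univ z)) ∂ν =
      ∫ z, f (mixture ∅ z) * f (mixture ∅ z) ∂ν - m * m := by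
    simp only [mul_sub]
    have hi : Integrable (fun z => f (mixture ∅ z) * f (mixture ∅ z)) ν :=
      hmp.integrable_comp_of_integrable hf2
    rw [integral_sub hi hprod, integral_mixture_mul μ]
  rw [hL, hR]
  congr 1
  rw [← hmp.map_eq, integral_map hmp.measurable.aemeasurable]
  rw [hmp.map_eq]
  exact hf2.aestronglyMeasurable

end EfronStein


/-! ### Consistency for completely mapped data -/

section Mapped
variable {n : ℕ}

/-- The points `a`, `b`, `c` are not moved, so `c` is as close to `a` as `b` is in both
configurations. -/
lemma IsNN.of_eq_off {x y : Fin n → Plane} {k : Fin n} (hxy : ∀ i, i ≠ k → x i = y i) {a b c : Fin n}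
    (ha : a ≠ k) (hb : IsNN x a b) (hbk : b ≠ k) (hc : IsNN y a c) (hck : c ≠ k) : IsNN x a c := by
  refine ⟨hc.1, fun d hd => le_trans ?_ (hb.2 d hd)⟩
  have := hc.2 b hb.1
  rwa [← hxy a ha, ← hxy b hbk, ← hxy c hck] at this

lemma nearest_le {x : Fin n → Plane} {i j : Fin n} (h : IsNN x i j) : nearest x i ≤ j := by
  classical
  have hmem : j ∈ Finset.univ.filter fun j => IsNN x i j := by simpa using h
  unfold nearest
  rw [dif_pos ⟨j, hmem⟩]
  exact Finset.min'_le _ _ hmem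

/-- Moving one point does not affect nearest neighbours not involving it. -/
lemma nearest_eq_of_eq_off {x y : Fin n → Plane} {k : Fin n} (hxy : ∀ i, i ≠ k → x i = y i)
    {a : Fin n} (ha : a ≠ k) (hx : nearest x a ≠ k) (hy : nearest y a ≠ k) :
    nearest x a = nearest y a := by
  have hn : 2 ≤ n := by
    by_contra h
    exact ha (Fin.ext (by omega))
  have h1 := isNN_nearest hn x a
  have h2 := isNN_nearest hn y a
  -- Each neighbour is also one in the other configuration; the least-index rule then forces
  -- equality even with ties.
  exact le_antisymm (nearest_le (h1.of_eq_off hxy ha hx h2 hy))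
    (nearest_le (h2.of_eq_off (fun i hi => (hxy i hi).symm) ha hy h1 hx))

/-- The number of pairs with base label `i` in which the point `k` takes part (with the pair based
at `k` counted once more if `k` is its own neighbour). -/
noncomputable def pairInvolvement (i : Fin 2) (k : Fin n) (l : Fin n → Fin 2) (η : Fin n → Fin n) :
    ℝ :=
  (if l k = i then 1 else 0) + ∑ a, if l a = i ∧ η a = k then 1 else 0

lemma pairInvolvement_nonneg (i : Fin 2) (k : Fin n) (l : Fin n → Fin 2) (η : Fin n → Fin n) :
    0 ≤ pairInvolvement i k l η :=
  add_nonneg (by split_ifs <;> norm_num) (Finset.sum_nonneg fun a _ => by split_ifs <;> norm_num)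

/-- The pair based at `a` can change only if `a = k`, or if `k` is the neighbour of `a` before or
after the change. Only bases of class `i` matter. -/
lemma abs_cellCount_sub_le (i j : Fin 2) (k : Fin n) {ω ω' : Fin n → Plane × Fin 2}
    (h : ∀ a, a ≠ k → ω a = ω' a) :
    |(cellCount (labels ω) (nnLabels ω) i j : ℝ) - cellCount (labels ω') (nnLabels ω') i j| ≤
      pairInvolvement i k (labels ω) (nearest fun m => (ω m).1) +
        pairInvolvement i k (labels ω') (nearest fun m => (ω' m).1) := by
  classical
  set x := fun m => (ω m).1 with hx
  set x' := fun m => (ω' m).1 with hx'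
  rw [cellCount_cast, cellCount_cast, ← Finset.sum_sub_distrib]
  refine (Finset.abs_sum_le_sum_abs _ _).trans ?_
  have hpt : ∀ a ∈ Finset.univ, |(if labels ω a = i ∧ nnLabels ω a = j then (1 : ℝ) else 0) -
      if labels ω' a = i ∧ nnLabels ω' a = j then (1 : ℝ) else 0| ≤
      ((if a = k then (if labels ω k = i then 1 else 0) else 0) +
        if labels ω a = i ∧ nearest x a = k then 1 else 0) +
      ((if a = k then (if labels ω' k = i then 1 else 0) else 0) +
        if labels ω' a = i ∧ nearest x' a = k then 1 else 0) := by
    intro a _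
    by_cases ha : a = k
    · subst ha
      simp only [if_true]
      by_cases h1 : labels ω a = i <;> by_cases h2 : labels ω' a = i <;>
        simp only [h1, h2, true_and, false_and, if_true, if_false] <;> (try split_ifs) <;> norm_num
    · have hl : labels ω' a = labels ω a := by simp only [labels, h a ha]
      simp only [ha, if_false, zero_add, hl]
      by_cases h1 : labels ω a = i
      · simp only [h1, true_and]
        by_cases h2 : nearest x a = k
        · simp only [h2, if_true]
          split_ifs <;> norm_num
        by_cases h3 : nearest x' a = k
        · simp only [h3, if_true]
          split_ifs <;> norm_num
        have h4 : nearest x a = nearest x' a :=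
          nearest_eq_of_eq_off (fun i hi => by simp only [hx, hx', h i hi]) ha h2 h3
        have h5 : nnLabels ω a = nnLabels ω' a := by
          change (ω (nearest x a)).2 = (ω' (nearest x' a)).2
          rw [← h4, h _ h2]
        rw [h5, sub_self, abs_zero]
        positivity
      · simp [h1]
  refine (Finset.sum_le_sum hpt).trans (le_of_eq ?_)
  rw [Finset.sum_add_distrib, Finset.sum_add_distrib, Finset.sum_add_distrib, Finset.sum_ite_eq',
    Finset.sum_ite_eq', if_pos (Finset.mem_univ k), if_pos (Finset.mem_univ k)]
  rfl

lemma labelCount_cast (l : Fin n → Fin 2) (i : Fin 2) :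
    (labelCount l i : ℝ) = ∑ a, if l a = i then (1 : ℝ) else 0 := by
  unfold labelCount
  rw [Finset.card_filter]
  push_cast
  rfl

/-- The number `d` of class `i` bases pointing to `k` satisfies `d² ≤ K d`, and summing `d` over `k`
counts each base of class `i` once. The bound is by the size of the class and not by `n`, so a class
may be a vanishing fraction of the points. -/
lemma sum_sq_pairInvolvement_le {K : ℕ} (i : Fin 2) (l : Fin n → Fin 2) {η : Fin n → Fin n}
    (hη : IsBoundedMap η K) :
    ∑ k, pairInvolvement i k l η ^ 2 ≤ 2 * (K + 1) * labelCount l i := by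
  classical
  have hpt : ∀ k ∈ Finset.univ, pairInvolvement i k l η ^ 2 ≤
      2 * (if l k = i then 1 else 0) + 2 * K * ∑ a, if l a = i ∧ η a = k then 1 else 0 := by
    intro k _
    unfold pairInvolvement
    set d : ℝ := ∑ a, if l a = i ∧ η a = k then 1 else 0 with hd
    have hd0 : 0 ≤ d := Finset.sum_nonneg fun a _ => by split_ifs <;> norm_num
    have hdK : d ≤ K := by
      have h1 : d ≤ ∑ a, if η a = k then (1 : ℝ) else 0 := by
        refine Finset.sum_le_sum fun a _ => ?_
        by_cases h : η a = k
        · simp only [h, and_true, if_true]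
          split_ifs <;> norm_num
        · simp [h]
      refine h1.trans ?_
      rw [Finset.sum_boole]
      exact_mod_cast hη.indegree_le k
    split_ifs <;> nlinarith [sq_nonneg (d - 1)]
  refine (Finset.sum_le_sum hpt).trans (le_of_eq ?_)
  rw [Finset.sum_add_distrib, ← Finset.mul_sum, ← Finset.mul_sum, Finset.sum_comm, labelCount_cast]
  have : ∀ a, (∑ k, if l a = i ∧ η a = k then (1 : ℝ) else 0) = if l a = i then 1 else 0 := by
    intro a
    by_cases h : l a = i <;> simp [h]
  simp only [this]
  ring

lemma measurable_labels_nearest :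
    Measurable fun ω : Fin n → Plane × Fin 2 => (labels ω, nearest fun m => (ω m).1) := by
  refine Measurable.prodMk (measurable_pi_iff.2 fun k => ?_) (measurable_nearest.comp ?_)
  · exact measurable_snd.comp (measurable_pi_apply k)
  · exact measurable_pi_iff.2 fun k => measurable_fst.comp (measurable_pi_apply k)

lemma Measurable.labels_nearest {β : Type*} [MeasurableSpace β]
    (g : (Fin n → Fin 2) → (Fin n → Fin n) → β) :
    Measurable fun ω : Fin n → Plane × Fin 2 => g (labels ω) (nearest fun m => (ω m).1) :=
  (measurable_of_finite fun p : (Fin n → Fin 2) × (Fin n → Fin n) => g p.1 p.2).comp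
    measurable_labels_nearest

lemma measurable_cellCount (i j : Fin 2) : Measurable fun ω : Fin n → Plane × Fin 2 =>
    (cellCount (labels ω) (nnLabels ω) i j : ℝ) :=
  Measurable.labels_nearest fun l η => (cellCount l (l ∘ η) i j : ℝ)

lemma cellCount_le_card (u v : Fin n → Fin 2) (i j : Fin 2) : (cellCount u v i j : ℝ) ≤ n := by
  refine Nat.cast_le.2 ((Finset.card_le_univ _).trans ?_)
  rw [Fintype.card_fin]

variable (μ : Fin n → Measure (Plane × Fin 2))

lemma meanCell_nonneg (i j : Fin 2) : 0 ≤ meanCell μ i j :=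
  integral_nonneg fun _ => Nat.cast_nonneg _

variable [∀ i, IsProbabilityMeasure (μ i)]

lemma integrable_cellCount (i j : Fin 2) : Integrable (fun ω : Fin n → Plane × Fin 2 =>
    (cellCount (labels ω) (nnLabels ω) i j : ℝ)) (Measure.pi μ) :=
  Integrable.of_bound (measurable_cellCount i j).aestronglyMeasurable n (ae_of_all _ fun ω => by
    rw [Real.norm_natCast]
    exact cellCount_le_card _ _ _ _)

lemma integral_labelCount (i : Fin 2) :
    ∫ ω, (labelCount (labels ω) i : ℝ) ∂(Measure.pi μ) = meanRow μ i := by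
  unfold meanRow meanCell
  rw [← integral_finsetSum _ fun j _ => integrable_cellCount μ i j]
  refine integral_congr_ae (ae_of_all _ fun ω => ?_)
  simp only
  rw [← rowSum_eq_labelCount (labels ω) (nnLabels ω)]
  unfold rowSum
  push_cast
  rfl

/-- Efron–Stein with the involvement numbers; the constant is `2 · 2 (25 + 1)`, where 25 is the
in-degree bound for distinct points of the plane. -/
lemma integral_sq_cellCount_sub_le (hn : 2 ≤ n)
    (hμ : ∀ i j, i ≠ j → ∀ᵐ ω ∂(Measure.pi μ), (ω i).1 ≠ (ω j).1) (i j : Fin 2) :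
    ∫ ω, ((cellCount (labels ω) (nnLabels ω) i j : ℝ) - meanCell μ i j) ^ 2 ∂(Measure.pi μ) ≤
      104 * meanRow μ i := by
  classical
  set h : Fin n → (Fin n → Plane × Fin 2) → ℝ := fun k ω =>
    pairInvolvement i k (labels ω) (nearest fun m => (ω m).1) with hh
  have hm : ∀ k, Measurable (h k) := fun k => Measurable.labels_nearest (pairInvolvement i k)
  have hB : ∀ k ω, |h k ω| ≤ 1 + n := by
    intro k ω
    rw [abs_of_nonneg (pairInvolvement_nonneg _ _ _ _)]
    refine add_le_add (by split_ifs <;> norm_num) ?_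
    refine (Finset.sum_le_card_nsmul _ _ 1 fun a _ => by split_ifs <;> norm_num).trans ?_
    simp
  have hES := integral_sq_sub_integral_le μ (B := 1 + n) (measurable_cellCount i j) hm (fun ω => by
    rw [Nat.abs_cast]
    linarith [cellCount_le_card (labels ω) (nnLabels ω) i j]) hB
    fun k ω ω' hk => abs_cellCount_sub_le i j k hk
  refine hES.trans ?_
  have hsq : ∀ k, Integrable (fun ω => h k ω ^ 2) (Measure.pi μ) := by
    intro k
    refine Integrable.of_bound (C := (1 + n) ^ 2) ((hm k).pow_const 2).aestronglyMeasurable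
      (ae_of_all _ fun ω => ?_)
    rw [Real.norm_eq_abs, abs_pow]
    exact pow_le_pow_left₀ (abs_nonneg _) (hB k ω) 2
  have hinj : ∀ᵐ ω ∂(Measure.pi μ), Function.Injective fun m => (ω m).1 := by
    filter_upwards [ae_all_iff.2 fun i => ae_all_iff.2 fun j => ae_all_iff.2 (hμ i j)] with ω hω a b hab
    by_contra hne
    exact hω a b hne hab
  have hlab : Integrable (fun ω => (labelCount (labels ω) i : ℝ)) (Measure.pi μ) := by
    refine Integrable.of_bound (C := n) (Measurable.labels_nearest fun l _ =>
      (labelCount l i : ℝ)).aestronglyMeasurable (ae_of_all _ fun ω => ?_)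
    rw [Real.norm_natCast]
    refine Nat.cast_le.2 ((Finset.card_le_univ _).trans ?_)
    rw [Fintype.card_fin]
  have hsum : ∑ k, ∫ ω, h k ω ^ 2 ∂(Measure.pi μ) ≤ 52 * meanRow μ i := by
    rw [← integral_finsetSum _ fun k _ => hsq k, ← integral_labelCount μ i, ← integral_const_mul]
    refine integral_mono_ae (integrable_finsetSum _ fun k _ => hsq k) (hlab.const_mul _) ?_
    filter_upwards [hinj] with ω hω
    have := sum_sq_pairInvolvement_le i (labels ω) (isBoundedMap_of_isNN hω (isNN_nearest hn _))
    refine this.trans (le_of_eq ?_)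
    norm_num
  linarith

/-- Chebyshev's inequality for the cells of the NNCT. -/
lemma measureReal_cellCount_sub_ge_le (hn : 2 ≤ n)
    (hμ : ∀ i j, i ≠ j → ∀ᵐ ω ∂(Measure.pi μ), (ω i).1 ≠ (ω j).1) (i j : Fin 2) {η : ℝ}
    (hη : 0 < η) (hM : 0 < meanRow μ i) :
    (Measure.pi μ).real {ω | η * meanRow μ i ≤
      |(cellCount (labels ω) (nnLabels ω) i j : ℝ) - meanCell μ i j|} ≤
      104 / (η ^ 2 * meanRow μ i) := by
  have hint : Integrable (fun ω =>
      ((cellCount (labels ω) (nnLabels ω) i j : ℝ) - meanCell μ i j) ^ 2) (Measure.pi μ) := by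
    refine Integrable.of_bound (C := (n + meanCell μ i j) ^ 2)
      (((measurable_cellCount i j).sub_const _).pow_const 2).aestronglyMeasurable
      (ae_of_all _ fun ω => ?_)
    rw [Real.norm_eq_abs, abs_pow]
    refine pow_le_pow_left₀ (abs_nonneg _) ((abs_sub _ _).trans ?_) 2
    rw [Nat.abs_cast, abs_of_nonneg (meanCell_nonneg μ i j)]
    linarith [cellCount_le_card (labels ω) (nnLabels ω) i j]
  have h := mul_meas_ge_le_integral_of_nonneg (ae_of_all _ fun ω => sq_nonneg _) hint
    ((η * meanRow μ i) ^ 2)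
  have hset : {ω : Fin n → Plane × Fin 2 | (η * meanRow μ i) ^ 2 ≤
      ((cellCount (labels ω) (nnLabels ω) i j : ℝ) - meanCell μ i j) ^ 2} =
      {ω | η * meanRow μ i ≤
        |(cellCount (labels ω) (nnLabels ω) i j : ℝ) - meanCell μ i j|} := by
    ext ω
    rw [Set.mem_ofPred_eq, Set.mem_ofPred_eq, ← sq_abs ((cellCount (labels ω) (nnLabels ω) i j : ℝ) - meanCell μ i j)]
    exact pow_le_pow_iff_left₀ (by positivity) (abs_nonneg _) two_ne_zero
  rw [hset] at h
  have h2 := h.trans (integral_sq_cellCount_sub_le μ hn hμ i j)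
  rw [le_div_iff₀ (by positivity)]
  have h3 : (η * meanRow μ i) ^ 2 = η ^ 2 * meanRow μ i * meanRow μ i := by ring
  rw [h3] at h2
  refine le_of_mul_le_mul_right ?_ hM
  linarith

end Mapped

/-- A table whose cells are close to given values with different row proportions has a large
value of Pielou's statistic. -/
lemma le_pielouStat_of_cells_near {ι : Type*} [Fintype ι] {u v : ι → Fin 2} {e : Fin 2 → Fin 2 → ℝ}
    {η ε M : ℝ} (he : ∀ i j, 0 ≤ e i j) (hη : 0 ≤ η) (hη4 : η ≤ 1 / 4) (hηε : 24 * η ≤ ε)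
    (hM : 0 < M) (hMe : ∀ i, 2 * M ≤ ∑ j, e i j)
    (hc : ∀ i j, |(cellCount u v i j : ℝ) - e i j| ≤ η * ∑ j, e i j)
    (hε : ε ≤ |e 0 0 / ∑ j, e 0 j - e 1 0 / ∑ j, e 1 j|) :
    2 * M * (ε / 2) ^ 2 ≤ pielouStat u v := by
  set m : Fin 2 → ℝ := fun i => ∑ j, e i j with hm
  have hm2 : ∀ i, m i = e i 0 + e i 1 := fun i => by simp [hm, Fin.sum_univ_two]
  have hm0 : ∀ i, 0 < m i := fun i => lt_of_lt_of_le (by linarith) (hMe i)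
  have hr : ∀ i, (rowSum u v i : ℝ) = cellCount u v i 0 + cellCount u v i 1 := by
    intro i
    unfold rowSum
    rw [Fin.sum_univ_two]
    push_cast
    rfl
  have hrow : ∀ i, m i / 2 ≤ rowSum u v i := by
    intro i
    have h0 := abs_le.1 (hc i 0)
    have h1 := abs_le.1 (hc i 1)
    have h2 : η * m i ≤ 1 / 4 * m i := mul_le_mul_of_nonneg_right hη4 (hm0 i).le
    rw [hr]
    have := hm2 i
    simp only [hm] at h2 this ⊢
    linarith [h0.1, h1.1]
  -- Numerator errors total `3 η m`, and the row sum is at least `m / 2`. Two rows lose at most `12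
  -- η ≤ ε / 2` of the separation.
  have hprop : ∀ i, |(cellCount u v i 0 : ℝ) / rowSum u v i - e i 0 / m i| ≤ 6 * η := by
    intro i
    have hr0 : (0 : ℝ) < rowSum u v i := lt_of_lt_of_le (by linarith [hm0 i]) (hrow i)
    have hkey : |(cellCount u v i 0 : ℝ) - e i 0 / m i * rowSum u v i| ≤ 3 * (η * m i) := by
      have h0 := abs_le.1 (hc i 0)
      have h1 := abs_le.1 (hc i 1)
      have hp0 : 0 ≤ e i 0 / m i := div_nonneg (he i 0) (hm0 i).le
      have hp1 : e i 0 / m i ≤ 1 := (div_le_one (hm0 i)).2 (by linarith [hm2 i, he i 1])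
      have heq : (cellCount u v i 0 : ℝ) - e i 0 / m i * rowSum u v i =
          (cellCount u v i 0 - e i 0) - e i 0 / m i * (rowSum u v i - m i) := by
        have : e i 0 / m i * m i = e i 0 := div_mul_cancel₀ _ (hm0 i).ne'
        rw [mul_sub, this]
        ring
      rw [heq]
      refine (abs_sub _ _).trans ?_
      have hd : |(rowSum u v i : ℝ) - m i| ≤ 2 * (η * m i) := by
        rw [hr, abs_le]
        have := hm2 i
        simp only [hm] at this ⊢
        constructor <;> linarith [h0.1, h0.2, h1.1, h1.2]
      rw [abs_mul, abs_of_nonneg hp0]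
      have : e i 0 / m i * |(rowSum u v i : ℝ) - m i| ≤ 1 * (2 * (η * m i)) :=
        mul_le_mul hp1 hd (abs_nonneg _) zero_le_one
      have h4 : |(cellCount u v i 0 : ℝ) - e i 0| ≤ η * m i := hc i 0
      linarith
    have : (cellCount u v i 0 : ℝ) / rowSum u v i - e i 0 / m i =
        (cellCount u v i 0 - e i 0 / m i * rowSum u v i) / rowSum u v i := by
      field_simp
    rw [this, abs_div, abs_of_pos hr0, div_le_iff₀ hr0]
    refine hkey.trans ?_
    have := mul_le_mul_of_nonneg_left (hrow i) hη
    linarith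
  refine le_trans ?_ (le_pielouStat u v hM ((show M ≤ m 0 / 2 by linarith [hMe 0]).trans (hrow 0))
    ((show M ≤ m 1 / 2 by linarith [hMe 1]).trans (hrow 1)))
  refine mul_le_mul_of_nonneg_left ?_ (by linarith)
  rw [← sq_abs ((cellCount u v 0 0 : ℝ) / _ - _)]
  have hε0 : 0 ≤ ε := by linarith
  refine pow_le_pow_left₀ (by linarith) ?_ 2
  have h0 := abs_le.1 (hprop 0)
  have h1 := abs_le.1 (hprop 1)
  rcases le_abs.1 hε with h | h
  · refine le_trans ?_ (le_abs_self _)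
    simp only [hm] at h0 h1
    linarith [h0.1, h1.2]
  · refine le_trans ?_ (neg_le_abs _)
    simp only [hm] at h0 h1
    linarith [h0.2, h1.1]

/-- Pielou's test is consistent for completely mapped data with independent points. -/
theorem mappedPower_tendsto_one (α : ℝ) {n : ℕ → ℕ} (μ : ∀ k, Fin (n k) → Measure (Plane × Fin 2))
    (hprob : ∀ k i, IsProbabilityMeasure (μ k i))
    (hμ : ∀ k i j, i ≠ j → ∀ᵐ ω ∂(Measure.pi (μ k)), (ω i).1 ≠ (ω j).1)
    (hrow : ∀ i, Tendsto (fun k => meanRow (μ k) i) atTop atTop)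
    {ε : ℝ} (hε : 0 < ε)
    (halt : ∀ᶠ k in atTop, ε ≤ |mappedRowProb (μ k) 0 0 - mappedRowProb (μ k) 1 0|) :
    Tendsto (fun k => mappedPower α (μ k)) atTop (𝓝 1) := by
  set η : ℝ := min (1 / 4) (ε / 24) with hη
  have hη0 : 0 < η := lt_min (by norm_num) (by positivity)
  set q := chiSqOneQuantile (1 - α) with hq
  -- With this choice the lower bound for the statistic is `|q| + 1`, above the critical value.
  set M : ℝ := (|q| + 1) / (2 * (ε / 2) ^ 2) with hM
  have hM0 : 0 < M := by positivity
  have hbound : ∀ᶠ k in atTop, 1 - ∑ i : Fin 2, ∑ _j : Fin 2, 104 / (η ^ 2 * meanRow (μ k) i) ≤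
      mappedPower α (μ k) := by
    filter_upwards [halt, (hrow 0).eventually_ge_atTop (max 2 (2 * M)),
      (hrow 1).eventually_ge_atTop (max 2 (2 * M))] with k ha h0 h1
    have hrowk : ∀ i, max 2 (2 * M) ≤ meanRow (μ k) i := by
      intro i
      fin_cases i
      · exact h0
      · exact h1
    have hpos : ∀ i, 0 < meanRow (μ k) i := fun i =>
      lt_of_lt_of_le (lt_of_lt_of_le two_pos (le_max_left _ _)) (hrowk i)
    -- A mean class size of at least 2 forces two points, so that nearest neighbours exist.
    have hn : 2 ≤ n k := by
      have h := (le_max_left _ _).trans (hrowk 0)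
      rw [← integral_labelCount] at h
      have h2 : ∫ ω, (labelCount (labels ω) 0 : ℝ) ∂(Measure.pi (μ k)) ≤ n k := by
        refine (integral_mono_of_nonneg (ae_of_all _ fun ω => Nat.cast_nonneg _)
          (integrable_const (n k : ℝ)) (ae_of_all _ fun ω => ?_)).trans (by simp)
        refine Nat.cast_le.2 ((Finset.card_le_univ _).trans ?_)
        rw [Fintype.card_fin]
      exact_mod_cast h.trans h2
    set bad : Fin 2 → Fin 2 → Set (Fin (n k) → Plane × Fin 2) := fun i j =>
      {ω | η * meanRow (μ k) i ≤
        |(cellCount (labels ω) (nnLabels ω) i j : ℝ) - meanCell (μ k) i j|} with hbad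
    have hcover : (Set.univ : Set (Fin (n k) → Plane × Fin 2)) ⊆
        {ω | PielouRejects α (labels ω) (nnLabels ω)} ∪
          ⋃ i ∈ (Finset.univ : Finset (Fin 2)), ⋃ j ∈ (Finset.univ : Finset (Fin 2)), bad i j := by
      intro ω _
      by_cases hω : ∀ i j, |(cellCount (labels ω) (nnLabels ω) i j : ℝ) - meanCell (μ k) i j| ≤
          η * meanRow (μ k) i
      · left
        have := le_pielouStat_of_cells_near (u := labels ω) (v := nnLabels ω) (e := meanCell (μ k))
          (meanCell_nonneg (μ k)) hη0.le (min_le_left _ _)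
          (by linarith [min_le_right (1 / 4 : ℝ) (ε / 24)]) hM0
          (fun i => (le_max_right _ _).trans (hrowk i)) hω ha
        have hMq : 2 * M * (ε / 2) ^ 2 = |q| + 1 := by
          rw [hM]
          field_simp
        change q < _
        linarith [le_abs_self q]
      · right
        push Not at hω
        obtain ⟨i, j, hij⟩ := hω
        simp only [Set.mem_iUnion]
        exact ⟨i, Finset.mem_univ i, j, Finset.mem_univ j, hij.le⟩
    have hone := (measureReal_mono (μ := Measure.pi (μ k)) hcover).trans (measureReal_union_le _ _)
    rw [probReal_univ] at hone
    have hbads : (Measure.pi (μ k)).real (⋃ i ∈ (Finset.univ : Finset (Fin 2)),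
        ⋃ j ∈ (Finset.univ : Finset (Fin 2)), bad i j) ≤
        ∑ i : Fin 2, ∑ _j : Fin 2, 104 / (η ^ 2 * meanRow (μ k) i) := by
      refine (measureReal_biUnion_finset_le _ _).trans (Finset.sum_le_sum fun i _ => ?_)
      refine (measureReal_biUnion_finset_le _ _).trans (Finset.sum_le_sum fun j _ => ?_)
      exact measureReal_cellCount_sub_ge_le (μ k) hn (hμ k) i j hη0 (hpos i)
    change _ ≤ (Measure.pi (μ k)).real _
    linarith
  have hlim : Tendsto (fun k => 1 - ∑ i : Fin 2, ∑ _j : Fin 2, 104 / (η ^ 2 * meanRow (μ k) i))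
      atTop (𝓝 1) := by
    have h : Tendsto (fun k => ∑ i : Fin 2, ∑ _j : Fin 2, 104 / (η ^ 2 * meanRow (μ k) i)) atTop
        (𝓝 (∑ _i : Fin 2, ∑ _j : Fin 2, (0 : ℝ))) :=
      tendsto_finsetSum _ fun i _ => tendsto_finsetSum _ fun j _ =>
        ((hrow i).const_mul_atTop (by positivity)).const_div_atTop 104
    simpa using h.const_sub 1
  exact tendsto_of_tendsto_of_tendsto_of_le_of_le' hlim tendsto_const_nhds hbound
    (Eventually.of_forall fun k => measureReal_le_one)

theorem theorem2 (α : ℝ) (hα : 0 < α) (hα' : α < 1) :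
    -- (I), class sizes given: asymptotic size `α`, and consistency
    (∀ (m₁ m₂ : ℕ → ℕ), Tendsto m₁ atTop atTop → Tendsto m₂ atTop atTop →
      ∀ P : Fin 2 → Measure (Fin 2), (∀ i, IsProbabilityMeasure (P i)) →
        ((P 0).real {0} = (P 1).real {0} → 0 < (P 0).real {0} → (P 0).real {0} < 1 →
          Tendsto (fun k => rowwisePower α P (m₁ k) (m₂ k)) atTop (𝓝 α)) ∧
        ((P 0).real {0} ≠ (P 1).real {0} →
          Tendsto (fun k => rowwisePower α P (m₁ k) (m₂ k)) atTop (𝓝 1))) ∧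
    -- (I), independent identically distributed pairs: asymptotic size `α`, and consistency
    (∀ P : Measure (Fin 2 × Fin 2), IsProbabilityMeasure P →
      0 < P.real {p | p.1 = 0} → 0 < P.real {p | p.1 = 1} →
        (rowProb P 0 0 = rowProb P 1 0 → 0 < rowProb P 0 0 → rowProb P 0 0 < 1 →
          Tendsto (fun n => samplePower α P n) atTop (𝓝 α)) ∧
        (rowProb P 0 0 ≠ rowProb P 1 0 →
          Tendsto (fun n => samplePower α P n) atTop (𝓝 1))) ∧
    -- (II), random labelling: the asymptotic level exceeds `α`
    (∀ (m₁ m₂ : ℕ → ℕ), Tendsto (fun k => m₁ k + m₂ k) atTop atTop →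
      ∀ c : ℝ, 0 < c →
      (∀ᶠ k in atTop, c * ((m₁ k : ℝ) + m₂ k) ≤ m₁ k ∧ c * ((m₁ k : ℝ) + m₂ k) ≤ m₂ k) →
      ∀ (x : ∀ k, Fin (m₁ k + m₂ k) → Plane) (nn : ∀ k, Fin (m₁ k + m₂ k) → Fin (m₁ k + m₂ k)),
        (∀ᶠ k in atTop, Function.Injective (x k) ∧ ∀ i, IsNN (x k) i (nn k i)) →
        (∀ᶠ k in atTop, c * ((m₁ k : ℝ) + m₂ k) ≤ reflexiveCount (nn k)) →
        ∃ δ : ℝ, 0 < δ ∧ ∀ᶠ k in atTop, α + δ ≤ rlLevel α (m₁ k) (m₂ k) (nn k)) ∧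
    -- (II), CSR independence: the asymptotic level exceeds `α`
    (∀ D : Set Plane, MeasurableSet D → volume D ≠ 0 → volume D ≠ ⊤ →
      ∀ (m₁ m₂ : ℕ → ℕ), Tendsto (fun k => m₁ k + m₂ k) atTop atTop →
      ∀ c : ℝ, 0 < c →
      (∀ᶠ k in atTop, c * ((m₁ k : ℝ) + m₂ k) ≤ m₁ k ∧ c * ((m₁ k : ℝ) + m₂ k) ≤ m₂ k) →
        ∃ δ : ℝ, 0 < δ ∧ ∀ᶠ k in atTop, α + δ ≤ csrLevel α D (m₁ k) (m₂ k)) ∧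
    -- (II), consistency for completely mapped data
    (∀ (n : ℕ → ℕ) (μ : ∀ k, Fin (n k) → Measure (Plane × Fin 2)),
      (∀ k i, IsProbabilityMeasure (μ k i)) →
      (∀ k i j, i ≠ j → ∀ᵐ ω ∂(Measure.pi (μ k)), (ω i).1 ≠ (ω j).1) →
      (∀ i, Tendsto (fun k => meanRow (μ k) i) atTop atTop) →
      (∃ ε : ℝ, 0 < ε ∧
        ∀ᶠ k in atTop, ε ≤ |mappedRowProb (μ k) 0 0 - mappedRowProb (μ k) 1 0|) →
        Tendsto (fun k => mappedPower α (μ k)) atTop (𝓝 1)) := by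
  refine ⟨fun m₁ m₂ h1 h2 P hP => ⟨fun heq hp0 hp1 => ?_, fun hne => ?_⟩,
    fun P hP h0 h1 => ⟨fun heq hp0 hp1 => ?_, fun hne => ?_⟩,
    fun m₁ m₂ hm c hc hmc x nn hnn hR => rlLevel_liberal hα hα' hm hc hmc x nn hnn hR,
    fun D hD h0 h1 m₁ m₂ hm c hc hmc => csrLevel_liberal hα hα' hD h0 h1 hm hc hmc,
    fun n μ hprob hμ hrow ⟨ε, hε, halt⟩ => mappedPower_tendsto_one α μ hprob hμ hrow hε halt⟩
  · exact rowwisePower_tendsto_size hα hα' h1 h2 P hP heq hp0 hp1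
  · exact rowwisePower_tendsto_one α h1 h2 P hP hne
  · exact samplePower_tendsto_size P hα hα' h0 h1 heq hp0 hp1
  · exact samplePower_tendsto_one P α h0 h1 hne
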